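/- Let $M$ be a smooth manifold. A Courant algebroid over $M$ is a smooth real vector bundle $E\to M$ of finite rank with a smooth nondegenerate symmetric bilinear form $\langle\cdot,\cdot\rangle$ on the fibres, a smooth bundle map $\pi:E\to TM$ (the anchor) and an $\mathbb R$-bilinear map $[\cdot,\cdot]:\Gamma(E)\times\Gamma(E)\to\Gamma(E)$ (the Dorfman bracket) such that, for all $u,v,w\in\Gamma(E)$, $$[u,[v,w]]=[[u,v],w]+[v,[u,w]],\quad \pi(u)\langle v,w\rangle=\langle[u,v],w\rangle+\langle v,[u,w]\rangle,\quad \langle[u,v],w\rangle+\langle[v,u],w\rangle=\pi(w)\langle u,v\rangle .$$ It is called transitive if $\pi$ is surjective on every fibre. A quadratic Lie algebra is a finite-dimensional real Lie algebra $\mathfrak g$ with a nondegenerate symmetric $\mathrm{ad}$-invariant bilinear form $\langle\cdot,\cdot\rangle_{\mathfrak g}$. The untwisted Courant algebroid over an open set $U\subset M$ with fibre $\mathfrak g$ is the bundle $TU\oplus T^*U\oplus(U\times\mathfrak g)$ with anchor the projection to $TU$, with scalar product $$\langle X+\xi+r,\,Y+\eta+s\rangle=\tfrac12\bigl(\xi(Y)+\eta(X)\bigr)+\langle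 r,s\rangle_{\mathfrak g},$$ and with the Dorfman bracket given by the trivial connection on $U\times\mathfrak g$, $R=0$ and $H=0$, that is $$[X+\xi+r,\,Y+\eta+s]=[X,Y]+\bigl(\mathcal L_X\eta-i_Yd\xi+2\langle dr,s\rangle_{\mathfrak g}\bigr)+\bigl(X(s)-Y(r)+[r,s]_{\mathfrak g}\bigr).$$ Proposition. Every transitive Courant algebroid $E$ over $M$ is locally isomorphic to an untwisted one: every point $p\in M$ has an open neighbourhood $U$ for which there are a quadratic Lie algebra $\mathfrak g$ and a smooth vector bundle isomorphism $E|_U\to TU\oplus T^*U\oplus(U\times\mathfrak g)$ over the identity of $U$ which preserves the scalar products, the anchors and the Dorfman brackets. -/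

import Mathlib

open Bundle VectorField
open scoped Manifold ContDiff

noncomputable section

/-- The structure of a quadratic Lie algebra on a real vector space `𝔤`: a Lie bracket together with
a nondegenerate symmetric bilinear form (of any signature) which is `ad`-invariant. -/
structure QuadraticLieAlgebra (𝔤 : Type*) [AddCommGroup 𝔤] [Module ℝ 𝔤] where
  /-- The Lie bracket. -/
  bracket : 𝔤 →ₗ[ℝ] 𝔤 →ₗ[ℝ] 𝔤
  /-- The scalar product. -/
  form : 𝔤 →ₗ[ℝ] 𝔤 →ₗ[ℝ] ℝ
  bracket_self : ∀ a, bracket a a = 0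
  jacobi : ∀ a b c, bracket a (bracket b c) = bracket (bracket a b) c + bracket b (bracket a c)
  form_symm : ∀ a b, form a b = form b a
  form_nondegenerate : ∀ a, (∀ b, form a b = 0) → a = 0
  form_invariant : ∀ a b c, form (bracket a b) c + form b (bracket a c) = 0

/-- A Courant algebroid structure on a smooth real vector bundle `V` (with model fibre `F`) over the
smooth `m`-dimensional manifold `M`. The scalar product and the anchor are given fibrewise and are
required to be smooth, i.e. to map smooth sections to smooth functions, respectively to smooth
vector fields. The Dorfman bracket is an `ℝ`-bilinear operation on the space of smooth global
sections. -/
structure CourantAlgebroid (m : ℕ) {M : Type*} [TopologicalSpace M]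
    [ChartedSpace (EuclideanSpace ℝ (Fin m)) M] [IsManifold (𝓡 m) ∞ M]
    (F : Type*) [NormedAddCommGroup F] [NormedSpace ℝ F]
    (V : M → Type*) [TopologicalSpace (TotalSpace F V)]
    [∀ x, TopologicalSpace (V x)] [∀ x, AddCommGroup (V x)] [∀ x, Module ℝ (V x)]
    [FiberBundle F V] [VectorBundle ℝ F V] where
  /-- The scalar product `⟨·,·⟩`. -/
  pairing : ∀ x, V x →ₗ[ℝ] V x →ₗ[ℝ] ℝ
  /-- The anchor `π`. -/
  anchor : ∀ x, V x →ₗ[ℝ] TangentSpace (𝓡 m) x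
  /-- The Dorfman bracket `[·,·]`. -/
  bracket : Cₛ^∞⟮𝓡 m; F, V⟯ →ₗ[ℝ] Cₛ^∞⟮𝓡 m; F, V⟯ →ₗ[ℝ] Cₛ^∞⟮𝓡 m; F, V⟯
  pairing_smooth : ∀ u v : Cₛ^∞⟮𝓡 m; F, V⟯,
    ContMDiff (𝓡 m) 𝓘(ℝ, ℝ) ∞ (fun x ↦ pairing x (u x) (v x))
  pairing_symm : ∀ x a b, pairing x a b = pairing x b a
  pairing_nondegenerate : ∀ x a, (∀ b, pairing x a b = 0) → a = 0
  anchor_smooth : ∀ u : Cₛ^∞⟮𝓡 m; F, V⟯,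
    ContMDiff (𝓡 m) (𝓡 m).tangent ∞
      (fun x ↦ (⟨x, anchor x (u x)⟩ : TangentBundle (𝓡 m) M))
  /-- `[u, [v, w]] = [[u, v], w] + [v, [u, w]]`. -/
  bracket_jacobi : ∀ u v w : Cₛ^∞⟮𝓡 m; F, V⟯,
    bracket u (bracket v w) = bracket (bracket u v) w + bracket v (bracket u w)
  /-- `π(u)⟨v, w⟩ = ⟨[u, v], w⟩ + ⟨v, [u, w]⟩`. -/
  bracket_pairing : ∀ (u v w : Cₛ^∞⟮𝓡 m; F, V⟯) (x : M),
    mvfderiv (𝓡 m) (fun y ↦ pairing y (v y) (w y)) x (anchor x (u x)) =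
      pairing x (bracket u v x) (w x) + pairing x (v x) (bracket u w x)
  /-- `⟨[u, v], w⟩ + ⟨[v, u], w⟩ = π(w)⟨u, v⟩`. -/
  bracket_symm : ∀ (u v w : Cₛ^∞⟮𝓡 m; F, V⟯) (x : M),
    pairing x (bracket u v x) (w x) + pairing x (bracket v u x) (w x) =
      mvfderiv (𝓡 m) (fun y ↦ pairing y (u y) (v y)) x (anchor x (w x))

namespace CourantAlgebroid

variable {m : ℕ} {M : Type*} [TopologicalSpace M]
  [ChartedSpace (EuclideanSpace ℝ (Fin m)) M]

/-- The exterior derivative `(dξ)(v, w)` of a `1`-form `ξ` at `x`, computed in the chart around `x`: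
the `1`-form is pulled back along the inverse of the chart, its total derivative is antisymmetrized
(`dξ(v, w) = ∂_v ξ(w) - ∂_w ξ(v)`), and the result is pulled back by the chart. -/
def dOneForm (ξ : ∀ x : M, TangentSpace (𝓡 m) x →L[ℝ] ℝ) (x : M) :
    TangentSpace (𝓡 m) x →L[ℝ] TangentSpace (𝓡 m) x →L[ℝ] ℝ :=
  let D : EuclideanSpace ℝ (Fin m) →L[ℝ] EuclideanSpace ℝ (Fin m) →L[ℝ] ℝ :=
    fderiv ℝ (fun y : EuclideanSpace ℝ (Fin m) ↦
      (ξ ((extChartAt (𝓡 m) x).symm y)).comp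
        (mfderiv 𝓘(ℝ, EuclideanSpace ℝ (Fin m)) (𝓡 m) (extChartAt (𝓡 m) x).symm y))
      (extChartAt (𝓡 m) x x)
  let A : TangentSpace (𝓡 m) x →L[ℝ] EuclideanSpace ℝ (Fin m) :=
    mvfderiv (𝓡 m) (extChartAt (𝓡 m) x) x
  (ContinuousLinearMap.precomp ℝ A).comp ((D - D.flip).comp A)

/-- The Lie derivative of a `1`-form along a vector field: `L_X η = d(η(X)) + i_X dη`. -/
def lieDerivOneForm (X : ∀ x : M, TangentSpace (𝓡 m) x)
    (η : ∀ x : M, TangentSpace (𝓡 m) x →L[ℝ] ℝ) (x : M) : TangentSpace (𝓡 m) x →L[ℝ] ℝ :=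
  mvfderiv (𝓡 m) (fun y ↦ η y (X y)) x + dOneForm η x (X x)

/-- The fibre at `x` of the bundle `TM ⊕ T*M ⊕ (M × 𝔤)`. -/
abbrev UntwistedFiber (m : ℕ) {M : Type*} [TopologicalSpace M]
    [ChartedSpace (EuclideanSpace ℝ (Fin m)) M] (𝔤 : Type*) [NormedAddCommGroup 𝔤]
    [NormedSpace ℝ 𝔤] (x : M) : Type _ :=
  TangentSpace (𝓡 m) x × (TangentSpace (𝓡 m) x →L[ℝ] ℝ) × 𝔤

variable {𝔤 : Type*} [NormedAddCommGroup 𝔤] [NormedSpace ℝ 𝔤]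

/-- Smoothness over `U` of a section `X + ξ + r` of `TM ⊕ T*M ⊕ (M × 𝔤)`: the vector field, the
`1`-form and the `𝔤`-valued function are smooth over `U`. -/
def IsSmoothSectionOn [IsManifold (𝓡 m) ∞ M]
    (a : ∀ x : M, UntwistedFiber m 𝔤 x) (U : Set M) : Prop :=
  ContMDiffOn (𝓡 m) (𝓡 m).tangent ∞
    (fun x ↦ (⟨x, (a x).1⟩ : TangentBundle (𝓡 m) M)) U ∧
  ContMDiffOn (𝓡 m) ((𝓡 m).prod 𝓘(ℝ, EuclideanSpace ℝ (Fin m) →L[ℝ] ℝ)) ∞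
    (fun x ↦ TotalSpace.mk' (EuclideanSpace ℝ (Fin m) →L[ℝ] ℝ)
      (E := fun x : M ↦ TangentSpace (𝓡 m) x →L[ℝ] ℝ) x (a x).2.1) U ∧
  ContMDiffOn (𝓡 m) 𝓘(ℝ, 𝔤) ∞ (fun x ↦ (a x).2.2) U

/-- The scalar product `⟨X + ξ + r, Y + η + s⟩ = ½ (ξ(Y) + η(X)) + ⟨r, s⟩` of
`TM ⊕ T*M ⊕ (M × 𝔤)`. -/
def untwistedPairing (Q : QuadraticLieAlgebra 𝔤) (x : M) (a b : UntwistedFiber m 𝔤 x) : ℝ :=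
  (1 / 2 : ℝ) * (a.2.1 b.1 + b.2.1 a.1) + Q.form a.2.2 b.2.2

/-- The Dorfman bracket of the untwisted Courant algebroid `TM ⊕ T*M ⊕ (M × 𝔤)`, i.e. the one with
the trivial connection on `M × 𝔤`, with `R = 0` and with `H = 0`. For `u = X + ξ + r` and
`v = Y + η + s` it is
`[u, v] = [X, Y] + (L_X η - i_Y dξ + 2 ⟨dr, s⟩) + (X(s) - Y(r) + [r, s])`. -/
def untwistedBracket [FiniteDimensional ℝ 𝔤] (Q : QuadraticLieAlgebra 𝔤)
    (u v : ∀ x : M, UntwistedFiber m 𝔤 x) (x : M) : UntwistedFiber m 𝔤 x :=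
  let X : ∀ y : M, TangentSpace (𝓡 m) y := fun y ↦ (u y).1
  let ξ : ∀ y : M, TangentSpace (𝓡 m) y →L[ℝ] ℝ := fun y ↦ (u y).2.1
  let r : M → 𝔤 := fun y ↦ (u y).2.2
  let Y : ∀ y : M, TangentSpace (𝓡 m) y := fun y ↦ (v y).1
  let η : ∀ y : M, TangentSpace (𝓡 m) y →L[ℝ] ℝ := fun y ↦ (v y).2.1
  let s : M → 𝔤 := fun y ↦ (v y).2.2
  (mlieBracket (𝓡 m) X Y x,
   lieDerivOneForm X η x - dOneForm ξ x (Y x) +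
     (2 : ℝ) • (LinearMap.toContinuousLinearMap (Q.form (s x))).comp (mvfderiv (𝓡 m) r x),
   mvfderiv (𝓡 m) s x (X x) - mvfderiv (𝓡 m) r x (Y x) + Q.bracket (r x) (s x))

variable [IsManifold (𝓡 m) ∞ M]
  {F : Type*} [NormedAddCommGroup F] [NormedSpace ℝ F]
  {V : M → Type*} [TopologicalSpace (TotalSpace F V)]
  [∀ x, TopologicalSpace (V x)] [∀ x, AddCommGroup (V x)] [∀ x, Module ℝ (V x)]
  [FiberBundle F V] [VectorBundle ℝ F V]

/-- A Courant algebroid is transitive if its anchor is fibrewise surjective. -/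
def IsTransitive (C : CourantAlgebroid m F V) : Prop :=
  ∀ x, Function.Surjective (C.anchor x)

/-- An isomorphism, covering the identity of the open set `U`, from the restriction to `U` of the
Courant algebroid `C` to the untwisted Courant algebroid `TU ⊕ T*U ⊕ (U × 𝔤)`: a smooth isomorphism
of vector bundles over `U` which preserves the scalar products, the anchors and the Dorfman
brackets. (The Dorfman brackets are local operators and every section over `U` agrees near any point
of `U` with the restriction of a global section, so that it suffices to compare the brackets
on restrictions of global sections. The values of `toFun` outside `U` play no role.) -/
structure UntwistedIsoOn [FiniteDimensional ℝ 𝔤] (C : CourantAlgebroid m F V)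
    (Q : QuadraticLieAlgebra 𝔤) (U : TopologicalSpace.Opens M) where
  /-- The linear maps between the fibres. -/
  toFun : ∀ x : M, V x →ₗ[ℝ] UntwistedFiber m 𝔤 x
  bijective : ∀ x ∈ U, Function.Bijective (toFun x)
  /-- The map and its inverse are smooth over `U`: an arbitrary section of `V` is smooth over an
  open set `W ⊆ U` if and only if its image is. -/
  smooth_iff : ∀ W : TopologicalSpace.Opens M, W ≤ U → ∀ u : ∀ x, V x,
    ContMDiffOn (𝓡 m) ((𝓡 m).prod 𝓘(ℝ, F)) ∞ (fun x ↦ TotalSpace.mk' F x (u x)) W ↔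
      IsSmoothSectionOn (fun x ↦ toFun x (u x)) (W : Set M)
  map_pairing : ∀ x ∈ U, ∀ a b : V x,
    untwistedPairing Q x (toFun x a) (toFun x b) = C.pairing x a b
  map_anchor : ∀ x ∈ U, ∀ a : V x, (toFun x a).1 = C.anchor x a
  map_bracket : ∀ (u v : Cₛ^∞⟮𝓡 m; F, V⟯), ∀ x ∈ U,
    toFun x (C.bracket u v x) =
      untwistedBracket Q (fun y ↦ toFun y (u y)) (fun y ↦ toFun y (v y)) x

end CourantAlgebroid

end

/-!
Why a transitive Courant algebroid is locally untwisted. The argument takes place in the module of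
germs at `p` of sections of `E`, over the ring of germs of functions; what is used of the geometry
is recorded in `DorfmanAlgebra.IsChart`, so that the main step is algebraic.

The nondegeneracy of the scalar product gives every coordinate `xⱼ` a gradient `dⱼ`, which the
anchor annihilates. One lifts the coordinate vector fields `∂ₖ` one after the other to sections
`eₖ` which are isotropic, mutually orthogonal and commute for the Dorfman bracket, and which
annihilate a common frame (`DorfmanAlgebra.IsChart.exists_isFlat`). Given the lifts so far, their
common parallel frame allows one to choose a lift of the next vector field which commutes with
them: the coefficients of an arbitrary lift in this frame are frozen at `p` and the anchors are
then corrected by the inverse of a matrix of functions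
(`DorfmanAlgebra.IsChart.IsFlat.exists_lift`). The subtraction of gradients makes this lift
isotropic and orthogonal to the previous ones. A new parallel frame is obtained by solving a
linear differential equation along `∂ₖ` with initial values on the hyperplane `xₖ = xₖ(p)`
(`DorfmanAlgebra.IsChart.IsFlat.exists_frame`). The solution exists and is smooth by
`exists_contDiffAt_solution_linear`, where smoothness in the parameters comes from the smoothness
of inversion in a Banach algebra of Volterra operators.

The sections which commute with all `eₖ` and are orthogonal to all `eₖ` and `dⱼ` are closed under
the bracket, their scalar products are constant, and in a parallel frame they have constant
coefficients. They form the quadratic Lie algebra, and together with the `eₖ` and the `dⱼ` they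
span `E` (`DorfmanAlgebra.IsChart.exists_isUntwisted`).

The hypotheses hold for the germs of sections of `E` (`CourantAlgebroid.isChart_germAlgebra`), and
identities between germs are identities in a neighbourhood of `p`. On this neighbourhood the map
given by the anchor and by the scalar products with the `eₖ` and with the sections of the Lie
algebra (`CourantAlgebroid.toUntwisted`) is the isomorphism: it takes `eₖ`, `dⱼ` and `a` to `∂ₖ`,
`2 dxⱼ` and the constant section `a`. It is compatible with the brackets of arbitrary sections
since both brackets are determined by those of these sections and by the Leibniz rule.
-/

open Set Filter Topology

noncomputable section

/-! ### Linear differential equations with smooth parameters -/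

section CurveSpace

/-- The interval `[-1, 1]`. -/
abbrev symmInterval : Set ℝ := Icc (-1) 1

/-- The Banach space of continuous functions `[-1, 1] → X`, with the supremum norm. -/
def CurveSpace (X : Type*) [NormedAddCommGroup X] : Type _ := C(symmInterval, X)

namespace CurveSpace

variable {X : Type*} [NormedAddCommGroup X]

instance : NormedAddCommGroup (CurveSpace X) :=
  inferInstanceAs (NormedAddCommGroup C(symmInterval, X))

instance [NormedSpace ℝ X] : NormedSpace ℝ (CurveSpace X) :=
  inferInstanceAs (NormedSpace ℝ C(symmInterval, X))

instance [CompleteSpace X] : CompleteSpace (CurveSpace X) :=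
  inferInstanceAs (CompleteSpace C(symmInterval, X))

/-- A curve, extended to `ℝ` by constants. -/
def eval (u : CurveSpace X) : ℝ → X :=
  IccExtend (by norm_num : (-1 : ℝ) ≤ 1) (ContinuousMap.toFun u)

/-- The restriction to `[-1, 1]` of a continuous function on `ℝ`. -/
def ofFun (f : ℝ → X) (hf : Continuous f) : CurveSpace X :=
  (⟨fun s ↦ f s, hf.comp continuous_subtype_val⟩ : C(symmInterval, X))

lemma continuous_eval (u : CurveSpace X) : Continuous u.eval :=
  (ContinuousMap.continuous_toFun u).Icc_extend'

lemma eval_ofFun (f : ℝ → X) (hf : Continuous f) {s : ℝ} (hs : s ∈ symmInterval) :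
    (ofFun f hf).eval s = f s := IccExtend_of_mem _ _ hs

lemma ext_eval {u v : CurveSpace X} (h : ∀ s ∈ symmInterval, u.eval s = v.eval s) : u = v := by
  refine ContinuousMap.ext (f := u) (g := v) fun s ↦ ?_
  have := h s s.2
  rwa [eval, eval, IccExtend_of_mem _ _ s.2, IccExtend_of_mem _ _ s.2] at this

lemma eval_add (u v : CurveSpace X) (s : ℝ) : (u + v).eval s = u.eval s + v.eval s := rfl

lemma eval_sub (u v : CurveSpace X) (s : ℝ) : (u - v).eval s = u.eval s - v.eval s := rfl

lemma eval_smul [NormedSpace ℝ X] (c : ℝ) (u : CurveSpace X) (s : ℝ) :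
    (c • u).eval s = c • u.eval s := rfl

lemma norm_eval_le (u : CurveSpace X) (s : ℝ) : ‖u.eval s‖ ≤ ‖u‖ :=
  ContinuousMap.norm_coe_le_norm (α := symmInterval) (E := X) u _

lemma norm_le_of_eval {u : CurveSpace X} {c : ℝ} (hc : 0 ≤ c)
    (h : ∀ s ∈ symmInterval, ‖u.eval s‖ ≤ c) : ‖u‖ ≤ c := by
  refine (ContinuousMap.norm_le (α := symmInterval) (E := X) u hc).2 fun s ↦ ?_
  have := h s s.2
  rwa [eval, IccExtend_of_mem _ _ s.2] at this

/-- Evaluation at a point, as a continuous linear map. -/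
def evalCLM [NormedSpace ℝ X] (s : ℝ) : CurveSpace X →L[ℝ] X :=
  LinearMap.mkContinuous ⟨⟨fun u ↦ u.eval s, fun _ _ ↦ rfl⟩, fun _ _ ↦ rfl⟩ 1 fun u ↦ by
    rw [one_mul]; exact norm_eval_le u s

variable (X) in
/-- A curve of continuous linear maps, seen as a continuous linear map into the space of curves. -/
def applyCLM (E : Type*) [NormedAddCommGroup E] [NormedSpace ℝ E] [NormedSpace ℝ X] :
    CurveSpace (E →L[ℝ] X) →L[ℝ] E →L[ℝ] CurveSpace X :=
  LinearMap.mkContinuous₂ (LinearMap.mk₂ ℝ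
      (fun (T : CurveSpace (E →L[ℝ] X)) (v : E) ↦
        ofFun (fun s ↦ T.eval s v) (T.continuous_eval.clm_apply continuous_const))
      (fun S T v ↦ ext_eval fun s hs ↦ by simp [eval_ofFun _ _ hs, eval_add])
      (fun c T v ↦ ext_eval fun s hs ↦ by simp [eval_ofFun _ _ hs, eval_smul])
      (fun T v w ↦ ext_eval fun s hs ↦ by simp [eval_ofFun _ _ hs, eval_add])
      (fun c T v ↦ ext_eval fun s hs ↦ by simp [eval_ofFun _ _ hs, eval_smul])) 1 fun T v ↦ by
    rw [one_mul]
    refine norm_le_of_eval (by positivity) fun s hs ↦ ?_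
    rw [LinearMap.mk₂_apply, eval_ofFun _ _ hs]
    exact (T.eval s).le_of_opNorm_le (norm_eval_le T s) v

lemma eval_applyCLM {E : Type*} [NormedAddCommGroup E] [NormedSpace ℝ E] [NormedSpace ℝ X]
    (T : CurveSpace (E →L[ℝ] X)) (v : E) {s : ℝ} (hs : s ∈ symmInterval) :
    (applyCLM X E T v).eval s = T.eval s v := eval_ofFun _ _ hs

end CurveSpace

open CurveSpace

/-- The curve `s ↦ H (y, s)`, depending on the parameter `y`. -/
def curveAt {E X : Type*} [TopologicalSpace E] [NormedAddCommGroup X]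
    (H : E × ℝ → X) (hH : Continuous H) (y : E) : CurveSpace X :=
  ofFun (fun s ↦ H (y, s)) (by fun_prop)

lemma eval_curveAt {E X : Type*} [TopologicalSpace E] [NormedAddCommGroup X]
    (H : E × ℝ → X) (hH : Continuous H) (y : E) {s : ℝ} (hs : s ∈ symmInterval) :
    (curveAt H hH y).eval s = H (y, s) := eval_ofFun _ _ hs

lemma continuous_curveAt {E X : Type*} [TopologicalSpace E] [NormedAddCommGroup X]
    (H : E × ℝ → X) (hH : Continuous H) : Continuous (curveAt H hH) :=
  (ContinuousMap.curry ⟨fun q : E × symmInterval ↦ H (q.1, q.2), by fun_prop⟩).continuous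

/-- Differentiation in the parameter is uniform along the compact interval, by the mean value
inequality. -/
lemma hasFDerivAt_curveAt {E : Type*} {X : Type*} [NormedAddCommGroup E] [NormedSpace ℝ E]
    [NormedAddCommGroup X] [NormedSpace ℝ X] (H : E × ℝ → X)
    (hH : Continuous H) (H' : E × ℝ → E →L[ℝ] X) (hH' : Continuous H')
    (hd : ∀ y s, HasFDerivAt (fun y ↦ H (y, s)) (H' (y, s)) y) (y : E) :
    HasFDerivAt (curveAt H hH) (applyCLM X E (curveAt H' hH' y)) y := by
  refine HasFDerivAt.of_isLittleO (Asymptotics.isLittleO_iff.2 fun ε hε ↦ ?_)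
  have h1 : Continuous fun w ↦ ‖curveAt H' hH' w - curveAt H' hH' y‖ :=
    ((continuous_curveAt H' hH').sub continuous_const).norm
  have h2 : ∀ᶠ w in 𝓝 y, ‖curveAt H' hH' w - curveAt H' hH' y‖ < ε :=
    h1.continuousAt.eventually_lt continuousAt_const (by simpa using hε)
  obtain ⟨δ, hδ, hball⟩ := Metric.eventually_nhds_iff_ball.1 h2
  filter_upwards [Metric.ball_mem_nhds y hδ] with z hz
  refine norm_le_of_eval (by positivity) fun s hs ↦ ?_
  rw [eval_sub, eval_sub, eval_curveAt _ _ _ hs, eval_curveAt _ _ _ hs, eval_applyCLM _ _ hs,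
    eval_curveAt _ _ _ hs]
  refine Convex.norm_image_sub_le_of_norm_hasFDerivWithin_le' (f := fun y ↦ H (y, s))
    (f' := fun y ↦ H' (y, s)) (φ := H' (y, s))
    (fun w _ ↦ (hd w s).hasFDerivWithinAt) (fun w hw ↦ ?_) (convex_ball y δ)
    (Metric.mem_ball_self hδ) hz
  have h3 := (norm_eval_le (curveAt H' hH' w - curveAt H' hH' y) s).trans (hball w hw).le
  rwa [eval_sub, eval_curveAt _ _ _ hs, eval_curveAt _ _ _ hs] at h3

universe uE

lemma contDiff_curveAt_nat {E : Type uE} [NormedAddCommGroup E] [NormedSpace ℝ E]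
    (n : ℕ) : ∀ {X : Type uE} [NormedAddCommGroup X] [NormedSpace ℝ X]
    (H : E × ℝ → X) (hH : ContDiff ℝ ∞ H), ContDiff ℝ n (curveAt H hH.continuous) := by
  induction n with
  | zero =>
    intro X _ _ H hH
    exact contDiff_zero.2 (continuous_curveAt H hH.continuous)
  | succ n ih =>
    intro X _ _ H hH
    have hsm : ContDiff ℝ ∞ fun q : E × ℝ ↦ (fderiv ℝ H q).comp (ContinuousLinearMap.inl ℝ E ℝ) :=
      (hH.fderiv_right (m := ∞) (by simp)).clm_comp contDiff_const
    refine contDiff_succ_iff_hasFDerivAt.2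
      ⟨fun y ↦ applyCLM X E (curveAt _ hsm.continuous y), (applyCLM X E).contDiff.comp (ih _ hsm),
      hasFDerivAt_curveAt H hH.continuous _ hsm.continuous fun y s ↦ ?_⟩
    have h1 : HasFDerivAt H (fderiv ℝ H (y, s)) (y, s) :=
      (hH.differentiable (by simp) _).hasFDerivAt
    exact h1.comp y (hasFDerivAt_prodMk_left y s)

/-- A smooth function of two variables defines a smooth map into the space of curves in the second
variable. The universes of `E` and `X` agree since the induction on the order of differentiability
replaces `X` by `E →L[ℝ] X`. -/
lemma contDiff_curveAt {E X : Type uE} [NormedAddCommGroup E] [NormedSpace ℝ E]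
    [NormedAddCommGroup X] [NormedSpace ℝ X]
    (H : E × ℝ → X) (hH : ContDiff ℝ ∞ H) : ContDiff ℝ ∞ (curveAt H hH.continuous) :=
  contDiff_infty.2 fun n ↦ contDiff_curveAt_nat n H hH

end CurveSpace

section Volterra

open CurveSpace

variable {A : Type*} [NormedRing A] [NormedAlgebra ℝ A]

variable (A) in
/-- The Volterra operator `u ↦ (s ↦ ∫₀ˢ T u)` with kernel `T`, as a function of `T`. -/
def volterraCLM : CurveSpace A →L[ℝ] CurveSpace A →L[ℝ] CurveSpace A :=
  LinearMap.mkContinuous₂ (LinearMap.mk₂ ℝ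
      (fun T u : CurveSpace A ↦ ofFun (fun s ↦ ∫ σ in (0 : ℝ)..s, T.eval σ * u.eval σ)
        (intervalIntegral.continuous_primitive (fun _ _ ↦
          (T.continuous_eval.mul u.continuous_eval).intervalIntegrable _ _) 0))
      (fun S T u ↦ ext_eval fun s hs ↦ by
        simp only [eval_ofFun _ _ hs, eval_add, add_mul]
        exact intervalIntegral.integral_add
          ((S.continuous_eval.mul u.continuous_eval).intervalIntegrable _ _)
          ((T.continuous_eval.mul u.continuous_eval).intervalIntegrable _ _))
      (fun c T u ↦ ext_eval fun s hs ↦ by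
        simp only [eval_ofFun _ _ hs, eval_smul, smul_mul_assoc]
        exact intervalIntegral.integral_smul c _)
      (fun T u v ↦ ext_eval fun s hs ↦ by
        simp only [eval_ofFun _ _ hs, eval_add, mul_add]
        exact intervalIntegral.integral_add
          ((T.continuous_eval.mul u.continuous_eval).intervalIntegrable _ _)
          ((T.continuous_eval.mul v.continuous_eval).intervalIntegrable _ _))
      (fun c T u ↦ ext_eval fun s hs ↦ by
        simp only [eval_ofFun _ _ hs, eval_smul, mul_smul_comm]
        exact intervalIntegral.integral_smul c _)) 1 fun T u ↦ by
    rw [one_mul]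
    refine norm_le_of_eval (by positivity) fun s hs ↦ ?_
    rw [LinearMap.mk₂_apply, eval_ofFun _ _ hs]
    refine (intervalIntegral.norm_integral_le_of_norm_le_const (C := ‖T‖ * ‖u‖)
      fun x _ ↦ (norm_mul_le _ _).trans
        (mul_le_mul (norm_eval_le T x) (norm_eval_le u x) (by positivity) (by positivity))).trans ?_
    have : |s - 0| ≤ 1 := by rw [sub_zero]; exact abs_le.2 hs
    exact mul_le_of_le_one_right (by positivity) this

lemma eval_volterraCLM (T u : CurveSpace A) {s : ℝ} (hs : s ∈ symmInterval) :
    (volterraCLM A T u).eval s = ∫ σ in (0 : ℝ)..s, T.eval σ * u.eval σ := eval_ofFun _ _ hs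

lemma norm_volterraCLM_le (T : CurveSpace A) : ‖volterraCLM A T‖ ≤ ‖T‖ := by
  have h := (volterraCLM A).le_of_opNorm_le
    (LinearMap.mkContinuous₂_norm_le _ zero_le_one _ : ‖volterraCLM A‖ ≤ 1) T
  rwa [one_mul] at h

variable [CompleteSpace A]

lemma isUnit_one_sub_volterraCLM {T : CurveSpace A} (hT : ‖T‖ < 1) :
    IsUnit (1 - volterraCLM A T) :=
  isUnit_one_sub_of_norm_lt_one (R := CurveSpace A →L[ℝ] CurveSpace A)
    ((norm_volterraCLM_le T).trans_lt hT)

/-- The constant curve `1`. -/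
def oneCurve (A : Type*) [NormedRing A] : CurveSpace A := ofFun (fun _ ↦ 1) continuous_const

/-- The solution of the linear integral equation `u = 1 + ∫₀ T u`, for `‖T‖ < 1`. Otherwise
`Ring.inverse` may take the value `0`. -/
def volterraSol (T : CurveSpace A) : CurveSpace A :=
  Ring.inverse (1 - volterraCLM A T) (oneCurve A)

lemma volterraSol_eq {T : CurveSpace A} (hT : ‖T‖ < 1) :
    volterraSol T = oneCurve A + volterraCLM A T (volterraSol T) := by
  have h := DFunLike.congr_fun
    (Ring.mul_inverse_cancel _ (isUnit_one_sub_volterraCLM hT)) (oneCurve A)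
  have h' : volterraSol T - volterraCLM A T (volterraSol T) = oneCurve A := h
  rw [← h', sub_add_cancel]

lemma eq_volterraSol {T u : CurveSpace A} (hT : ‖T‖ < 1)
    (hu : u = oneCurve A + volterraCLM A T u) : u = volterraSol T := by
  have h := DFunLike.congr_fun (Ring.inverse_mul_cancel _ (isUnit_one_sub_volterraCLM hT)) u
  have h1 : (1 - volterraCLM A T) u = oneCurve A := by
    change u - volterraCLM A T u = oneCurve A
    exact sub_eq_iff_eq_add.2 hu
  have h2 : Ring.inverse (1 - volterraCLM A T) ((1 - volterraCLM A T) u) = u := h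
  rw [h1] at h2
  exact h2.symm

/-- The solution depends smoothly on the kernel since inversion is smooth on the units of the Banach
algebra of operators. -/
lemma contDiffAt_volterraSol {T : CurveSpace A} (hT : ‖T‖ < 1) :
    ContDiffAt ℝ ∞ (volterraSol (A := A)) T := by
  obtain ⟨w, hw⟩ := isUnit_one_sub_volterraCLM hT
  have h1 : ContDiffAt ℝ ∞ Ring.inverse (1 - volterraCLM A T) := by
    rw [← hw]
    exact contDiffAt_ringInverse (R := CurveSpace A →L[ℝ] CurveSpace A) ℝ w
  have h2 : ContDiffAt ℝ ∞ (fun T ↦ 1 - volterraCLM A T) T :=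
    contDiffAt_const.sub (volterraCLM A).contDiff.contDiffAt
  exact (h1.comp T h2).clm_apply contDiffAt_const

lemma eval_volterraSol {T : CurveSpace A} (hT : ‖T‖ < 1) {s : ℝ} (hs : s ∈ symmInterval) :
    (volterraSol T).eval s = 1 + ∫ σ in (0 : ℝ)..s, T.eval σ * (volterraSol T).eval σ := by
  conv_lhs => rw [volterraSol_eq hT]
  rw [eval_add, eval_volterraCLM _ _ hs, oneCurve, eval_ofFun _ _ hs]

lemma hasDerivAt_eval_volterraSol {T : CurveSpace A} (hT : ‖T‖ < 1) {s : ℝ}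
    (hs : s ∈ Ioo (-1 : ℝ) 1) :
    HasDerivAt (volterraSol T).eval (T.eval s * (volterraSol T).eval s) s := by
  have hc := T.continuous_eval.mul (volterraSol T).continuous_eval
  have h1 := (intervalIntegral.integral_hasDerivAt_right (hc.intervalIntegrable 0 s)
      hc.aestronglyMeasurable.stronglyMeasurableAtFilter hc.continuousAt).const_add (1 : A)
  refine h1.congr_of_eventuallyEq ?_
  filter_upwards [Ioo_mem_nhds hs.1 hs.2] with r hr
  exact eval_volterraSol hT (Ioo_subset_Icc_self hr)

/-- **Linear differential equations with smooth parameters.** Near a point `p₀`, the equation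
`∂_b g = B g` has a smooth solution with `g = 1` on the hyperplane `ℓ = ℓ p₀` transverse to `b`.

Along the line through `y` the unknown is rescaled to `[-1, 1]`, the hyperplane being reached at `0`
and `y` at `1`. The rescaled unknown solves a Volterra equation whose kernel depends smoothly on
`y`, and `g y` is its value at `1`. -/
lemma exists_contDiffAt_solution_linear {E A : Type uE} [NormedAddCommGroup E] [NormedSpace ℝ E]
    [NormedRing A] [NormedAlgebra ℝ A] [CompleteSpace A] {B : E → A} (hB : ContDiff ℝ ∞ B)
    {b : E} {ℓ : E →L[ℝ] ℝ} (hb : ℓ b = 1) (p₀ : E) :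
    ∃ g : E → A, ∀ᶠ y in 𝓝 p₀, ContDiffAt ℝ ∞ g y ∧
      HasDerivAt (fun h : ℝ ↦ g (y + h • b)) (B y * g y) 0 ∧ (ℓ (y - p₀) = 0 → g y = 1) := by
  set τ : E → ℝ := fun y ↦ ℓ (y - p₀) with hτ
  set H : E × ℝ → A := fun q ↦ τ q.1 • B (q.1 - τ q.1 • b + (q.2 * τ q.1) • b) with hHdef
  have hτs : ContDiff ℝ ∞ τ := by fun_prop
  have hH : ContDiff ℝ ∞ H := by
    have h1 : ContDiff ℝ ∞ fun q : E × ℝ ↦ τ q.1 := hτs.comp contDiff_fst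
    exact h1.smul (hB.comp ((contDiff_fst.sub (h1.smul contDiff_const)).add
      ((contDiff_snd.mul h1).smul contDiff_const)))
  set T : E → CurveSpace A := curveAt H hH.continuous with hTdef
  have hT0 : T p₀ = 0 := ext_eval fun s hs ↦ by
    rw [hTdef, eval_curveAt _ _ _ hs]
    simp only [hHdef, hτ, sub_self, map_zero, zero_smul]
    rfl
  have hTs : ContDiff ℝ ∞ T := contDiff_curveAt H hH
  -- On the ball of radius `r` the Volterra equation is solved by a Neumann series.
  have hlt : ∀ᶠ y in 𝓝 p₀, ‖T y‖ < 1 :=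
    hTs.continuous.norm.continuousAt.eventually_lt continuousAt_const (by simp [hT0])
  obtain ⟨r, hr, hball⟩ := Metric.eventually_nhds_iff_ball.1 hlt
  -- `t` bounds the distance to the hyperplane; the lines of length `2 t` stay in the ball.
  set t : ℝ := r / (2 * (‖b‖ + 1)) with ht
  have htpos : 0 < t := by positivity
  have htb : t * ‖b‖ < r / 2 := by
    rw [ht, div_mul_eq_mul_div, div_lt_div_iff₀ (by positivity) (by positivity)]
    nlinarith [norm_nonneg b]
  have hline : ∀ z : E, ‖z - p₀‖ < r / 2 → ∀ h : ℝ, |h| ≤ t → ‖T (z + h • b)‖ < 1 := by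
    intro z hz h hh
    apply hball
    rw [mem_ball_iff_norm]
    calc ‖z + h • b - p₀‖ = ‖(z - p₀) + h • b‖ := by congr 1; abel
      _ ≤ ‖z - p₀‖ + |h| * ‖b‖ := (norm_add_le _ _).trans (by rw [norm_smul, Real.norm_eq_abs])
      _ < r := by nlinarith [norm_nonneg b]
  -- Rescaling the solution on a longer segment gives the one on a shorter segment.
  have hscale : ∀ z : E, τ z = 0 → ‖z - p₀‖ < r / 2 → ∀ c ∈ symmInterval,
      (volterraSol (T (z + (c * t) • b))).eval 1 = (volterraSol (T (z + t • b))).eval c := by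
    intro z hz hzr c hc
    have hτz : ∀ h : ℝ, τ (z + h • b) = h := by
      intro h
      have : z + h • b - p₀ = (z - p₀) + h • b := by abel
      simp only [hτ] at hz ⊢
      rw [this, map_add, hz, map_smul, hb, smul_eq_mul, mul_one, zero_add]
    have hTz : ∀ h s : ℝ, s ∈ symmInterval → (T (z + h • b)).eval s = h • B (z + (s * h) • b) := by
      intro h s hs
      rw [hTdef, eval_curveAt _ _ _ hs]
      simp only [hHdef, hτz]
      congr 3
      abel
    have habs : |c * t| ≤ t := by
      rw [abs_mul, abs_of_pos htpos]
      exact mul_le_of_le_one_left htpos.le (abs_le.2 hc)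
    have hmem : ∀ s ∈ symmInterval, c * s ∈ symmInterval := fun s hs ↦ by
      refine abs_le.1 ?_
      rw [abs_mul]
      exact mul_le_one₀ (abs_le.2 hc) (abs_nonneg _) (abs_le.2 hs)
    set U := volterraSol (T (z + t • b)) with hU
    have hTt := hline z hzr t (abs_of_pos htpos).le
    set W : CurveSpace A := ofFun (fun s ↦ U.eval (c * s))
      (U.continuous_eval.comp (continuous_const.mul continuous_id)) with hW
    have hWU : W = volterraSol (T (z + (c * t) • b)) := by
      refine eq_volterraSol (hline z hzr _ habs) (ext_eval fun s hs ↦ ?_)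
      rw [eval_add, eval_volterraCLM _ _ hs, oneCurve, eval_ofFun _ _ hs, hW, eval_ofFun _ _ hs, hU,
        eval_volterraSol hTt (hmem s hs), ← hU]
      congr 1
      have h0 : (0 : ℝ) = c * 0 := by simp
      conv_lhs => rw [h0]
      rw [← intervalIntegral.smul_integral_comp_mul_left, ← intervalIntegral.integral_smul]
      refine intervalIntegral.integral_congr fun σ hσ ↦ ?_
      have hσ' : σ ∈ symmInterval :=
        uIcc_subset_Icc (by norm_num : (0 : ℝ) ∈ Icc (-1) 1) hs hσ
      rw [hTz _ _ (hmem σ hσ'), hTz _ _ hσ', eval_ofFun _ _ hσ', ← smul_mul_assoc, smul_smul,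
        show c * σ * t = σ * (c * t) by ring]
    rw [← hWU, hW, eval_ofFun _ _ (by norm_num), mul_one]
  refine ⟨fun y ↦ (volterraSol (T y)).eval 1, ?_⟩
  have hc1 : Continuous fun y ↦ ‖y - τ y • b - p₀‖ := by fun_prop
  have hc2 : Continuous fun y ↦ |τ y| := by fun_prop
  have hτ0 : τ p₀ = 0 := by simp [hτ]
  have e1 : ∀ᶠ y in 𝓝 p₀, ‖y - τ y • b - p₀‖ < r / 2 :=
    hc1.continuousAt.eventually_lt continuousAt_const (by simp [hτ0, hr])
  have e2 : ∀ᶠ y in 𝓝 p₀, |τ y| < t :=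
    hc2.continuousAt.eventually_lt continuousAt_const (by simp [hτ0, htpos])
  filter_upwards [hlt, e1, e2] with y hy hy1 hy2
  refine ⟨?_, ?_, fun h0 ↦ ?_⟩
  · exact (evalCLM (X := A) 1).contDiff.contDiffAt.comp y
      ((contDiffAt_volterraSol hy).comp y hTs.contDiffAt)
  · set z := y - τ y • b with hz
    have hτz : τ z = 0 := by
      have : z - p₀ = (y - p₀) - τ y • b := by rw [hz]; abel
      simp only [hτ] at this ⊢
      rw [this, map_sub, map_smul, hb, smul_eq_mul, mul_one, sub_self]
    have hdiv : ∀ a : ℝ, |a| < t → a / t ∈ Ioo (-1 : ℝ) 1 := fun a ha ↦ by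
      rw [abs_lt] at ha
      exact ⟨by rw [lt_div_iff₀ htpos]; linarith [ha.1], by rw [div_lt_iff₀ htpos]; linarith [ha.2]⟩
    have hloc : ∀ a : ℝ, |a| < t → (volterraSol (T (z + a • b))).eval 1 =
        (volterraSol (T (z + t • b))).eval (a / t) := fun a ha ↦ by
      rw [← hscale z hτz hy1 _ (Ioo_subset_Icc_self (hdiv a ha)), div_mul_cancel₀ _ htpos.ne']
    have hyz : y = z + τ y • b := by rw [hz]; abel
    have hcu := hdiv _ hy2
    have hder := hasDerivAt_eval_volterraSol
      (hline z hy1 t (abs_of_pos htpos).le) hcu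
    have hlin : HasDerivAt (fun h : ℝ ↦ (τ y + h) / t) (1 / t) 0 := by
      simpa using ((hasDerivAt_id (0 : ℝ)).const_add (τ y)).div_const t
    have hder' := hder
    rw [show τ y / t = (τ y + 0) / t by simp] at hder'
    have hcomp := hder'.scomp (0 : ℝ) hlin
    have hval : (1 / t) • ((T (z + t • b)).eval ((τ y + 0) / t) *
        (volterraSol (T (z + t • b))).eval ((τ y + 0) / t)) =
        B y * (volterraSol (T y)).eval 1 := by
      have h1 : (T (z + t • b)).eval (τ y / t) = t • B y := by
        rw [hTdef, eval_curveAt _ _ _ (Ioo_subset_Icc_self hcu)]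
        have h2 : τ (z + t • b) = t := by
          have : z + t • b - p₀ = (z - p₀) + t • b := by abel
          simp only [hτ] at hτz this ⊢
          rw [this, map_add, hτz, map_smul, hb, smul_eq_mul, mul_one, zero_add]
        simp only [hHdef, h2]
        rw [div_mul_cancel₀ _ htpos.ne', add_sub_cancel_right, ← hyz]
      rw [add_zero, h1, ← hloc _ hy2, ← hyz, smul_mul_assoc, smul_smul, one_div,
        inv_mul_cancel₀ htpos.ne', one_smul]
    rw [hval] at hcomp
    refine hcomp.congr_of_eventuallyEq ?_
    have e3 : ∀ᶠ h : ℝ in 𝓝 0, |τ y + h| < t :=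
      (by fun_prop : Continuous fun h : ℝ ↦ |τ y + h|).continuousAt.eventually_lt
        continuousAt_const (by simpa using hy2)
    filter_upwards [e3] with h hh
    have h3 : y + h • b = z + (τ y + h) • b := by rw [hz, add_smul]; abel
    simp only [h3, Function.comp_apply]
    exact hloc _ hh
  · have hTy : T y = 0 := ext_eval fun s hs ↦ by
      rw [hTdef, eval_curveAt _ _ _ hs]
      simp only [hHdef]
      rw [show τ y = 0 from h0, zero_smul]
      rfl
    rw [hTy, eval_volterraSol (by simp) (by norm_num)]
    have : ∀ σ, (0 : CurveSpace A).eval σ = 0 := fun σ ↦ rfl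
    simp [this]

end Volterra

/-! ### Coordinates, Lie brackets and exterior derivatives on a manifold -/

section ManifoldCalculus

variable {m : ℕ} {M : Type*} [TopologicalSpace M]
  [ChartedSpace (EuclideanSpace ℝ (Fin m)) M]

section Extension

variable [IsManifold (𝓡 m) ∞ M] [T2Space M]

/-- Multiplication by a bump function extends a smooth germ to a global smooth function. -/
lemma exists_contMDiff_eventuallyEq {G : Type*} [NormedAddCommGroup G] [NormedSpace ℝ G]
    {f : M → G} {p : M} (hf : ∀ᶠ x in 𝓝 p, ContMDiffAt (𝓡 m) 𝓘(ℝ, G) ∞ f x) :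
    ∃ g : M → G, ContMDiff (𝓡 m) 𝓘(ℝ, G) ∞ g ∧ g =ᶠ[𝓝 p] f := by
  obtain ⟨χ, -, hχ⟩ := (SmoothBumpFunction.nhds_basis_tsupport (I := 𝓡 m) p).mem_iff.1 hf
  refine ⟨fun x ↦ χ x • f x, contMDiff_of_tsupport fun x hx ↦ ?_, ?_⟩
  · exact χ.contMDiffAt.smul (hχ (closure_mono (Function.support_smul_subset_left _ _) hx))
  · filter_upwards [χ.eventuallyEq_one] with x hx
    simp [hx]

/-- Multiplication by a bump function extends a smooth germ to a global smooth section. -/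
lemma exists_contMDiffSection_eventuallyEq {F : Type*} [NormedAddCommGroup F] [NormedSpace ℝ F]
    {V : M → Type*} [TopologicalSpace (TotalSpace F V)]
    [∀ x, TopologicalSpace (V x)] [∀ x, AddCommGroup (V x)] [∀ x, Module ℝ (V x)]
    [FiberBundle F V] [VectorBundle ℝ F V]
    {s : ∀ x, V x} {p : M} (hs : ∀ᶠ x in 𝓝 p,
      ContMDiffAt (𝓡 m) ((𝓡 m).prod 𝓘(ℝ, F)) ∞ (fun x ↦ TotalSpace.mk' F x (s x)) x) :
    ∃ t : Cₛ^∞⟮𝓡 m; F, V⟯, ∀ᶠ x in 𝓝 p, t x = s x := by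
  obtain ⟨W, hWs, hW, hpW⟩ := eventually_nhds_iff.1 hs
  obtain ⟨χ, -, hχ⟩ :=
    (SmoothBumpFunction.nhds_basis_tsupport (I := 𝓡 m) p).mem_iff.1 (hW.mem_nhds hpW)
  refine ⟨⟨(χ : M → ℝ) • s, ContMDiffOn.smul_section_of_tsupport χ.contMDiff.contMDiffOn hW hχ
    fun x hx ↦ (hWs x hx).contMDiffWithinAt⟩, ?_⟩
  filter_upwards [χ.eventuallyEq_one] with x hx
  simp [hx]

end Extension

section Coordinates

/-- The coordinate functions of the chart around `p`. -/
def chartCoord (p : M) (j : Fin m) (x : M) : ℝ := extChartAt (𝓡 m) p x j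

variable [IsManifold (𝓡 m) ∞ M]

lemma contMDiffAt_chartCoord {p x : M} (hx : x ∈ (chartAt (EuclideanSpace ℝ (Fin m)) p).source)
    (j : Fin m) : ContMDiffAt (𝓡 m) 𝓘(ℝ, ℝ) ∞ (chartCoord p j) x :=
  (EuclideanSpace.proj (𝕜 := ℝ) j).contMDiff.contMDiffAt.comp x (contMDiffAt_extChartAt' hx)

lemma mvfderiv_chartCoord {p x : M} (hx : x ∈ (chartAt (EuclideanSpace ℝ (Fin m)) p).source)
    (j : Fin m) (v : TangentSpace (𝓡 m) x) :
    mvfderiv (𝓡 m) (chartCoord p j) x v = mvfderiv (𝓡 m) (extChartAt (𝓡 m) p) x v j := by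
  have h := mfderiv_comp (I' := 𝓘(ℝ, EuclideanSpace ℝ (Fin m))) (I'' := 𝓘(ℝ, ℝ)) x
    ((EuclideanSpace.proj (𝕜 := ℝ) j).differentiableAt.mdifferentiableAt)
    (mdifferentiableAt_extChartAt (I := 𝓡 m) hx)
  rw [ContinuousLinearMap.mfderiv_eq] at h
  exact DFunLike.congr_fun h v

/-- The chain rule in the chart around `p`. -/
lemma mvfderiv_eq_fderiv_chart {G : Type*} [NormedAddCommGroup G] [NormedSpace ℝ G] {p x : M}
    (hx : x ∈ (chartAt (EuclideanSpace ℝ (Fin m)) p).source) {f : M → G}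
    (hf : MDifferentiableAt (𝓡 m) 𝓘(ℝ, G) f x) (v : TangentSpace (𝓡 m) x) :
    DifferentiableAt ℝ (f ∘ (extChartAt (𝓡 m) p).symm) (extChartAt (𝓡 m) p x) ∧
    mvfderiv (𝓡 m) f x v = fderiv ℝ (f ∘ (extChartAt (𝓡 m) p).symm) (extChartAt (𝓡 m) p x)
      (mvfderiv (𝓡 m) (extChartAt (𝓡 m) p) x v) := by
  have hxs : x ∈ (extChartAt (𝓡 m) p).source := by rwa [extChartAt_source]
  have hxt := (extChartAt (𝓡 m) p).map_source hxs
  have hsymm : MDifferentiableAt 𝓘(ℝ, EuclideanSpace ℝ (Fin m)) (𝓡 m) (extChartAt (𝓡 m) p).symm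
      (extChartAt (𝓡 m) p x) :=
    ((contMDiffOn_extChartAt_symm (n := 1) p).contMDiffAt
      ((isOpen_extChartAt_target p).mem_nhds hxt)).mdifferentiableAt one_ne_zero
  have hF : MDifferentiableAt 𝓘(ℝ, EuclideanSpace ℝ (Fin m)) 𝓘(ℝ, G)
      (f ∘ (extChartAt (𝓡 m) p).symm) (extChartAt (𝓡 m) p x) := by
    refine MDifferentiableAt.comp _ ?_ hsymm
    rwa [(extChartAt (𝓡 m) p).left_inv hxs]
  refine ⟨hF.differentiableAt, ?_⟩
  have hcomp := mfderiv_comp x hF (mdifferentiableAt_extChartAt (I := 𝓡 m) hx)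
  have heq : (f ∘ (extChartAt (𝓡 m) p).symm) ∘ extChartAt (𝓡 m) p =ᶠ[𝓝 x] f := by
    filter_upwards [extChartAt_source_mem_nhds' (I := 𝓡 m) hxs] with y hy
    exact congrArg f ((extChartAt (𝓡 m) p).left_inv hy)
  rw [mfderiv_eq_fderiv, heq.mfderiv_eq] at hcomp
  exact DFunLike.congr_fun hcomp v

lemma mvfderiv_extChartAt_bijective {p x : M}
    (hx : x ∈ (chartAt (EuclideanSpace ℝ (Fin m)) p).source) :
    Function.Bijective (mvfderiv (𝓡 m) (extChartAt (𝓡 m) p) x) := by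
  obtain ⟨e, he⟩ := isInvertible_mfderiv_extChartAt (I := 𝓡 m) (M := M) (x := p) (y := x)
    (by rwa [extChartAt_source])
  have hev : ∀ v, mvfderiv (𝓡 m) (extChartAt (𝓡 m) p) x v = e v := fun v ↦
    (DFunLike.congr_fun he v).symm
  exact (funext hev : ⇑(mvfderiv (𝓡 m) (extChartAt (𝓡 m) p) x) = e) ▸ e.bijective

/-- Tangent vectors are determined by their coordinates. -/
lemma tangent_ext {p x : M} (hx : x ∈ (chartAt (EuclideanSpace ℝ (Fin m)) p).source)
    {v w : TangentSpace (𝓡 m) x}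
    (h : ∀ j : Fin m, mvfderiv (𝓡 m) (chartCoord p j) x v = mvfderiv (𝓡 m) (chartCoord p j) x w) :
    v = w := by
  refine (mvfderiv_extChartAt_bijective hx).1 ?_
  ext j
  exact (mvfderiv_chartCoord hx j v).symm.trans ((h j).trans (mvfderiv_chartCoord hx j w))

lemma exists_tangent_coord {p x : M} (hx : x ∈ (chartAt (EuclideanSpace ℝ (Fin m)) p).source)
    (c : Fin m → ℝ) :
    ∃ v : TangentSpace (𝓡 m) x, ∀ j, mvfderiv (𝓡 m) (chartCoord p j) x v = c j := by
  obtain ⟨v, hv⟩ := (mvfderiv_extChartAt_bijective hx).2 (WithLp.toLp 2 c)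
  exact ⟨v, fun j ↦ by rw [mvfderiv_chartCoord hx, hv]⟩

omit [IsManifold (𝓡 m) ∞ M] in
lemma eventually_mem_chart_source (p : M) :
    ∀ᶠ x in 𝓝 p, x ∈ (chartAt (EuclideanSpace ℝ (Fin m)) p).source :=
  (chartAt _ p).open_source.mem_nhds (mem_chart_source _ p)

end Coordinates

section OneForms

variable [IsManifold (𝓡 m) ∞ M]

/-- The differential of a smooth function is a smooth `1`-form. -/
lemma contMDiffAt_mvfderiv {f : M → ℝ} {x : M} (hf : ContMDiffAt (𝓡 m) 𝓘(ℝ, ℝ) ∞ f x) :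
    ContMDiffAt (𝓡 m) ((𝓡 m).prod 𝓘(ℝ, EuclideanSpace ℝ (Fin m) →L[ℝ] ℝ)) ∞
      (fun x ↦ TotalSpace.mk' (EuclideanSpace ℝ (Fin m) →L[ℝ] ℝ)
      (E := fun x : M ↦ TangentSpace (𝓡 m) x →L[ℝ] ℝ) x (mvfderiv (𝓡 m) f x)) x := by
  refine (contMDiffAt_hom_bundle _).2 ⟨contMDiffAt_id, ?_⟩
  have h := hf.mfderiv_const (m := ∞) (by simp)
  refine h.congr_of_eventuallyEq ?_
  refine Eventually.of_forall fun y ↦ ?_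
  simp only [inTangentCoordinates]
  ext v
  simp only [ContinuousLinearMap.inCoordinates, ContinuousLinearMap.comp_apply]
  have h1 := Bundle.Trivial.continuousLinearMapAt_trivialization ℝ M ℝ y
  have h2 := TangentBundle.continuousLinearMapAt_model_space (𝕜 := ℝ) (f x) (f y)
  exact (DFunLike.congr_fun h1 _).trans (DFunLike.congr_fun h2 _).symm

lemma contMDiffAt_mvfderiv_apply {f : M → ℝ} {x : M} (hf : ContMDiffAt (𝓡 m) 𝓘(ℝ, ℝ) ∞ f x)
    {X : ∀ x : M, TangentSpace (𝓡 m) x} (hX : ContMDiffAt (𝓡 m) (𝓡 m).tangent ∞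
      (fun x ↦ (⟨x, X x⟩ : TangentBundle (𝓡 m) M)) x) :
    ContMDiffAt (𝓡 m) 𝓘(ℝ, ℝ) ∞ (fun y ↦ mvfderiv (𝓡 m) f y (X y)) x := by
  exact ((contMDiffAt_totalSpace).1 (ContMDiffAt.clm_bundle_apply
    (E₂ := Bundle.Trivial M ℝ) (F₂ := ℝ) (contMDiffAt_mvfderiv hf) hX)).2

end OneForms

section Bracket

variable [IsManifold (𝓡 m) ∞ M]

lemma inverse_mfderiv_extChartAt_symm {p : M} {y : EuclideanSpace ℝ (Fin m)}
    (hy : y ∈ (extChartAt (𝓡 m) p).target) :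
    (mfderiv 𝓘(ℝ, EuclideanSpace ℝ (Fin m)) (𝓡 m) (extChartAt (𝓡 m) p).symm y).inverse =
      mfderiv (𝓡 m) 𝓘(ℝ, EuclideanSpace ℝ (Fin m)) (extChartAt (𝓡 m) p)
        ((extChartAt (𝓡 m) p).symm y) := by
  have h1 := mfderiv_extChartAt_comp_mfderivWithin_extChartAt_symm (I := 𝓡 m) hy
  have h2 := mfderivWithin_extChartAt_symm_comp_mfderiv_extChartAt (I := 𝓡 m) hy
  simp only [modelWithCornersSelf_coe, range_id, mfderivWithin_univ] at h1 h2
  exact ContinuousLinearMap.inverse_eq h2 h1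

/-- The Lie bracket of vector fields is the commutator of derivations. -/
lemma mvfderiv_mlieBracket {f : M → ℝ} {x : M} (hf : ContMDiffAt (𝓡 m) 𝓘(ℝ, ℝ) ∞ f x)
    {X Y : ∀ x : M, TangentSpace (𝓡 m) x}
    (hX : ContMDiffAt (𝓡 m) (𝓡 m).tangent ∞ (fun x ↦ (⟨x, X x⟩ : TangentBundle (𝓡 m) M)) x)
    (hY : ContMDiffAt (𝓡 m) (𝓡 m).tangent ∞ (fun x ↦ (⟨x, Y x⟩ : TangentBundle (𝓡 m) M)) x) :
    mvfderiv (𝓡 m) f x (mlieBracket (𝓡 m) X Y x) =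
      mvfderiv (𝓡 m) (fun y ↦ mvfderiv (𝓡 m) f y (Y y)) x (X x) -
        mvfderiv (𝓡 m) (fun y ↦ mvfderiv (𝓡 m) f y (X y)) x (Y x) := by
  have hx := mem_chart_source (EuclideanSpace ℝ (Fin m)) x
  set φ := extChartAt (𝓡 m) x with hφ
  set y₀ := φ x with hy₀
  set F := f ∘ φ.symm with hF
  -- `P Z` is the vector field `Z` in the chart.
  set P : (∀ x : M, TangentSpace (𝓡 m) x) → EuclideanSpace ℝ (Fin m) → EuclideanSpace ℝ (Fin m) :=
    fun Z y ↦ mpullback 𝓘(ℝ, EuclideanSpace ℝ (Fin m)) (𝓡 m) φ.symm Z y with hP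
  have hFs : ContDiffAt ℝ ∞ F y₀ := by
    refine ContMDiffAt.contDiffAt (ContMDiffAt.comp (I' := 𝓡 m) (M' := M) y₀ (g := f) ?_ ?_)
    · rwa [hy₀, φ.left_inv (mem_extChartAt_source x)]
    · exact (contMDiffOn_extChartAt_symm x).contMDiffAt
        ((isOpen_extChartAt_target x).mem_nhds (mem_extChartAt_target x))
  have hFev : ∀ᶠ z in 𝓝 x, MDifferentiableAt (𝓡 m) 𝓘(ℝ, ℝ) f z :=
    ((contMDiffAt_iff_contMDiffAt_nhds (by simp)).1 (hf.of_le (m := 1) ENat.LEInfty.out)).mono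
      fun z hz ↦ hz.mdifferentiableAt one_ne_zero
  have hsymm : Tendsto φ.symm (𝓝 y₀) (𝓝 x) := by
    have := (continuousAt_extChartAt_symm (I := 𝓡 m) (M := M) x).tendsto
    rwa [extChartAt_to_inv] at this
  have hPd : ∀ Z : ∀ x : M, TangentSpace (𝓡 m) x, ∀ y ∈ φ.target, P Z y =
      mvfderiv (𝓡 m) φ (φ.symm y) (Z (φ.symm y)) := fun Z y hy ↦ by
    exact DFunLike.congr_fun (inverse_mfderiv_extChartAt_symm hy) _
  have hPdiff : ∀ Z : ∀ x : M, TangentSpace (𝓡 m) x,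
      ContMDiffAt (𝓡 m) (𝓡 m).tangent ∞ (fun x ↦ (⟨x, Z x⟩ : TangentBundle (𝓡 m) M)) x →
      DifferentiableAt ℝ (P Z) y₀ := fun Z hZ ↦ by
    have h := MDifferentiableWithinAt.differentiableWithinAt_mpullbackWithin_vectorField
      (I := 𝓡 m) (s := univ) (V := Z) (x := x)
      (hZ.mdifferentiableAt (by simp)).mdifferentiableWithinAt
    rw [modelWithCornersSelf_coe, range_id, preimage_univ, inter_univ, mpullbackWithin_univ] at h
    exact differentiableWithinAt_univ.1 h
  have hev : ∀ Z : ∀ x : M, TangentSpace (𝓡 m) x,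
      (fun z ↦ mvfderiv (𝓡 m) f z (Z z)) ∘ φ.symm =ᶠ[𝓝 y₀]
        fun y ↦ fderiv ℝ F y (P Z y) := fun Z ↦ by
    filter_upwards [hsymm.eventually hFev, (isOpen_extChartAt_target x).mem_nhds
      (mem_extChartAt_target (I := 𝓡 m) x)] with y hy hyt
    have hys := φ.map_target hyt
    rw [hφ, extChartAt_source] at hys
    have h := (mvfderiv_eq_fderiv_chart hys hy (Z (φ.symm y))).2
    rw [Function.comp_apply, h, φ.right_inv hyt, hPd Z y hyt]
  have hP0 : ∀ Z : ∀ x : M, TangentSpace (𝓡 m) x, P Z y₀ = mvfderiv (𝓡 m) φ x (Z x) := fun Z ↦ by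
    rw [hPd Z _ (mem_extChartAt_target x), extChartAt_to_inv]
  have hterm : ∀ Z W : ∀ x : M, TangentSpace (𝓡 m) x,
      ContMDiffAt (𝓡 m) (𝓡 m).tangent ∞ (fun x ↦ (⟨x, Z x⟩ : TangentBundle (𝓡 m) M)) x →
      mvfderiv (𝓡 m) (fun y ↦ mvfderiv (𝓡 m) f y (Z y)) x (W x) =
        fderiv ℝ (fderiv ℝ F) y₀ (P W y₀) (P Z y₀) +
          fderiv ℝ F y₀ (fderiv ℝ (P Z) y₀ (P W y₀)) := by
    intro Z W hZ
    rw [(mvfderiv_eq_fderiv_chart hx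
      ((contMDiffAt_mvfderiv_apply hf hZ).mdifferentiableAt (by simp)) (W x)).2, (hev Z).fderiv_eq,
      ← hP0]
    have h1 : DifferentiableAt ℝ (fderiv ℝ F) y₀ :=
      (hFs.fderiv_right (m := 1) (by norm_num; exact ENat.LEInfty.out)).differentiableAt one_ne_zero
    rw [fderiv_clm_apply h1 (hPdiff Z hZ)]
    simp [add_comm]
  have hbr : mvfderiv (𝓡 m) φ x (mlieBracket (𝓡 m) X Y x) = lieBracket ℝ (P X) (P Y) y₀ := by
    rw [← mlieBracketWithin_univ, mlieBracketWithin_apply, modelWithCornersSelf_coe, range_id,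
      preimage_univ, inter_univ, mpullbackWithin_univ, mpullbackWithin_univ]
    obtain ⟨e, he⟩ := isInvertible_mfderiv_extChartAt (I := 𝓡 m) (M := M) (x := x) (y := x)
      (mem_extChartAt_source x)
    change mfderiv (𝓡 m) 𝓘(ℝ, EuclideanSpace ℝ (Fin m)) φ x _ = _
    rw [hφ, ← he, ContinuousLinearMap.inverse_equiv]
    refine (e.apply_symm_apply _).trans ?_
    exact congrFun (lieBracketWithin_univ (𝕜 := ℝ) (V := P X) (W := P Y)) y₀
  rw [(mvfderiv_eq_fderiv_chart hx (hf.mdifferentiableAt (by simp)) _).2, hbr, hterm Y X hY,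
    hterm X Y hX, lieBracket_eq]
  have hsy : IsSymmSndFDerivAt ℝ F y₀ := hFs.isSymmSndFDerivAt (by
    rw [minSmoothness_of_isRCLikeNormedField]; exact ENat.LEInfty.out)
  rw [hsy.eq (P X y₀) (P Y y₀), map_sub, ← hF, ← hφ, ← hy₀]
  abel

end Bracket

section ExteriorDerivative

variable [IsManifold (𝓡 m) ∞ M]

/-- The exterior derivative of `∑ j, f j • d(g j)` is `∑ j, d(f j) ∧ d(g j)`. -/
lemma dOneForm_sum_smul_mvfderiv {ι : Type*} [Fintype ι] {f g : ι → M → ℝ} {x : M}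
    (hf : ∀ j, ContMDiffAt (𝓡 m) 𝓘(ℝ, ℝ) ∞ (f j) x) (hg : ∀ j, ContMDiffAt (𝓡 m) 𝓘(ℝ, ℝ) ∞ (g j) x)
    {ξ : ∀ x : M, TangentSpace (𝓡 m) x →L[ℝ] ℝ}
    (hξ : ∀ᶠ y in 𝓝 x, ξ y = ∑ j, f j y • mvfderiv (𝓡 m) (g j) y) (v w : TangentSpace (𝓡 m) x) :
    CourantAlgebroid.dOneForm ξ x v w =
      ∑ j, (mvfderiv (𝓡 m) (f j) x v * mvfderiv (𝓡 m) (g j) x w -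
        mvfderiv (𝓡 m) (f j) x w * mvfderiv (𝓡 m) (g j) x v) := by
  have hx := mem_chart_source (EuclideanSpace ℝ (Fin m)) x
  set φ := extChartAt (𝓡 m) x with hφ
  set y₀ := φ x with hy₀
  have hφsymm : ∀ y ∈ φ.target,
      ContMDiffAt 𝓘(ℝ, EuclideanSpace ℝ (Fin m)) (𝓡 m) ∞ φ.symm y := fun y hy ↦
    (contMDiffOn_extChartAt_symm x).contMDiffAt ((isOpen_extChartAt_target x).mem_nhds hy)
  have hsm : ∀ h : M → ℝ, ContMDiffAt (𝓡 m) 𝓘(ℝ, ℝ) ∞ h x → ContDiffAt ℝ ∞ (h ∘ φ.symm) y₀ := by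
    intro h hh
    refine ContMDiffAt.contDiffAt (ContMDiffAt.comp (I' := 𝓡 m) (M' := M) y₀ (g := h) ?_
      (hφsymm _ (mem_extChartAt_target x)))
    rwa [hy₀, φ.left_inv (mem_extChartAt_source x)]
  have hsymm : Tendsto φ.symm (𝓝 y₀) (𝓝 x) := by
    have := (continuousAt_extChartAt_symm (I := 𝓡 m) (M := M) x).tendsto
    rwa [extChartAt_to_inv] at this
  have hgev : ∀ᶠ z in 𝓝 x, ∀ j, MDifferentiableAt (𝓡 m) 𝓘(ℝ, ℝ) (g j) z :=
    eventually_all.2 fun j ↦ ((contMDiffAt_iff_contMDiffAt_nhds (by simp)).1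
      ((hg j).of_le (m := 1) ENat.LEInfty.out)).mono fun z hz ↦ hz.mdifferentiableAt one_ne_zero
  -- The `1`-form in the chart.
  set Ξ : EuclideanSpace ℝ (Fin m) → EuclideanSpace ℝ (Fin m) →L[ℝ] ℝ := fun y ↦
    (ξ (φ.symm y)).comp (mfderiv 𝓘(ℝ, EuclideanSpace ℝ (Fin m)) (𝓡 m) φ.symm y) with hΞ
  have hev : Ξ =ᶠ[𝓝 y₀]
      fun y ↦ ∑ j, (f j ∘ φ.symm) y • fderiv ℝ (g j ∘ φ.symm) y := by
    filter_upwards [hsymm.eventually hξ, hsymm.eventually hgev,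
      (isOpen_extChartAt_target x).mem_nhds (mem_extChartAt_target (I := 𝓡 m) x)] with y h1 h2 h3
    ext u
    have hc : ∀ j, fderiv ℝ (g j ∘ φ.symm) y u = mvfderiv (𝓡 m) (g j) (φ.symm y)
        (mfderiv 𝓘(ℝ, EuclideanSpace ℝ (Fin m)) (𝓡 m) φ.symm y u) := fun j ↦ by
      have := mfderiv_comp y (h2 j) ((hφsymm y h3).mdifferentiableAt (by simp))
      rw [mfderiv_eq_fderiv] at this
      exact DFunLike.congr_fun this u
    have hΞu : Ξ y u = ξ (φ.symm y)
        (mfderiv 𝓘(ℝ, EuclideanSpace ℝ (Fin m)) (𝓡 m) φ.symm y u) := rfl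
    rw [hΞu, h1]
    simp only [sum_apply, smul_apply, hc]
    rfl
  set D := fderiv ℝ Ξ y₀ with hD
  have hDapp : ∀ a b, D a b = ∑ j, ((f j ∘ φ.symm) y₀ * fderiv ℝ (fderiv ℝ (g j ∘ φ.symm)) y₀ a b +
      fderiv ℝ (f j ∘ φ.symm) y₀ a * fderiv ℝ (g j ∘ φ.symm) y₀ b) := by
    intro a b
    have h1 : ∀ j, DifferentiableAt ℝ (fderiv ℝ (g j ∘ φ.symm)) y₀ := fun j ↦
      ((hsm _ (hg j)).fderiv_right (m := 1) (by norm_num; exact ENat.LEInfty.out)).differentiableAt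
        one_ne_zero
    have h2 : ∀ j, DifferentiableAt ℝ (f j ∘ φ.symm) y₀ := fun j ↦
      (hsm _ (hf j)).differentiableAt (by simp)
    rw [hD, hev.fderiv_eq, fderiv_fun_sum
      (A := fun j y ↦ (f j ∘ φ.symm) y • fderiv ℝ (g j ∘ φ.symm) y)
      fun j _ ↦ (h2 j).smul (h1 j)]
    simp only [sum_apply]
    refine Finset.sum_congr rfl fun j _ ↦ ?_
    rw [fderiv_fun_smul (h2 j) (h1 j)]
    simp
  have hsy : ∀ j a b, fderiv ℝ (fderiv ℝ (g j ∘ φ.symm)) y₀ a b =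
      fderiv ℝ (fderiv ℝ (g j ∘ φ.symm)) y₀ b a := fun j a b ↦
    ((hsm _ (hg j)).isSymmSndFDerivAt (by
      rw [minSmoothness_of_isRCLikeNormedField]; exact ENat.LEInfty.out)).eq a b
  have hv : ∀ h : M → ℝ, ContMDiffAt (𝓡 m) 𝓘(ℝ, ℝ) ∞ h x → ∀ u : TangentSpace (𝓡 m) x,
      mvfderiv (𝓡 m) h x u = fderiv ℝ (h ∘ φ.symm) y₀ (mvfderiv (𝓡 m) φ x u) := fun h hh u ↦
    (mvfderiv_eq_fderiv_chart hx (hh.mdifferentiableAt (by simp)) u).2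
  have hgoal : CourantAlgebroid.dOneForm ξ x v w =
      D (mvfderiv (𝓡 m) φ x v) (mvfderiv (𝓡 m) φ x w) -
        D (mvfderiv (𝓡 m) φ x w) (mvfderiv (𝓡 m) φ x v) := rfl
  rw [hgoal, hDapp, hDapp, ← Finset.sum_sub_distrib]
  refine Finset.sum_congr rfl fun j _ ↦ ?_
  rw [hv _ (hf j), hv _ (hf j), hv _ (hg j), hv _ (hg j), hsy j _ (mvfderiv (𝓡 m) φ x v)]
  ring

end ExteriorDerivative

end ManifoldCalculus

/-! ### Functions and differential equations along coordinate directions -/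

section LocalCalculus

variable {m : ℕ} {M : Type*} [TopologicalSpace M]
  [ChartedSpace (EuclideanSpace ℝ (Fin m)) M] [IsManifold (𝓡 m) ∞ M] {p : M}

omit [IsManifold (𝓡 m) ∞ M] in
lemma tendsto_extChartAt_symm (p : M) :
    Tendsto (extChartAt (𝓡 m) p).symm (𝓝 (extChartAt (𝓡 m) p p)) (𝓝 p) := by
  have := (continuousAt_extChartAt_symm (I := 𝓡 m) (M := M) p).tendsto
  rwa [extChartAt_to_inv] at this

omit [IsManifold (𝓡 m) ∞ M] in
lemma tendsto_extChartAt (p : M) :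
    Tendsto (extChartAt (𝓡 m) p) (𝓝 p) (𝓝 (extChartAt (𝓡 m) p p)) :=
  (continuousAt_extChartAt (I := 𝓡 m) p).tendsto

/-- Near `p` the derivative of a function may be computed in the chart around `p`. -/
lemma eventually_mvfderiv_eq_fderiv {G : Type*} [NormedAddCommGroup G] [NormedSpace ℝ G] {f : M → G}
    (hf : ∀ᶠ x in 𝓝 p, MDifferentiableAt (𝓡 m) 𝓘(ℝ, G) f x) :
    ∀ᶠ y in 𝓝 (extChartAt (𝓡 m) p p),
      (extChartAt (𝓡 m) p).symm y ∈ (chartAt (EuclideanSpace ℝ (Fin m)) p).source ∧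
      extChartAt (𝓡 m) p ((extChartAt (𝓡 m) p).symm y) = y ∧
      DifferentiableAt ℝ (f ∘ (extChartAt (𝓡 m) p).symm) y ∧
      ∀ v, mvfderiv (𝓡 m) f ((extChartAt (𝓡 m) p).symm y) v =
        fderiv ℝ (f ∘ (extChartAt (𝓡 m) p).symm) y
          (mvfderiv (𝓡 m) (extChartAt (𝓡 m) p) ((extChartAt (𝓡 m) p).symm y) v) := by
  filter_upwards [(tendsto_extChartAt_symm (m := m) p).eventually
      (hf.and (eventually_mem_chart_source (m := m) p)),
    (isOpen_extChartAt_target p).mem_nhds (mem_extChartAt_target (I := 𝓡 m) p)] with y h1 hy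
  have hxy := (extChartAt (𝓡 m) p).right_inv hy
  have h2 := fun v ↦ mvfderiv_eq_fderiv_chart h1.2 h1.1 v
  rw [hxy] at h2
  exact ⟨h1.2, hxy, (h2 0).1, fun v ↦ (h2 v).2⟩

/-- A function whose derivative vanishes near `p` is constant near `p`. -/
lemma eventually_eq_of_mvfderiv_eq_zero {f : M → ℝ}
    (hf : ∀ᶠ x in 𝓝 p, MDifferentiableAt (𝓡 m) 𝓘(ℝ, ℝ) f x)
    (h0 : ∀ᶠ x in 𝓝 p, ∀ v, mvfderiv (𝓡 m) f x v = 0) : ∀ᶠ x in 𝓝 p, f x = f p := by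
  set φ := extChartAt (𝓡 m) p with hφ
  have h1 : ∀ᶠ y in 𝓝 (φ p), DifferentiableAt ℝ (f ∘ φ.symm) y ∧ fderiv ℝ (f ∘ φ.symm) y = 0 := by
    filter_upwards [eventually_mvfderiv_eq_fderiv hf,
      (tendsto_extChartAt_symm (m := m) p).eventually h0]
      with y ⟨hy1, hy2, hy3, hy4⟩ hy5
    refine ⟨hy3, ContinuousLinearMap.ext fun w ↦ ?_⟩
    obtain ⟨v, rfl⟩ := (mvfderiv_extChartAt_bijective hy1).2 w
    rw [← hy4, hy5]
    rfl
  obtain ⟨ε, hε, h2⟩ := Metric.eventually_nhds_iff_ball.1 h1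
  have h3 : ∀ y ∈ Metric.ball (φ p) ε, (f ∘ φ.symm) y = (f ∘ φ.symm) (φ p) := fun y hy ↦
    Metric.isOpen_ball.is_const_of_fderiv_eq_zero (convex_ball (φ p) ε).isPreconnected
      (fun z hz ↦ (h2 z hz).1.differentiableWithinAt) (fun z hz ↦ (h2 z hz).2) hy
      (Metric.mem_ball_self hε)
  filter_upwards [(tendsto_extChartAt (m := m) p).eventually (Metric.ball_mem_nhds _ hε),
    extChartAt_source_mem_nhds (I := 𝓡 m) p] with x hx hxs
  have h4 := h3 _ hx
  rwa [Function.comp_apply, Function.comp_apply, φ.left_inv hxs, hφ, extChartAt_to_inv] at h4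

/-- The coordinate hyperplane through `p` on which the `j`-th coordinate is constant. -/
def coordSlice (p : M) (j : Fin m) : Set M := {x | chartCoord p j x = chartCoord p j p}

/-- A function which is constant along the `j`-th coordinate direction and vanishes on the
transversal hyperplane vanishes. -/
lemma eventually_eq_zero_of_slice {f : M → ℝ} {j : Fin m} {X : ∀ x : M, TangentSpace (𝓡 m) x}
    (hf : ∀ᶠ x in 𝓝 p, MDifferentiableAt (𝓡 m) 𝓘(ℝ, ℝ) f x)
    (hX : ∀ᶠ x in 𝓝 p, mvfderiv (𝓡 m) (extChartAt (𝓡 m) p) x (X x) = EuclideanSpace.single j 1)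
    (hfX : ∀ᶠ x in 𝓝 p, mvfderiv (𝓡 m) f x (X x) = 0)
    (hf0 : ∀ᶠ x in 𝓝 p, x ∈ coordSlice p j → f x = 0) : ∀ᶠ x in 𝓝 p, f x = 0 := by
  set φ := extChartAt (𝓡 m) p with hφ
  set b : EuclideanSpace ℝ (Fin m) := EuclideanSpace.single j 1 with hb
  set F := f ∘ φ.symm with hF
  have h1 : ∀ᶠ y in 𝓝 (φ p), DifferentiableAt ℝ F y ∧ fderiv ℝ F y b = 0 ∧
      (y j = φ p j → F y = 0) := by
    filter_upwards [eventually_mvfderiv_eq_fderiv hf,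
      (tendsto_extChartAt_symm (m := m) p).eventually (hX.and (hfX.and hf0))]
      with y ⟨hy1, hy2, hy3, hy4⟩ ⟨hy5, hy6, hy7⟩
    refine ⟨hy3, ?_, fun hy ↦ hy7 ?_⟩
    · rw [← hy5, ← hy4, hy6]
    · change φ (φ.symm y) j = φ p j
      rw [hy2, hy]
  obtain ⟨ε, hε, h2⟩ := Metric.eventually_nhds_iff_ball.1 h1
  have h3 : ∀ y ∈ Metric.ball (φ p) (ε / 2), F y = 0 := by
    intro y hy
    -- `z` is the projection of `y` to the hyperplane.
    set s := y j - φ p j with hs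
    set z := y - s • b with hz
    have hys : |s| ≤ ‖y - φ p‖ := PiLp.norm_apply_le (y - φ p) j
    have hzb : z ∈ Metric.ball (φ p) ε := by
      rw [mem_ball_iff_norm] at hy ⊢
      have h4 : z - φ p = (y - φ p) - s • b := by rw [hz]; abel
      have h5 : ‖s • b‖ = |s| := by rw [norm_smul, hb, PiLp.norm_single]; simp
      rw [h4]
      linarith [norm_sub_le (y - φ p) (s • b)]
    have hyb : y ∈ Metric.ball (φ p) ε := Metric.ball_subset_ball (by linarith) hy
    have hz0 : F z = 0 := (h2 z hzb).2.2 (by simp [hz, hb, hs])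
    have hyz : y - z = s • b := by rw [hz]; abel
    have hseg : ∀ t ∈ Icc (0 : ℝ) 1, z + t • (y - z) ∈ Metric.ball (φ p) ε := fun t ht ↦
      (convex_ball (φ p) ε).add_smul_sub_mem hzb hyb ht
    have hder : ∀ t ∈ Icc (0 : ℝ) 1, HasDerivAt (fun t : ℝ ↦ F (z + t • (y - z))) 0 t := by
      intro t ht
      have h5 : HasDerivAt (fun t : ℝ ↦ z + t • (y - z)) (y - z) t := by
        simpa using ((hasDerivAt_id t).smul_const (y - z)).const_add z
      have h6 := ((h2 _ (hseg t ht)).1.hasFDerivAt).comp_hasDerivAt t h5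
      rwa [hyz, map_smul, ← hyz, (h2 _ (hseg t ht)).2.1, smul_zero] at h6
    have h7 := constant_of_has_deriv_right_zero
      (fun t ht ↦ (hder t ht).continuousAt.continuousWithinAt)
      (fun t ht ↦ (hder t ⟨ht.1, ht.2.le⟩).hasDerivWithinAt) 1 ⟨zero_le_one, le_rfl⟩
    simpa [hz0] using h7
  filter_upwards [(tendsto_extChartAt (m := m) p).eventually (Metric.ball_mem_nhds _ (half_pos hε)),
    extChartAt_source_mem_nhds (I := 𝓡 m) p] with x hx hxs
  have h4 := h3 _ hx
  rwa [hF, Function.comp_apply, φ.left_inv hxs] at h4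

/-- A function which vanishes on a coordinate hyperplane has vanishing derivative along the
hyperplane. -/
lemma eventually_mvfderiv_eq_zero_of_slice {f : M → ℝ} {j : Fin m}
    {X : ∀ x : M, TangentSpace (𝓡 m) x}
    (hf : ∀ᶠ x in 𝓝 p, MDifferentiableAt (𝓡 m) 𝓘(ℝ, ℝ) f x)
    (hX : ∀ᶠ x in 𝓝 p, mvfderiv (𝓡 m) (chartCoord p j) x (X x) = 0)
    (hf0 : ∀ᶠ x in 𝓝 p, x ∈ coordSlice p j → f x = 0) :
    ∀ᶠ x in 𝓝 p, x ∈ coordSlice p j → mvfderiv (𝓡 m) f x (X x) = 0 := by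
  set φ := extChartAt (𝓡 m) p with hφ
  set F := f ∘ φ.symm with hF
  have h1 : ∀ᶠ y in 𝓝 (φ p), y j = φ p j → F y = 0 := by
    filter_upwards [eventually_mvfderiv_eq_fderiv hf,
      (tendsto_extChartAt_symm (m := m) p).eventually hf0]
      with y ⟨hy1, hy2, hy3, hy4⟩ hy5 hy
    refine hy5 ?_
    change φ (φ.symm y) j = φ p j
    rw [hy2, hy]
  filter_upwards [(tendsto_extChartAt (m := m) p).eventually (eventually_eventually_nhds.2 h1),
    hX, hf, eventually_mem_chart_source (m := m) p] with x hx hXx hfx hxs hxj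
  obtain ⟨hd, hv⟩ := mvfderiv_eq_fderiv_chart hxs hfx (X x)
  rw [mvfderiv_chartCoord hxs] at hXx
  set w := mvfderiv (𝓡 m) φ x (X x) with hw
  rw [hv]
  have h2 := hd.hasFDerivAt.hasLineDerivAt w
  have h3 : (fun t : ℝ ↦ F (φ x + t • w)) =ᶠ[𝓝 0] fun _ ↦ 0 := by
    have h4 : Tendsto (fun t : ℝ ↦ φ x + t • w) (𝓝 0) (𝓝 (φ x)) := by
      have : Continuous (fun t : ℝ ↦ φ x + t • w) := by fun_prop
      simpa using this.tendsto 0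
    filter_upwards [h4.eventually hx] with t ht
    refine ht ?_
    have hxj' : φ x j = φ p j := hxj
    simp [hXx, hxj']
  exact h2.unique ((hasDerivAt_const 0 0).congr_of_eventuallyEq h3)

/-- A linear differential equation along a coordinate vector field has a smooth solution with
initial value `1` on the transversal hyperplane. The universe of `A` is that of the model space, as
in `exists_contDiffAt_solution_linear`. -/
lemma exists_contMDiffAt_solution {A : Type} [NormedRing A] [NormedAlgebra ℝ A]
    [CompleteSpace A] {B : M → A} (hB : ∀ᶠ x in 𝓝 p, ContMDiffAt (𝓡 m) 𝓘(ℝ, A) ∞ B x) (j : Fin m) :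
    ∃ g : M → A, (∀ᶠ x in 𝓝 p, ContMDiffAt (𝓡 m) 𝓘(ℝ, A) ∞ g x) ∧
      (∀ᶠ x in 𝓝 p, ∀ v : TangentSpace (𝓡 m) x,
        mvfderiv (𝓡 m) (extChartAt (𝓡 m) p) x v = EuclideanSpace.single j 1 →
        mvfderiv (𝓡 m) g x v = B x * g x) ∧
      ∀ᶠ x in 𝓝 p, x ∈ coordSlice p j → g x = 1 := by
  set φ := extChartAt (𝓡 m) p with hφ
  obtain ⟨B', hB', hBB'⟩ := exists_contMDiff_eventuallyEq (M := EuclideanSpace ℝ (Fin m))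
    (p := φ p) (f := B ∘ φ.symm) (by
      filter_upwards [(tendsto_extChartAt_symm (m := m) p).eventually hB,
        (isOpen_extChartAt_target p).mem_nhds (mem_extChartAt_target (I := 𝓡 m) p)] with y hy hyt
      exact hy.comp y ((contMDiffOn_extChartAt_symm p).contMDiffAt
        ((isOpen_extChartAt_target p).mem_nhds hyt)))
  obtain ⟨g, hg⟩ := exists_contDiffAt_solution_linear hB'.contDiff
    (b := EuclideanSpace.single j 1) (ℓ := EuclideanSpace.proj j) (by simp) (φ p)
  refine ⟨g ∘ φ, ?_, ?_, ?_⟩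
  · filter_upwards [(tendsto_extChartAt (m := m) p).eventually hg,
      eventually_mem_chart_source (m := m) p]
      with x hx hxs
    exact hx.1.contMDiffAt.comp x (contMDiffAt_extChartAt' hxs)
  · filter_upwards [(tendsto_extChartAt (m := m) p).eventually (hg.and hBB'),
      eventually_mem_chart_source (m := m) p, extChartAt_source_mem_nhds (I := 𝓡 m) p]
      with x hx hxs hxs' v hv
    have h1 : DifferentiableAt ℝ g (φ x) := hx.1.1.differentiableAt (by simp)
    have h2 := mfderiv_comp x h1.mdifferentiableAt (mdifferentiableAt_extChartAt (I := 𝓡 m) hxs)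
    rw [mfderiv_eq_fderiv] at h2
    have h3 : mvfderiv (𝓡 m) (g ∘ φ) x v = fderiv ℝ g (φ x) (mvfderiv (𝓡 m) φ x v) :=
      DFunLike.congr_fun h2 v
    rw [h3, hv]
    have h4 := (h1.hasFDerivAt.hasLineDerivAt (EuclideanSpace.single j 1)).unique hx.1.2.1
    rw [h4, hx.2, Function.comp_apply, φ.left_inv hxs']
    rfl
  · filter_upwards [(tendsto_extChartAt (m := m) p).eventually hg] with x hx hxj
    refine hx.2.2 ?_
    have hxj' : φ x j = φ p j := hxj
    exact sub_eq_zero.2 hxj'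

end LocalCalculus

/-! ### Dorfman algebras and their straightening -/

section Algebra

/-- The algebraic structure carried by the sections of a Courant algebroid: a module `E` over a
commutative `ℝ`-algebra `R` of functions, with a scalar product, an anchor by which the elements
of `E` act on `R` as derivations, and a Dorfman bracket. -/
structure DorfmanAlgebra (R E : Type*) [CommRing R] [Algebra ℝ R] [AddCommGroup E] [Module R E]
    [Module ℝ E] where
  /-- The scalar product. -/
  pair : E →ₗ[R] E →ₗ[R] R
  /-- The anchor. -/
  act : E →ₗ[R] Derivation ℝ R R
  /-- The Dorfman bracket. -/
  br : E →ₗ[ℝ] E →ₗ[ℝ] E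
  pair_symm : ∀ u v, pair u v = pair v u
  eq_zero_of_pair : ∀ u, (∀ v, pair u v = 0) → u = 0
  jacobi : ∀ u v w, br u (br v w) = br (br u v) w + br v (br u w)
  act_pair : ∀ u v w, act u (pair v w) = pair (br u v) w + pair v (br u w)
  br_symm : ∀ u v w, pair (br u v) w + pair (br v u) w = act w (pair u v)

namespace DorfmanAlgebra

variable {R E : Type*} [CommRing R] [Algebra ℝ R] [AddCommGroup E] [Module R E] [Module ℝ E]
  (D : DorfmanAlgebra R E)

lemma ext_pair {u v : E} (h : ∀ w, D.pair u w = D.pair v w) : u = v :=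
  sub_eq_zero.1 (D.eq_zero_of_pair _ fun w ↦ by simp [h w])

/-- The Leibniz rule, a consequence of the invariance of the nondegenerate scalar product. -/
lemma br_smul (u v : E) (f : R) : D.br u (f • v) = f • D.br u v + D.act u f • v := by
  refine D.ext_pair fun w ↦ ?_
  have h1 := D.act_pair u (f • v) w
  have h2 := D.act_pair u v w
  simp only [map_smul, LinearMap.smul_apply, smul_eq_mul, Derivation.leibniz, map_add,
    LinearMap.add_apply] at h1 ⊢
  linear_combination -h1 + f * h2

/-- If the scalar product represents `1`, then the anchor is a homomorphism of brackets. -/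
lemma act_br_of_pair_eq_one {w w' : E} (hw : D.pair w w' = 1) (u v : E) (f : R) :
    D.act (D.br u v) f = D.act u (D.act v f) - D.act v (D.act u f) := by
  have h := D.jacobi u v (f • w)
  simp only [br_smul, map_add] at h
  have h0 := D.jacobi u v w
  have h1 : (D.act (D.br u v) f - (D.act u (D.act v f) - D.act v (D.act u f))) • w = 0 := by
    rw [h0] at h
    linear_combination (norm := module) (-1 : R) • h
  have h2 := congrArg (fun z ↦ D.pair z w') h1
  simp only [map_smul, LinearMap.smul_apply, hw, smul_eq_mul, mul_one, map_zero,
    LinearMap.zero_apply] at h2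
  exact sub_eq_zero.1 h2

/-- If the scalar product represents `1`, then every function has a gradient. -/
lemma exists_grad_of_pair_eq_one {w w' : E} (hw : D.pair w w' = 1) (f : R) :
    ∃ d, ∀ v, D.pair d v = D.act v f := by
  refine ⟨D.br (f • w) w' + D.br w' (f • w), fun v ↦ ?_⟩
  rw [map_add, LinearMap.add_apply, D.br_symm]
  simp [hw]

/-- The properties of the germs at a point `p` of an `m`-dimensional manifold, of the coordinates
`x`, of the evaluation `ev` at `p` and of the ideals `Z j` of germs which vanish on the coordinate
hyperplane through `p` transversal to the `j`-th coordinate direction, which are needed to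
straighten a transitive Courant algebroid. -/
structure IsChart {m : ℕ} (ι : Type*) [Fintype ι] [DecidableEq ι] (ev : R →ₐ[ℝ] ℝ) (x : Fin m → R)
    (Z : Fin m → Ideal R) : Prop where
  exists_basis : Nonempty (Module.Basis ι R E)
  isUnit_of_ev : ∀ f, ev f ≠ 0 → IsUnit f
  exists_pair : 0 < m → ∃ v w, ev (D.pair v w) ≠ 0
  exists_transversal : ∃ t : Fin m → E, ∀ l j,
    ev (D.act (t l) (x j)) = (1 : Matrix (Fin m) (Fin m) ℝ) l j
  act_eq_zero : ∀ u, (∀ j, D.act u (x j) = 0) → ∀ f, D.act u f = 0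
  eq_const : ∀ f, (∀ u, D.act u f = 0) → f = algebraMap ℝ R (ev f)
  eq_zero_of_mem : ∀ u j f, (∀ i, D.act u (x i) = (1 : Matrix (Fin m) (Fin m) R) j i) →
    D.act u f = 0 → f ∈ Z j → f = 0
  act_mem : ∀ u j f, D.act u (x j) = 0 → f ∈ Z j → D.act u f ∈ Z j
  ev_eq_zero : ∀ j, ∀ f ∈ Z j, ev f = 0
  exists_ode : ∀ u j, (∀ i, D.act u (x i) = (1 : Matrix (Fin m) (Fin m) R) j i) →
    ∀ A : Matrix ι ι R, ∃ g : Matrix ι ι R,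
      (∀ a b, D.act u (g a b) = (A * g) a b) ∧ ∀ a b, (g - 1) a b ∈ Z j

variable {D} {m : ℕ} {ι : Type*} [Fintype ι] [DecidableEq ι] {ev : R →ₐ[ℝ] ℝ} {x : Fin m → R}
  {Z : Fin m → Ideal R}

namespace IsChart

lemma exists_pair_eq_one (h : D.IsChart ι ev x Z) (hm : 0 < m) : ∃ v w, D.pair v w = 1 := by
  obtain ⟨v, w, hvw⟩ := h.exists_pair hm
  obtain ⟨f, hf⟩ := (h.isUnit_of_ev _ hvw).exists_left_inv
  exact ⟨f • v, w, by simpa using hf⟩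

lemma act_br (h : D.IsChart ι ev x Z) (u v : E) (f : R) :
    D.act (D.br u v) f = D.act u (D.act v f) - D.act v (D.act u f) := by
  rcases m.eq_zero_or_pos with rfl | hm
  · have h0 : ∀ u g, D.act u g = 0 := fun u ↦ h.act_eq_zero u (fun j ↦ j.elim0)
    simp [h0]
  · obtain ⟨v, w, hvw⟩ := h.exists_pair_eq_one hm
    exact D.act_br_of_pair_eq_one hvw _ _ _

lemma exists_grad (h : D.IsChart ι ev x Z) (j : Fin m) : ∃ d, ∀ v, D.pair d v = D.act v (x j) := by
  obtain ⟨v, w, hvw⟩ := h.exists_pair_eq_one j.pos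
  exact D.exists_grad_of_pair_eq_one hvw _

/-- The anchor annihilates the gradients: `[u, v] + [v, u]` is the gradient of `⟨u, v⟩`, while the
anchor of `[u, v]` is skew-symmetric in `u` and `v`. -/
lemma act_grad (h : D.IsChart ι ev x Z) (hm : 0 < m) {d : E} {f : R}
    (hd : ∀ v, D.pair d v = D.act v f) (g : R) : D.act d g = 0 := by
  obtain ⟨w, w', hw⟩ := h.exists_pair_eq_one hm
  have hg : g = D.pair (g • w) w' := by simp [hw]
  rw [hg, ← D.br_symm, D.pair_symm _ d, D.pair_symm _ d, hd, hd, h.act_br, h.act_br]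
  ring

/-- The bracket with a gradient is the gradient of the derivative. -/
lemma pair_br_grad (h : D.IsChart ι ev x Z) {d : E} {f : R}
    (hd : ∀ v, D.pair d v = D.act v f) (u v : E) :
    D.pair (D.br u d) v = D.act v (D.act u f) := by
  have h1 := D.act_pair u d v
  rw [hd, hd, h.act_br] at h1
  linear_combination -h1

/-- Partial data of an untwisted Courant algebroid: elements `e i`, `d i` and a basis `φ` such that
`d i` is the gradient of the coordinate `x i` and such that, for `i` in `S`, the elements `e i` lift
the coordinate vector fields, span an isotropic abelian subalgebra and commute with `φ`. -/
structure IsFlat (D : DorfmanAlgebra R E) (x : Fin m → R) (S : Set (Fin m)) (e d : Fin m → E)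
    (φ : Module.Basis ι R E) : Prop where
  grad : ∀ j v, D.pair (d j) v = D.act v (x j)
  act_e : ∀ i ∈ S, ∀ j, D.act (e i) (x j) = (1 : Matrix (Fin m) (Fin m) R) i j
  pair_e : ∀ i ∈ S, ∀ j ∈ S, D.pair (e i) (e j) = 0
  br_e : ∀ i ∈ S, ∀ j ∈ S, D.br (e i) (e j) = 0
  br_φ : ∀ i ∈ S, ∀ a, D.br (e i) (φ a) = 0

end IsChart

end DorfmanAlgebra
end Algebra

section Straightening

open scoped Matrix

namespace DorfmanAlgebra

variable {R E : Type*} [CommRing R] [Algebra ℝ R] [AddCommGroup E] [Module R E] [Module ℝ E]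
  {D : DorfmanAlgebra R E}
variable {m : ℕ} {ι : Type*} [Fintype ι] [DecidableEq ι] {ev : R →ₐ[ℝ] ℝ} {x : Fin m → R}
  {Z : Fin m → Ideal R}

lemma derivation_one_apply (X : Derivation ℝ R R) {n : Type*} [DecidableEq n] (i j : n) :
    X ((1 : Matrix n n R) i j) = 0 := by
  rw [Matrix.one_apply]
  split_ifs <;> simp

lemma derivation_sum_apply {n : Type*} (s : Finset n) (X : n → Derivation ℝ R R) (g : R) :
    (∑ i ∈ s, X i) g = ∑ i ∈ s, X i g := by
  classical
  induction s using Finset.induction_on with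
  | empty => simp
  | insert i s hi ih => simp [Finset.sum_insert hi, ih]

lemma br_eq_neg {u v : E} (h : ∀ w, D.act w (D.pair u v) = 0) : D.br u v = -D.br v u := by
  refine D.ext_pair fun w ↦ ?_
  have h1 := D.br_symm u v w
  rw [h w] at h1
  rw [map_neg, LinearMap.neg_apply]
  exact eq_neg_of_add_eq_zero_left h1

lemma br_self {u : E} (h : ∀ w, D.act w (D.pair u u) = 0) : D.br u u = 0 := by
  have h1 : (2 : ℝ) • D.br u u = 0 := by
    rw [two_smul, ← eq_neg_iff_add_eq_zero]
    exact br_eq_neg h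
  exact (smul_eq_zero.1 h1).resolve_left two_ne_zero

namespace IsChart

lemma isUnit_det {n : Type*} [Fintype n] [DecidableEq n] (h : D.IsChart ι ev x Z)
    {N : Matrix n n R} (hN : ∀ i j, ev (N i j) = (1 : Matrix n n ℝ) i j) : IsUnit N.det := by
  refine h.isUnit_of_ev _ ?_
  have h1 : ev.mapMatrix N = 1 := Matrix.ext hN
  rw [AlgHom.map_det, h1, Matrix.det_one]
  exact one_ne_zero

namespace IsFlat

variable {S : Set (Fin m)} {e d : Fin m → E} {φ : Module.Basis ι R E}

/-- The coordinate vector fields can be lifted to elements which commute with the given `e i`. -/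
lemma exists_lift (h : D.IsChart ι ev x Z) (F : IsFlat D x S e d φ) (k : Fin m) :
    ∃ v, (∀ j, D.act v (x j) = (1 : Matrix (Fin m) (Fin m) R) k j) ∧
      ∀ i ∈ S, D.br (e i) v = 0 := by
  obtain ⟨t, ht⟩ := h.exists_transversal
  -- Freezing the coefficients at the base point makes the transversal commute with the `e i`.
  set t' : Fin m → E := fun l ↦ ∑ a, algebraMap ℝ R (ev (φ.repr (t l) a)) • φ a with ht'
  set N : Matrix (Fin m) (Fin m) R := Matrix.of fun l j ↦ D.act (t' l) (x j) with hN
  have hbr : ∀ i ∈ S, ∀ l, D.br (e i) (t' l) = 0 := fun i hi l ↦ by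
    simp [ht', br_smul, F.br_φ i hi]
  have hdet : IsUnit N.det := h.isUnit_det fun l j ↦ by
    rw [← ht l j]
    conv_rhs => rw [← φ.sum_repr (t l)]
    simp only [hN, ht', Matrix.of_apply, map_sum, derivation_sum_apply, map_smul,
      Derivation.smul_apply, smul_eq_mul, map_mul, AlgHom.commutes,
      Algebra.algebraMap_self, RingHom.id_apply]
  have hNe : ∀ i ∈ S, ∀ l j, D.act (e i) (N l j) = 0 := fun i hi l j ↦ by
    have h1 := h.act_br (e i) (t' l) (x j)
    rw [hbr i hi, F.act_e i hi, derivation_one_apply] at h1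
    simpa [hN] using h1.symm
  set y := N⁻¹ k with hy
  have hyN : ∀ j, ∑ l, y l * N l j = (1 : Matrix (Fin m) (Fin m) R) k j := fun j ↦ by
    rw [← Matrix.nonsing_inv_mul N hdet, Matrix.mul_apply]
  have hye : ∀ i ∈ S, ∀ l, D.act (e i) (y l) = 0 := fun i hi l ↦ by
    have h1 : (fun l ↦ D.act (e i) (y l)) ᵥ* N = 0 := by
      ext j
      have h2 := congrArg (D.act (e i)) (hyN j)
      simp only [map_sum, Derivation.leibniz, hNe i hi,
        derivation_one_apply, smul_eq_mul] at h2
      simpa [Matrix.vecMul, dotProduct, mul_comm] using h2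
    have h2 := congrArg (fun z ↦ (z ᵥ* N⁻¹) l) h1
    simpa [Matrix.vecMul_vecMul, Matrix.mul_nonsing_inv N hdet] using h2
  refine ⟨∑ l, y l • t' l, fun j ↦ ?_, fun i hi ↦ ?_⟩
  · rw [← hyN j]
    simp [hN, derivation_sum_apply]
  · simp [br_smul, hbr i hi, hye i hi]

lemma act_d (h : D.IsChart ι ev x Z) (F : IsFlat D x S e d φ) (j : Fin m) (g : R) :
    D.act (d j) g = 0 :=
  h.act_grad j.pos (F.grad j) g

lemma pair_d (h : D.IsChart ι ev x Z) (F : IsFlat D x S e d φ) (i j : Fin m) :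
    D.pair (d i) (d j) = 0 := by
  rw [F.grad, F.act_d h]

omit [Fintype ι] [DecidableEq ι] in
lemma pair_d_e (F : IsFlat D x S e d φ) {i : Fin m} (hi : i ∈ S) (j : Fin m) :
    D.pair (d j) (e i) = (1 : Matrix (Fin m) (Fin m) R) i j := by
  rw [F.grad, F.act_e i hi]

lemma br_d (h : D.IsChart ι ev x Z) (F : IsFlat D x S e d φ) {u : E}
    {i : Fin m} (hu : ∀ j, D.act u (x j) = (1 : Matrix (Fin m) (Fin m) R) i j) (j : Fin m) :
    D.br u (d j) = 0 :=
  D.eq_zero_of_pair _ fun v ↦ by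
    rw [h.pair_br_grad (F.grad j), hu, derivation_one_apply]

/-- The lift of a coordinate vector field can be made isotropic and orthogonal to the `e i` by
subtracting a combination of gradients. -/
lemma exists_isotropic_lift (h : D.IsChart ι ev x Z) (F : IsFlat D x S e d φ) {k : Fin m}
    (hk : k ∉ S) : ∃ v, (∀ j, D.act v (x j) = (1 : Matrix (Fin m) (Fin m) R) k j) ∧
      (∀ i ∈ S, D.br (e i) v = 0) ∧ (∀ i ∈ S, D.pair (e i) v = 0) ∧ D.pair v v = 0 := by
  classical
  obtain ⟨v, hv, hve⟩ := F.exists_lift h k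
  have hdd := F.pair_d h
  have hbd : ∀ i ∈ S, ∀ j, D.br (e i) (d j) = 0 := fun i hi ↦ F.br_d h (F.act_e i hi)
  have hact : ∀ i ∈ S, ∀ w, D.br (e i) w = 0 → ∀ w', D.br (e i) w' = 0 →
      D.act (e i) (D.pair w w') = 0 := fun i hi w hw w' hw' ↦ by
    rw [D.act_pair, hw, hw']; simp
  set v₁ := v - ∑ j ∈ S.toFinset, D.pair v (e j) • d j with hv₁
  have h1 : ∀ j, D.act v₁ (x j) = (1 : Matrix (Fin m) (Fin m) R) k j := fun j ↦ by
    simp [hv₁, hv, derivation_sum_apply, F.act_d h]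
  have h1e : ∀ i ∈ S, D.br (e i) v₁ = 0 := fun i hi ↦ by
    rw [hv₁, map_sub, hve i hi, map_sum, zero_sub, neg_eq_zero]
    refine Finset.sum_eq_zero fun j hj ↦ ?_
    rw [br_smul, hbd i hi, hact i hi _ (hve i hi) _ (F.br_e i hi j (by simpa using hj))]
    simp
  have h1p : ∀ i ∈ S, D.pair v₁ (e i) = 0 := fun i hi ↦ by
    rw [hv₁, map_sub, LinearMap.sub_apply, map_sum, LinearMap.sum_apply,
      Finset.sum_eq_single i]
    · simp [F.pair_d_e hi]
    · intro j _ hj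
      simp [F.pair_d_e hi, Matrix.one_apply_ne hj.symm]
    · simp [hi]
  set q := algebraMap ℝ R (1 / 2) * D.pair v₁ v₁ with hq
  have h2q : 2 * q = D.pair v₁ v₁ := by
    have h2 : (2 : R) * algebraMap ℝ R (1 / 2) = 1 := by
      rw [← map_ofNat (algebraMap ℝ R) 2, ← map_mul]
      norm_num
    rw [hq, ← mul_assoc, h2, one_mul]
  have hqe : ∀ i ∈ S, D.act (e i) q = 0 := fun i hi ↦ by
    rw [hq, Derivation.leibniz, Derivation.map_algebraMap, hact i hi _ (h1e i hi) _ (h1e i hi)]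
    simp
  have hdv : D.pair (d k) v₁ = 1 := by rw [F.grad, h1, Matrix.one_apply_eq]
  refine ⟨v₁ - q • d k, fun j ↦ ?_, fun i hi ↦ ?_, fun i hi ↦ ?_, ?_⟩
  · simp [h1, F.act_d h]
  · simp [h1e i hi, br_smul, hqe i hi, hbd i hi]
  · have hik : i ≠ k := fun hik ↦ hk (hik ▸ hi)
    rw [D.pair_symm]
    simp [h1p i hi, F.pair_d_e hi, Matrix.one_apply_ne hik]
  · simp only [map_sub, LinearMap.sub_apply, map_smul, LinearMap.smul_apply, hdv, hdd,
      D.pair_symm v₁ (d k), smul_eq_mul]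
    linear_combination -h2q

/-- The frame `φ` can be replaced by one which commutes with one more lift `v` of a coordinate
vector field: the transition matrix solves a linear differential equation along that vector field,
with the identity matrix as initial value on a transversal hyperplane. -/
lemma exists_frame (h : D.IsChart ι ev x Z) (F : IsFlat D x S e d φ) {k : Fin m} (hk : k ∉ S)
    {v : E} (hv : ∀ j, D.act v (x j) = (1 : Matrix (Fin m) (Fin m) R) k j)
    (hve : ∀ i ∈ S, D.br (e i) v = 0) (hpe : ∀ i ∈ S, D.pair (e i) v = 0) :
    ∃ φ' : Module.Basis ι R E, (∀ a, D.br v (φ' a) = 0) ∧ ∀ i ∈ S, ∀ a, D.br (e i) (φ' a) = 0 := by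
  have hev : ∀ i ∈ S, D.br v (e i) = 0 := fun i hi ↦ by
    rw [br_eq_neg, hve i hi, neg_zero]
    simp [D.pair_symm v, hpe i hi]
  set Γ : Matrix ι ι R := Matrix.of fun a b ↦ φ.repr (D.br v (φ b)) a with hΓ
  obtain ⟨g, hg, hgZ⟩ := h.exists_ode v k hv (-Γ)
  have hdet : IsUnit g.det := h.isUnit_det fun a b ↦ by
    have h1 := h.ev_eq_zero k _ (hgZ a b)
    rw [Matrix.sub_apply, map_sub, sub_eq_zero] at h1
    rw [h1, Matrix.one_apply, Matrix.one_apply]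
    split_ifs <;> simp
  set φ' := φ.map (Matrix.toLinearEquiv φ g hdet) with hφ'
  have hφ'a : ∀ b, φ' b = ∑ a, g a b • φ a := fun b ↦ by
    simp [hφ', Matrix.toLinearEquiv, Matrix.toLin_self]
  have hvφ : ∀ b, D.br v (φ' b) = 0 := fun b ↦ by
    have h1 : ∀ c, D.br v (φ c) = ∑ a, Γ a c • φ a := fun c ↦ (φ.sum_repr _).symm
    simp only [hφ'a, map_sum, br_smul, h1, hg, Finset.sum_add_distrib, Finset.smul_sum, smul_smul,
      Matrix.mul_apply, Matrix.neg_apply, neg_mul, Finset.sum_neg_distrib, neg_smul,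
      Finset.sum_smul]
    rw [Finset.sum_comm, add_neg_eq_zero]
    simp only [mul_comm]
  refine ⟨φ', hvφ, fun i hi b ↦ ?_⟩
  have hik : i ≠ k := fun hik ↦ hk (hik ▸ hi)
  set u := D.br (e i) (φ' b) with hu
  -- `u` is parallel along `v`, and it vanishes on the hyperplane.
  have hvu : D.br v u = 0 := by
    rw [hu, D.jacobi, hvφ, hev i hi]
    simp
  have huZ : ∀ a, φ.repr u a ∈ Z k := fun a ↦ by
    have h1 : u = ∑ a, D.act (e i) (g a b) • φ a := by
      simp [hu, hφ'a, br_smul, F.br_φ i hi]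
    rw [h1, φ.repr_sum_self]
    have h2 := h.act_mem (e i) k _ (by rw [F.act_e i hi, Matrix.one_apply_ne hik]) (hgZ a b)
    rwa [Matrix.sub_apply, map_sub, derivation_one_apply, sub_zero] at h2
  have huZ' : ∀ a, φ'.repr u a ∈ Z k := fun a ↦ by
    have h1 : u = ∑ c, φ.repr u c • φ c := (φ.sum_repr u).symm
    rw [h1]
    simp only [map_sum, map_smul, Finsupp.coe_finsetSum, Finset.sum_apply, Finsupp.smul_apply,
      smul_eq_mul]
    exact Ideal.sum_mem _ fun c _ ↦ Ideal.mul_mem_right _ _ (huZ c)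
  have h3 : ∀ a, D.act v (φ'.repr u a) = 0 := fun a ↦ by
    have h1 : D.br v u = ∑ a, D.act v (φ'.repr u a) • φ' a := by
      conv_lhs => rw [← φ'.sum_repr u]
      simp only [map_sum, br_smul, hvφ, smul_zero, zero_add]
    have h2 := congrArg (fun z ↦ φ'.repr z a) h1
    simp only [hvu, φ'.repr_sum_self] at h2
    simpa using h2.symm
  refine φ'.ext_elem fun a ↦ ?_
  rw [h.eq_zero_of_mem v k _ hv (h3 a) (huZ' a)]
  simp

/-- One more coordinate vector field is lifted. -/
lemma exists_insert (h : D.IsChart ι ev x Z) (F : IsFlat D x S e d φ) {k : Fin m} (hk : k ∉ S) :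
    ∃ (e' : Fin m → E) (φ' : Module.Basis ι R E), IsFlat D x (insert k S) e' d φ' := by
  obtain ⟨v, hv, hve, hpe, hvv⟩ := F.exists_isotropic_lift h hk
  obtain ⟨φ', hvφ, heφ⟩ := F.exists_frame h hk hv hve hpe
  have hvv' : D.br v v = 0 := br_self fun w ↦ by simp [hvv]
  have hev : ∀ i ∈ S, D.br v (e i) = 0 := fun i hi ↦ by
    rw [br_eq_neg, hve i hi, neg_zero]
    simp [D.pair_symm v, hpe i hi]
  have hS : ∀ i ∈ S, Function.update e k v i = e i := fun i hi ↦
    Function.update_of_ne (fun hik : i = k ↦ hk (hik ▸ hi)) _ _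
  refine ⟨Function.update e k v, φ', F.grad, ?_, ?_, ?_, ?_⟩
  · rintro i (rfl | hi)
    · simpa using hv
    · rw [hS i hi]
      exact F.act_e i hi
  · rintro i (rfl | hi) j (rfl | hj)
    · simpa using hvv
    · rw [hS j hj, Function.update_self, D.pair_symm, hpe j hj]
    · rw [hS i hi, Function.update_self, hpe i hi]
    · rw [hS i hi, hS j hj, F.pair_e i hi j hj]
  · rintro i (rfl | hi) j (rfl | hj)
    · simpa using hvv'
    · rw [hS j hj, Function.update_self, hev j hj]
    · rw [hS i hi, Function.update_self, hve i hi]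
    · rw [hS i hi, hS j hj, F.br_e i hi j hj]
  · rintro i (rfl | hi) a
    · simpa using hvφ a
    · rw [hS i hi, heφ i hi]

end IsFlat

/-- The coordinate vector fields can be lifted simultaneously to isotropic commuting elements which
admit a parallel frame. -/
lemma exists_isFlat (h : D.IsChart ι ev x Z) :
    ∃ (e d : Fin m → E) (φ : Module.Basis ι R E), IsFlat D x univ e d φ := by
  obtain ⟨φ⟩ := h.exists_basis
  choose d hd using h.exists_grad
  suffices H : ∀ S : Finset (Fin m), ∃ (e : Fin m → E) (φ : Module.Basis ι R E),
      IsFlat D x S e d φ by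
    obtain ⟨e, φ, F⟩ := H Finset.univ
    exact ⟨e, d, φ, by simpa using F⟩
  intro S
  induction S using Finset.induction_on with
  | empty => exact ⟨0, φ, hd, by simp, by simp, by simp, by simp⟩
  | insert k S hk ih =>
    obtain ⟨e, φ, F⟩ := ih
    simpa using F.exists_insert h (k := k) (by simpa using hk)

end IsChart
end DorfmanAlgebra

end Straightening

/-! ### The quadratic Lie algebra of parallel elements -/

/-- The transport of the structure of a quadratic Lie algebra along a linear isomorphism. -/
def QuadraticLieAlgebra.comap {𝔤 𝔥 : Type*} [AddCommGroup 𝔤] [Module ℝ 𝔤] [AddCommGroup 𝔥]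
    [Module ℝ 𝔥] (Q : QuadraticLieAlgebra 𝔤) (L : 𝔥 ≃ₗ[ℝ] 𝔤) : QuadraticLieAlgebra 𝔥 where
  bracket := (Q.bracket.compl₁₂ L.toLinearMap L.toLinearMap).compr₂ L.symm.toLinearMap
  form := Q.form.compl₁₂ L.toLinearMap L.toLinearMap
  bracket_self a := by simp [Q.bracket_self]
  jacobi a b c := by simp [Q.jacobi (L a) (L b) (L c)]
  form_symm a b := by simp [Q.form_symm (L a) (L b)]
  form_nondegenerate a h := L.map_eq_zero_iff.1 <| Q.form_nondegenerate _ fun b ↦ by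
    simpa using h (L.symm b)
  form_invariant a b c := by simpa using Q.form_invariant (L a) (L b) (L c)

namespace DorfmanAlgebra

variable {R E : Type*} [CommRing R] [Algebra ℝ R] [AddCommGroup E] [Module R E] [Module ℝ E]
  {D : DorfmanAlgebra R E}
variable {m : ℕ} {ι : Type*} [Fintype ι] [DecidableEq ι] {ev : R →ₐ[ℝ] ℝ} {x : Fin m → R}
  {Z : Fin m → Ideal R}

/-- The elements `e i`, `d j` and `r a` exhibit `D` as an untwisted Courant algebroid with fibre the
quadratic Lie algebra `Q`: `e i` is the `i`-th coordinate vector field, `d j` is twice the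
differential of the `j`-th coordinate and `r a` is the constant section `a`. -/
structure IsUntwisted {𝔤 : Type*} [AddCommGroup 𝔤] [Module ℝ 𝔤] (D : DorfmanAlgebra R E)
    (x : Fin m → R) (Q : QuadraticLieAlgebra 𝔤) (e d : Fin m → E) (r : 𝔤 →ₗ[ℝ] E) : Prop where
  grad : ∀ j v, D.pair (d j) v = D.act v (x j)
  act_e : ∀ i j, D.act (e i) (x j) = (1 : Matrix (Fin m) (Fin m) R) i j
  act_d : ∀ i j, D.act (d i) (x j) = 0
  act_r : ∀ a f, D.act (r a) f = 0
  pair_e : ∀ i j, D.pair (e i) (e j) = 0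
  pair_r_e : ∀ a i, D.pair (r a) (e i) = 0
  pair_r : ∀ a b, D.pair (r a) (r b) = algebraMap ℝ R (Q.form a b)
  br_e : ∀ i j, D.br (e i) (e j) = 0
  br_e_d : ∀ i j, D.br (e i) (d j) = 0
  br_e_r : ∀ i a, D.br (e i) (r a) = 0
  br_r_d : ∀ a j, D.br (r a) (d j) = 0
  br_r : ∀ a b, D.br (r a) (r b) = r (Q.bracket a b)
  eq_zero : ∀ u, (∀ i, D.pair u (e i) = 0) → (∀ j, D.pair u (d j) = 0) →
    (∀ a, D.pair u (r a) = 0) → u = 0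

namespace IsChart

namespace IsFlat

variable {e d : Fin m → E} {φ : Module.Basis ι R E}

/-- A function which is constant along the lifts of the coordinate vector fields is constant. -/
lemma eq_const (h : D.IsChart ι ev x Z) (F : IsFlat D x univ e d φ) {f : R}
    (hf : ∀ i, D.act (e i) f = 0) : f = algebraMap ℝ R (ev f) := by
  refine h.eq_const f fun u ↦ ?_
  have h1 := h.act_eq_zero (u - ∑ i, D.act u (x i) • e i) (fun j ↦ by
    simp [derivation_sum_apply, F.act_e, Matrix.one_apply]) f
  simpa [derivation_sum_apply, hf] using h1

lemma pair_eq_const (h : D.IsChart ι ev x Z) (F : IsFlat D x univ e d φ) {u v : E}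
    (hu : ∀ i, D.br (e i) u = 0) (hv : ∀ i, D.br (e i) v = 0) :
    D.pair u v = algebraMap ℝ R (ev (D.pair u v)) :=
  F.eq_const h fun i ↦ by simp [D.act_pair, hu, hv]

variable [IsScalarTower ℝ R E]

/-- The parallel elements orthogonal to the `e i` and the `d j`. -/
def flatOrthogonal (D : DorfmanAlgebra R E) (e d : Fin m → E) : Submodule ℝ E where
  carrier := {u | (∀ i, D.br (e i) u = 0) ∧ (∀ i, D.pair u (e i) = 0) ∧ ∀ j, D.pair u (d j) = 0}
  add_mem' := fun ⟨h1, h2, h3⟩ ⟨h1', h2', h3'⟩ ↦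
    ⟨fun i ↦ by simp [h1, h1'], fun i ↦ by simp [h2, h2'], fun i ↦ by simp [h3, h3']⟩
  zero_mem' := by simp
  smul_mem' := fun c u ⟨h1, h2, h3⟩ ↦ by
    rw [← algebraMap_smul R c u]
    refine ⟨fun i ↦ ?_, fun i ↦ by rw [map_smul]; simp [h2], fun i ↦ by rw [map_smul]; simp [h3]⟩
    rw [D.br_smul, h1]
    simp

lemma br_mem_flatOrthogonal (h : D.IsChart ι ev x Z) (F : IsFlat D x univ e d φ) {u v : E}
    (hu : u ∈ flatOrthogonal D e d) (hv : v ∈ flatOrthogonal D e d) :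
    D.br u v ∈ flatOrthogonal D e d := by
  obtain ⟨hu1, hu2, hu3⟩ := hu
  obtain ⟨hv1, hv2, hv3⟩ := hv
  have hux : ∀ j, D.act u (x j) = 0 := fun j ↦ by rw [← F.grad, D.pair_symm, hu3]
  have hvx : ∀ j, D.act v (x j) = 0 := fun j ↦ by rw [← F.grad, D.pair_symm, hv3]
  refine ⟨fun i ↦ by simp [D.jacobi, hu1, hv1], fun i ↦ ?_, fun j ↦ ?_⟩
  · have h1 := D.act_pair u v (e i)
    rw [br_eq_neg (u := u) (v := e i) fun w ↦ by simp [hu2], hu1, hv2] at h1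
    simpa using h1.symm
  · rw [D.pair_symm, F.grad, h.act_br, hux, hvx]
    simp

/-- The coefficients of a parallel element in the parallel frame are constants, so that the element
is determined by its value at the base point. -/
lemma finiteDimensional_flatOrthogonal (h : D.IsChart ι ev x Z) (F : IsFlat D x univ e d φ) :
    FiniteDimensional ℝ (flatOrthogonal D e d) := by
  set T : flatOrthogonal D e d →ₗ[ℝ] ι → ℝ := LinearMap.pi fun a ↦
    ev.toLinearMap ∘ₗ (Finsupp.lapply (R := R) (M := R) a).restrictScalars ℝ ∘ₗ
      φ.repr.toLinearMap.restrictScalars ℝ ∘ₗ (flatOrthogonal D e d).subtype with hT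
  refine FiniteDimensional.of_injective T ((injective_iff_map_eq_zero T).2 fun u hu ↦ ?_)
  refine Subtype.ext (φ.ext_elem fun a ↦ ?_)
  rw [F.eq_const h (f := φ.repr u a) fun i ↦ ?_]
  · have h1 : ev (φ.repr u a) = 0 := congrFun hu a
    simp [h1]
  · have h1 : D.br (e i) u = ∑ a, D.act (e i) (φ.repr u a) • φ a := by
      conv_lhs => rw [← φ.sum_repr u]
      simp only [map_sum, br_smul, F.br_φ i (mem_univ i), smul_zero, zero_add]
    have h2 := congrArg (fun z ↦ φ.repr z a) h1
    simp only [u.2.1 i, φ.repr_sum_self] at h2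
    simpa using h2.symm

/-- A parallel element is a combination of the `e i`, the `d j` and a parallel element orthogonal
to them. -/
lemma sub_mem_flatOrthogonal (h : D.IsChart ι ev x Z) (F : IsFlat D x univ e d φ) {u : E}
    (hu : ∀ i, D.br (e i) u = 0) :
    u - ∑ i, D.pair u (d i) • e i - ∑ i, D.pair u (e i) • d i ∈ flatOrthogonal D e d := by
  have hbd : ∀ i j, D.br (e i) (d j) = 0 := fun i ↦ F.br_d h (F.act_e i (mem_univ i))
  have hbe : ∀ i j, D.br (e i) (e j) = 0 := fun i j ↦ F.br_e i (mem_univ i) j (mem_univ j)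
  have hpe : ∀ i j, D.pair (e i) (e j) = 0 := fun i j ↦ F.pair_e i (mem_univ i) j (mem_univ j)
  have hde : ∀ i j, D.pair (d i) (e j) = (1 : Matrix (Fin m) (Fin m) R) j i := fun i j ↦
    F.pair_d_e (mem_univ j) i
  have hed : ∀ i j, D.pair (e i) (d j) = (1 : Matrix (Fin m) (Fin m) R) i j := fun i j ↦ by
    rw [D.pair_symm, hde]
  have h1 : ∀ i j, D.act (e i) (D.pair u (e j)) = 0 := fun i j ↦ by simp [D.act_pair, hu, hbe]
  have h2 : ∀ i j, D.act (e i) (D.pair u (d j)) = 0 := fun i j ↦ by simp [D.act_pair, hu, hbd]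
  refine ⟨fun i ↦ ?_, fun i ↦ ?_, fun i ↦ ?_⟩
  · simp [br_smul, hu, hbd, hbe, h1, h2]
  · simp [hpe, hde, Matrix.one_apply]
  · simp [hed, F.pair_d h, Matrix.one_apply]

/-- The quadratic Lie algebra of the parallel elements orthogonal to the `e i` and the `d j`. -/
def quadraticLieAlgebra (h : D.IsChart ι ev x Z) (F : IsFlat D x univ e d φ) :
    QuadraticLieAlgebra (flatOrthogonal D e d) where
  bracket := LinearMap.mk₂ ℝ (fun u v ↦ ⟨D.br u v, F.br_mem_flatOrthogonal h u.2 v.2⟩)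
    (fun u u' v ↦ by ext; simp) (fun c u v ↦ by ext; simp)
    (fun u v v' ↦ by ext; simp) (fun c u v ↦ by ext; simp)
  form := LinearMap.mk₂ ℝ (fun u v ↦ ev (D.pair u v))
    (fun u u' v ↦ by simp) (fun c u v ↦ by rw [Submodule.coe_smul, ← algebraMap_smul R c]; simp)
    (fun u v v' ↦ by simp) (fun c u v ↦ by rw [Submodule.coe_smul, ← algebraMap_smul R c]; simp)
  bracket_self u := Subtype.ext <| br_self fun w ↦ by
    rw [F.pair_eq_const h u.2.1 u.2.1, Derivation.map_algebraMap]
  jacobi u v w := Subtype.ext (D.jacobi u v w)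
  form_symm u v := by simp [D.pair_symm u.1]
  form_nondegenerate u hu := by
    have hu' : ∀ v ∈ flatOrthogonal D e d, D.pair u v = 0 := fun v hv ↦ by
      rw [F.pair_eq_const h u.2.1 hv.1]
      have h1 : ev (D.pair u v) = 0 := hu ⟨v, hv⟩
      simp [h1]
    refine Subtype.ext (D.eq_zero_of_pair _ fun v ↦ ?_)
    suffices H : D.pair u = 0 by simp [H]
    refine φ.ext fun a ↦ ?_
    have h1 := hu' _ (F.sub_mem_flatOrthogonal h fun i ↦ F.br_φ i (mem_univ i) a)
    simpa [u.2.2.1, u.2.2.2] using h1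
  form_invariant u v w := by
    have h1 := congrArg ev (D.act_pair u v w)
    rw [F.pair_eq_const h v.2.1 w.2.1, Derivation.map_algebraMap, map_zero, map_add] at h1
    exact h1.symm

end IsFlat

variable [IsScalarTower ℝ R E]

/-- The algebraic form of the local triviality of transitive Courant algebroids: the parallel
elements orthogonal to the lifted coordinate vector fields and to the gradients are the constant
sections of the bundle of quadratic Lie algebras. -/
theorem exists_isUntwisted (h : D.IsChart ι ev x Z) :
    ∃ (n : ℕ) (Q : QuadraticLieAlgebra (Fin n → ℝ)) (e d : Fin m → E) (r : (Fin n → ℝ) →ₗ[ℝ] E),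
      D.IsUntwisted x Q e d r := by
  obtain ⟨e, d, φ, F⟩ := h.exists_isFlat
  have := F.finiteDimensional_flatOrthogonal h
  set L := ((Module.finBasis ℝ (IsFlat.flatOrthogonal D e d)).equivFun).symm with hL
  have hact : ∀ a f, D.act (L a : E) f = 0 := fun a ↦ h.act_eq_zero _ fun j ↦ by
    rw [← F.grad, D.pair_symm]
    exact (L a).2.2.2 j
  refine ⟨_, (F.quadraticLieAlgebra h).comap L, e, d,
    (IsFlat.flatOrthogonal D e d).subtype ∘ₗ L.toLinearMap, F.grad,
    fun i ↦ F.act_e i (mem_univ i), fun i j ↦ F.act_d h i _, hact,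
    fun i j ↦ F.pair_e i (mem_univ i) j (mem_univ j), fun a i ↦ (L a).2.2.1 i,
    fun a b ↦ F.pair_eq_const h (L a).2.1 (L b).2.1,
    fun i j ↦ F.br_e i (mem_univ i) j (mem_univ j), fun i ↦ F.br_d h (F.act_e i (mem_univ i)),
    fun i a ↦ (L a).2.1 i, fun a j ↦ ?_, fun a b ↦ ?_, fun u hue hud hur ↦ ?_⟩
  · refine D.eq_zero_of_pair _ fun v ↦ ?_
    rw [h.pair_br_grad (F.grad j), LinearMap.comp_apply]
    exact (congrArg (D.act v) (hact a (x j))).trans (map_zero _)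
  · have h1 : L (((F.quadraticLieAlgebra h).comap L).bracket a b) =
        (F.quadraticLieAlgebra h).bracket (L a) (L b) := L.apply_symm_apply _
    exact (congrArg Subtype.val h1).symm
  · refine D.eq_zero_of_pair _ fun v ↦ ?_
    suffices H : D.pair u = 0 by simp [H]
    refine φ.ext fun a ↦ ?_
    obtain ⟨b, hb⟩ := L.surjective ⟨_, F.sub_mem_flatOrthogonal h fun i ↦ F.br_φ i (mem_univ i) a⟩
    have h1 := hur b
    rw [LinearMap.comp_apply, LinearEquiv.coe_coe, hb, Submodule.subtype_apply] at h1
    simpa [hue, hud] using h1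

end IsChart
end DorfmanAlgebra

/-! ### Quotients of Dorfman algebras -/

namespace DorfmanAlgebra

variable {R E : Type*} [CommRing R] [Algebra ℝ R] [AddCommGroup E] [Module R E] [Module ℝ E]
  (D : DorfmanAlgebra R E) (I : Ideal R)

/-- The class of a section modulo the sections with coefficients in an ideal. -/
abbrev toQuot : E →ₗ[R] E ⧸ (I • ⊤ : Submodule R E) := Submodule.mkQ _

/-- The class of a function modulo an ideal. -/
abbrev toQuotR : R →+* R ⧸ I := Ideal.Quotient.mk I

omit [Algebra ℝ R] in
lemma toQuotR_surjective : Function.Surjective (toQuotR I) := Ideal.Quotient.mk_surjective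

omit [Algebra ℝ R] [Module ℝ E] in
lemma toQuot_surjective : Function.Surjective (toQuot (E := E) I) := Submodule.mkQ_surjective _

omit [Algebra ℝ R] [Module ℝ E] in
lemma toQuot_smul (f : R) (u : E) : toQuot I (f • u) = toQuotR I f • toQuot I u := rfl

omit [Algebra ℝ R] [Module ℝ E] in
lemma toQuot_eq_iff {u v : E} : toQuot I u = toQuot I v ↔ u - v ∈ (I • ⊤ : Submodule R E) :=
  Submodule.Quotient.eq _

omit [Algebra ℝ R] in
lemma toQuotR_eq_iff {f g : R} : toQuotR I f = toQuotR I g ↔ f - g ∈ I :=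
  Ideal.Quotient.eq

lemma toQuot_smul_real [IsScalarTower ℝ R E] (c : ℝ) (u : E) :
    toQuot I (c • u) = c • toQuot I u := rfl

instance isScalarTower_quotient [IsScalarTower ℝ R E] :
    IsScalarTower ℝ (R ⧸ I) (E ⧸ (I • ⊤ : Submodule R E)) where
  smul_assoc c f u := by
    obtain ⟨f, rfl⟩ := toQuotR_surjective I f
    obtain ⟨u, rfl⟩ := toQuot_surjective I u
    exact congrArg (toQuot I) (smul_assoc c f u)

/-- An ideal of functions which is compatible with the operations of a Dorfman algebra. -/
structure IsLocal : Prop where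
  act_mem : ∀ u, ∀ f ∈ I, D.act u f ∈ I
  mem_of_pair : ∀ u, (∀ v, D.pair u v ∈ I) → u ∈ (I • ⊤ : Submodule R E)

namespace IsLocal

variable {D I}

lemma pair_mem {u : E} (hu : u ∈ (I • ⊤ : Submodule R E)) (v : E) : D.pair u v ∈ I := by
  refine Submodule.smul_induction_on hu (fun f hf w _ ↦ ?_) fun w w' hw hw' ↦ ?_
  · simpa using I.mul_mem_right _ hf
  · simpa using I.add_mem hw hw'

lemma act_mem_left {u : E} (hu : u ∈ (I • ⊤ : Submodule R E)) (f : R) : D.act u f ∈ I := by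
  refine Submodule.smul_induction_on hu (fun g hg w _ ↦ ?_) fun w w' hw hw' ↦ ?_
  · simpa using I.mul_mem_right _ hg
  · simpa using I.add_mem hw hw'

lemma br_mem (h : D.IsLocal I) {u : E} (hu : u ∈ (I • ⊤ : Submodule R E)) (v : E) :
    D.br v u ∈ (I • ⊤ : Submodule R E) := by
  refine Submodule.smul_induction_on hu (fun f hf w _ ↦ ?_) fun w w' hw hw' ↦ ?_
  · rw [br_smul]
    exact add_mem (Submodule.smul_mem_smul hf trivial)
      (Submodule.smul_mem_smul (h.act_mem _ _ hf) trivial)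
  · simpa using add_mem hw hw'

lemma br_mem_left (h : D.IsLocal I) {u : E} (hu : u ∈ (I • ⊤ : Submodule R E)) (v : E) :
    D.br u v ∈ (I • ⊤ : Submodule R E) := by
  refine h.mem_of_pair _ fun w ↦ ?_
  rw [eq_sub_of_add_eq (D.br_symm u v w)]
  exact I.sub_mem (h.act_mem _ _ (pair_mem hu v)) (pair_mem (h.br_mem hu v) w)

/-- The scalar product modulo an ideal, in terms of representatives. -/
lemma pair_congr {u u' v v' : E} (hu : toQuot I u = toQuot I u') (hv : toQuot I v = toQuot I v') :
    toQuotR I (D.pair u v) = toQuotR I (D.pair u' v') := by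
  rw [toQuot_eq_iff] at hu hv
  have h1 := I.add_mem (pair_mem (D := D) hu v) (pair_mem (D := D) hv u')
  rw [D.pair_symm (v - v')] at h1
  rw [toQuotR_eq_iff]
  simpa using h1

lemma act_congr (h : D.IsLocal I) {u u' : E} {f f' : R} (hu : toQuot I u = toQuot I u')
    (hf : toQuotR I f = toQuotR I f') : toQuotR I (D.act u f) = toQuotR I (D.act u' f') := by
  rw [toQuot_eq_iff] at hu
  rw [toQuotR_eq_iff] at hf ⊢
  have h1 := I.add_mem (act_mem_left (D := D) hu f) (h.act_mem u' _ hf)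
  simpa using h1

lemma br_congr (h : D.IsLocal I) {u u' v v' : E} (hu : toQuot I u = toQuot I u')
    (hv : toQuot I v = toQuot I v') : toQuot I (D.br u v) = toQuot I (D.br u' v') := by
  rw [toQuot_eq_iff] at hu hv ⊢
  have h1 := add_mem (h.br_mem_left hu v) (h.br_mem hv u')
  simpa using h1

end IsLocal

/-- A representative of a class of functions. -/
def repR (f : R ⧸ I) : R := Function.surjInv (toQuotR_surjective I) f

/-- A representative of a class of sections. -/
def repE (u : E ⧸ (I • ⊤ : Submodule R E)) : E := Function.surjInv (toQuot_surjective I) u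

omit [Algebra ℝ R] in
lemma toQuotR_repR (f : R ⧸ I) : toQuotR I (repR I f) = f := Function.surjInv_eq _ _

omit [Algebra ℝ R] [Module ℝ E] in
lemma toQuot_repE (u : E ⧸ (I • ⊤ : Submodule R E)) : toQuot I (repE I u) = u :=
  Function.surjInv_eq _ _

variable {D I}

/-- The action of a class of sections on classes of functions. -/
def quotientAct (h : D.IsLocal I) (u : E) : Derivation ℝ (R ⧸ I) (R ⧸ I) :=
  have hmk : ∀ f, toQuotR I (D.act u (repR I (toQuotR I f))) = toQuotR I (D.act u f) := fun f ↦
    h.act_congr rfl (toQuotR_repR I _)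
  Derivation.mk'
    { toFun := fun f ↦ toQuotR I (D.act u (repR I f))
      map_add' := fun f g ↦ by
        obtain ⟨f, rfl⟩ := toQuotR_surjective I f
        obtain ⟨g, rfl⟩ := toQuotR_surjective I g
        rw [← map_add, hmk, hmk, hmk, map_add, map_add]
      map_smul' := fun c f ↦ by
        obtain ⟨f, rfl⟩ := toQuotR_surjective I f
        have h1 : c • toQuotR I f = toQuotR I (c • f) := rfl
        rw [h1, hmk, hmk, Derivation.map_smul]
        rfl }
    fun f g ↦ by
      obtain ⟨f, rfl⟩ := toQuotR_surjective I f
      obtain ⟨g, rfl⟩ := toQuotR_surjective I g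
      change toQuotR I (D.act u (repR I (toQuotR I f * toQuotR I g))) =
        toQuotR I f • toQuotR I (D.act u (repR I (toQuotR I g))) +
        toQuotR I g • toQuotR I (D.act u (repR I (toQuotR I f)))
      rw [← map_mul, hmk, hmk, hmk, Derivation.leibniz, map_add, smul_eq_mul, smul_eq_mul, map_mul,
        map_mul]
      rfl

lemma quotientAct_apply (h : D.IsLocal I) (u : E) (f : R) :
    quotientAct h u (toQuotR I f) = toQuotR I (D.act u f) :=
  h.act_congr rfl (toQuotR_repR I _)

/-- The scalar product of classes of sections. -/
def quotientPair (D : DorfmanAlgebra R E) (I : Ideal R) : (E ⧸ (I • ⊤ : Submodule R E)) →ₗ[R ⧸ I]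
    (E ⧸ (I • ⊤ : Submodule R E)) →ₗ[R ⧸ I] R ⧸ I :=
  have hpair : ∀ u v, toQuotR I (D.pair (repE I (toQuot I u)) (repE I (toQuot I v))) =
      toQuotR I (D.pair u v) := fun u v ↦ IsLocal.pair_congr (toQuot_repE I _) (toQuot_repE I _)
  LinearMap.mk₂ _ (fun u v ↦ toQuotR I (D.pair (repE I u) (repE I v)))
    (fun u u' v ↦ by
      obtain ⟨u, rfl⟩ := toQuot_surjective I u
      obtain ⟨u', rfl⟩ := toQuot_surjective I u'
      obtain ⟨v, rfl⟩ := toQuot_surjective I v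
      rw [← map_add, hpair, hpair, hpair, map_add, LinearMap.add_apply, map_add])
    (fun f u v ↦ by
      obtain ⟨f, rfl⟩ := toQuotR_surjective I f
      obtain ⟨u, rfl⟩ := toQuot_surjective I u
      obtain ⟨v, rfl⟩ := toQuot_surjective I v
      rw [← toQuot_smul, hpair, hpair, map_smul, LinearMap.smul_apply, smul_eq_mul, map_mul]
      rfl)
    (fun u v v' ↦ by
      obtain ⟨u, rfl⟩ := toQuot_surjective I u
      obtain ⟨v', rfl⟩ := toQuot_surjective I v'
      obtain ⟨v, rfl⟩ := toQuot_surjective I v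
      rw [← map_add, hpair, hpair, hpair, map_add, map_add])
    (fun f u v ↦ by
      obtain ⟨f, rfl⟩ := toQuotR_surjective I f
      obtain ⟨u, rfl⟩ := toQuot_surjective I u
      obtain ⟨v, rfl⟩ := toQuot_surjective I v
      rw [← toQuot_smul, hpair, hpair, map_smul, smul_eq_mul, map_mul]
      rfl)

lemma quotientPair_apply (u v : E) :
    quotientPair D I (toQuot I u) (toQuot I v) = toQuotR I (D.pair u v) :=
  IsLocal.pair_congr (toQuot_repE I _) (toQuot_repE I _)

/-- The action of classes of sections on classes of functions. -/
def quotientAnchor (h : D.IsLocal I) :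
    (E ⧸ (I • ⊤ : Submodule R E)) →ₗ[R ⧸ I] Derivation ℝ (R ⧸ I) (R ⧸ I) :=
  have hact : ∀ u f, quotientAct h (repE I (toQuot I u)) (toQuotR I f) =
      toQuotR I (D.act u f) := fun u f ↦ by
    rw [quotientAct_apply]
    exact h.act_congr (toQuot_repE I _) rfl
  { toFun := fun u ↦ quotientAct h (repE I u)
    map_add' := fun u v ↦ by
      obtain ⟨u, rfl⟩ := toQuot_surjective I u
      obtain ⟨v, rfl⟩ := toQuot_surjective I v
      ext f
      obtain ⟨f, rfl⟩ := toQuotR_surjective I f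
      rw [Derivation.add_apply, ← map_add, hact, hact, hact, map_add, Derivation.add_apply,
        map_add]
    map_smul' := fun g u ↦ by
      obtain ⟨g, rfl⟩ := toQuotR_surjective I g
      obtain ⟨u, rfl⟩ := toQuot_surjective I u
      ext f
      obtain ⟨f, rfl⟩ := toQuotR_surjective I f
      rw [RingHom.id_apply, Derivation.smul_apply, ← toQuot_smul, hact, hact, map_smul,
        Derivation.smul_apply, smul_eq_mul, map_mul]
      rfl }

lemma quotientAnchor_apply (h : D.IsLocal I) (u : E) (f : R) :
    quotientAnchor h (toQuot I u) (toQuotR I f) = toQuotR I (D.act u f) :=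
  (quotientAct_apply h _ _).trans (h.act_congr (toQuot_repE I _) rfl)

variable [IsScalarTower ℝ R E]

/-- The Dorfman bracket of classes of sections. -/
def quotientBr (h : D.IsLocal I) : (E ⧸ (I • ⊤ : Submodule R E)) →ₗ[ℝ]
    (E ⧸ (I • ⊤ : Submodule R E)) →ₗ[ℝ] (E ⧸ (I • ⊤ : Submodule R E)) :=
  have hbr : ∀ u v, toQuot I (D.br (repE I (toQuot I u)) (repE I (toQuot I v))) =
      toQuot I (D.br u v) := fun u v ↦ h.br_congr (toQuot_repE I _) (toQuot_repE I _)
  LinearMap.mk₂ _ (fun u v ↦ toQuot I (D.br (repE I u) (repE I v)))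
      (fun u u' v ↦ by
        obtain ⟨u, rfl⟩ := toQuot_surjective I u
        obtain ⟨u', rfl⟩ := toQuot_surjective I u'
        obtain ⟨v, rfl⟩ := toQuot_surjective I v
        rw [← map_add, hbr, hbr, hbr, map_add, LinearMap.add_apply, map_add])
      (fun c u v ↦ by
        obtain ⟨u, rfl⟩ := toQuot_surjective I u
        obtain ⟨v, rfl⟩ := toQuot_surjective I v
        rw [← toQuot_smul_real, hbr, hbr, map_smul, LinearMap.smul_apply, toQuot_smul_real])
      (fun u v v' ↦ by
        obtain ⟨u, rfl⟩ := toQuot_surjective I u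
        obtain ⟨v', rfl⟩ := toQuot_surjective I v'
        obtain ⟨v, rfl⟩ := toQuot_surjective I v
        rw [← map_add, hbr, hbr, hbr, map_add, map_add])
      (fun c u v ↦ by
        obtain ⟨u, rfl⟩ := toQuot_surjective I u
        obtain ⟨v, rfl⟩ := toQuot_surjective I v
        rw [← toQuot_smul_real, hbr, hbr, map_smul, toQuot_smul_real])

lemma quotientBr_apply (h : D.IsLocal I) (u v : E) :
    quotientBr h (toQuot I u) (toQuot I v) = toQuot I (D.br u v) :=
  h.br_congr (toQuot_repE I _) (toQuot_repE I _)

/-- The Dorfman algebra of classes of sections modulo a compatible ideal of functions. -/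
def quotient (D : DorfmanAlgebra R E) (h : D.IsLocal I) :
    DorfmanAlgebra (R ⧸ I) (E ⧸ (I • ⊤ : Submodule R E)) where
  pair := quotientPair D I
  act := quotientAnchor h
  br := quotientBr h
  pair_symm u v := by
    obtain ⟨u, rfl⟩ := toQuot_surjective I u
    obtain ⟨v, rfl⟩ := toQuot_surjective I v
    rw [quotientPair_apply, quotientPair_apply, D.pair_symm]
  eq_zero_of_pair u hu := by
    obtain ⟨u, rfl⟩ := toQuot_surjective I u
    refine (Submodule.Quotient.mk_eq_zero _).2 (h.mem_of_pair u fun v ↦ ?_)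
    rw [← Ideal.Quotient.eq_zero_iff_mem]
    exact (quotientPair_apply u v).symm.trans (hu (toQuot I v))
  jacobi u v w := by
    obtain ⟨u, rfl⟩ := toQuot_surjective I u
    obtain ⟨v, rfl⟩ := toQuot_surjective I v
    obtain ⟨w, rfl⟩ := toQuot_surjective I w
    simp only [quotientBr_apply, ← map_add, D.jacobi u v w]
  act_pair u v w := by
    obtain ⟨u, rfl⟩ := toQuot_surjective I u
    obtain ⟨v, rfl⟩ := toQuot_surjective I v
    obtain ⟨w, rfl⟩ := toQuot_surjective I w
    simp only [quotientBr_apply, quotientPair_apply, quotientAnchor_apply, ← map_add,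
      D.act_pair u v w]
  br_symm u v w := by
    obtain ⟨u, rfl⟩ := toQuot_surjective I u
    obtain ⟨v, rfl⟩ := toQuot_surjective I v
    obtain ⟨w, rfl⟩ := toQuot_surjective I w
    simp only [quotientBr_apply, quotientPair_apply, quotientAnchor_apply, ← map_add,
      D.br_symm u v w]

lemma quotient_pair (h : D.IsLocal I) (u v : E) :
    (D.quotient h).pair (toQuot I u) (toQuot I v) = toQuotR I (D.pair u v) :=
  quotientPair_apply u v

lemma quotient_act (h : D.IsLocal I) (u : E) (f : R) :
    (D.quotient h).act (toQuot I u) (toQuotR I f) = toQuotR I (D.act u f) :=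
  quotientAnchor_apply h u f

lemma quotient_br (h : D.IsLocal I) (u v : E) :
    (D.quotient h).br (toQuot I u) (toQuot I v) = toQuot I (D.br u v) :=
  quotientBr_apply h u v

end DorfmanAlgebra

/-! ### Germs of smooth functions and of smooth sections -/

section SmoothSections

variable {m : ℕ} {M : Type*} [TopologicalSpace M]
  [ChartedSpace (EuclideanSpace ℝ (Fin m)) M]
  {F : Type*} [NormedAddCommGroup F] [NormedSpace ℝ F]
  {V : M → Type*} [TopologicalSpace (TotalSpace F V)]
  [∀ x, TopologicalSpace (V x)] [∀ x, AddCommGroup (V x)] [∀ x, Module ℝ (V x)]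
  [FiberBundle F V] [VectorBundle ℝ F V]

/-- Smooth sections are a module over the smooth functions. -/
instance ContMDiffSection.moduleSmoothFunctions :
    Module C^∞⟮𝓡 m, M; 𝓘(ℝ, ℝ), ℝ⟯ Cₛ^∞⟮𝓡 m; F, V⟯ where
  smul f s := ⟨fun x ↦ f x • s x, fun x ↦ (f.contMDiff x).smul_section (s.contMDiff x)⟩
  one_smul s := ContMDiffSection.ext fun x ↦ one_smul ℝ (s x)
  mul_smul f g s := ContMDiffSection.ext fun x ↦ mul_smul (f x) (g x) (s x)
  smul_zero f := ContMDiffSection.ext fun x ↦ smul_zero (f x)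
  smul_add f s t := ContMDiffSection.ext fun x ↦ smul_add (f x) (s x) (t x)
  add_smul f g s := ContMDiffSection.ext fun x ↦ add_smul (f x) (g x) (s x)
  zero_smul s := ContMDiffSection.ext fun x ↦ zero_smul ℝ (s x)

lemma ContMDiffSection.smooth_smul_apply (f : C^∞⟮𝓡 m, M; 𝓘(ℝ, ℝ), ℝ⟯) (s : Cₛ^∞⟮𝓡 m; F, V⟯)
    (x : M) : (f • s) x = f x • s x := rfl

lemma ContMDiffSection.sum_apply {ι : Type*} (t : Finset ι) (s : ι → Cₛ^∞⟮𝓡 m; F, V⟯) (x : M) :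
    (∑ i ∈ t, s i) x = ∑ i ∈ t, s i x := by
  have h := map_sum (ContMDiffSection.coeAddHom (𝓡 m) F ∞ V) s t
  exact (congrFun h x).trans (Finset.sum_apply x t _)

lemma ContMDiffMap.sum_apply {ι : Type*} (t : Finset ι) (f : ι → C^∞⟮𝓡 m, M; 𝓘(ℝ, ℝ), ℝ⟯) (x : M) :
    (∑ i ∈ t, f i) x = ∑ i ∈ t, f i x :=
  map_sum (ContMDiffMap.evalRingHom (n := ∞) (I := 𝓡 m) (I' := 𝓘(ℝ, ℝ)) (R := ℝ) x) f t

instance ContMDiffSection.isScalarTower_smoothFunctions :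
    IsScalarTower ℝ C^∞⟮𝓡 m, M; 𝓘(ℝ, ℝ), ℝ⟯ Cₛ^∞⟮𝓡 m; F, V⟯ where
  smul_assoc c f s := ContMDiffSection.ext fun x ↦ smul_assoc c (f x) (s x)

section Germs

/-- The ideal of the smooth functions which vanish near `p`. -/
def germIdeal (m : ℕ) {M : Type*} [TopologicalSpace M]
    [ChartedSpace (EuclideanSpace ℝ (Fin m)) M] (p : M) :
    Ideal C^∞⟮𝓡 m, M; 𝓘(ℝ, ℝ), ℝ⟯ where
  carrier := {f | ∀ᶠ x in 𝓝 p, f x = 0}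
  add_mem' {f g} hf hg := by
    filter_upwards [hf, hg] with x h1 h2
    exact (congrArg₂ (· + ·) h1 h2).trans (add_zero 0)
  zero_mem' := Eventually.of_forall fun x ↦ rfl
  smul_mem' f g hg := by
    filter_upwards [hg] with x h1
    exact (congrArg (f x * ·) h1).trans (mul_zero _)

lemma mem_germIdeal {p : M} {f : C^∞⟮𝓡 m, M; 𝓘(ℝ, ℝ), ℝ⟯} :
    f ∈ germIdeal m p ↔ ∀ᶠ x in 𝓝 p, f x = 0 := Iff.rfl

/-- The sections with coefficients in the ideal of functions which vanish near `p` are the sections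
which vanish near `p`. -/
lemma mem_germIdeal_smul_top [IsManifold (𝓡 m) ∞ M] [T2Space M] {p : M} {s : Cₛ^∞⟮𝓡 m; F, V⟯} :
    s ∈ (germIdeal m p • ⊤ : Submodule C^∞⟮𝓡 m, M; 𝓘(ℝ, ℝ), ℝ⟯ Cₛ^∞⟮𝓡 m; F, V⟯) ↔
      ∀ᶠ x in 𝓝 p, s x = 0 := by
  constructor
  · intro hs
    refine Submodule.smul_induction_on hs (fun f hf t _ ↦ ?_) fun t t' ht ht' ↦ ?_
    · filter_upwards [mem_germIdeal.1 hf] with x hx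
      rw [ContMDiffSection.smooth_smul_apply, hx, zero_smul]
    · filter_upwards [ht, ht'] with x h1 h2
      rw [ContMDiffSection.coe_add, Pi.add_apply, h1, h2, add_zero]
  · intro hs
    -- `s = (1 - χ) s` for a bump function `χ` supported where `s` vanishes.
    obtain ⟨χ, -, hχ⟩ := (SmoothBumpFunction.nhds_basis_support (I := 𝓡 m) hs).mem_iff.1 hs
    set f : C^∞⟮𝓡 m, M; 𝓘(ℝ, ℝ), ℝ⟯ := 1 - ⟨χ, χ.contMDiff⟩ with hf
    have hfa : ∀ x, f x = 1 - χ x := fun x ↦ rfl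
    have h1 : s = f • s := ContMDiffSection.ext fun x ↦ by
      rw [ContMDiffSection.smooth_smul_apply, hfa]
      by_cases hx : χ x = 0
      · simp [hx]
      · have h2 : s x = 0 := hχ hx
        simp [h2]
    rw [h1]
    refine Submodule.smul_mem_smul ?_ trivial
    filter_upwards [χ.eventuallyEq_one] with x hx
    rw [hfa, hx]
    simp

lemma toQuotR_eq_iff_eventually {p : M} {f g : C^∞⟮𝓡 m, M; 𝓘(ℝ, ℝ), ℝ⟯} :
    DorfmanAlgebra.toQuotR (germIdeal m p) f = DorfmanAlgebra.toQuotR (germIdeal m p) g ↔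
      ∀ᶠ x in 𝓝 p, f x = g x := by
  rw [DorfmanAlgebra.toQuotR_eq_iff, mem_germIdeal]
  exact eventually_congr (Eventually.of_forall fun x ↦ sub_eq_zero)

lemma toQuot_eq_iff_eventually [IsManifold (𝓡 m) ∞ M] [T2Space M] {p : M} {s t : Cₛ^∞⟮𝓡 m; F, V⟯} :
    DorfmanAlgebra.toQuot (germIdeal m p) s = DorfmanAlgebra.toQuot (germIdeal m p) t ↔
      ∀ᶠ x in 𝓝 p, s x = t x := by
  rw [DorfmanAlgebra.toQuot_eq_iff, mem_germIdeal_smul_top]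
  exact eventually_congr (Eventually.of_forall fun x ↦ sub_eq_zero)

lemma mvfderiv_congr {G : Type*} [NormedAddCommGroup G] [NormedSpace ℝ G] {f g : M → G} {x : M}
    (h : f =ᶠ[𝓝 x] g) (v : TangentSpace (𝓡 m) x) :
    mvfderiv (𝓡 m) f x v = mvfderiv (𝓡 m) g x v := by
  have h1 := h.mfderiv_eq (I := 𝓡 m) (I' := 𝓘(ℝ, G))
  exact DFunLike.congr_fun h1 v

end Germs

section Frames

variable [IsManifold (𝓡 m) ∞ M] [T2Space M] [ContMDiffVectorBundle ∞ F V (𝓡 m)]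

lemma exists_contMDiffSection_eq {p : M} (v : V p) : ∃ s : Cₛ^∞⟮𝓡 m; F, V⟯, s p = v := by
  obtain ⟨W, hW, h⟩ := FiberBundle.exists_contMDiffOn_extend (k := ∞) (𝓡 m) F v
  obtain ⟨s, hs⟩ := exists_contMDiffSection_eventuallyEq (V := V) (F := F)
    (s := FiberBundle.extend F v) (p := p) (by
      filter_upwards [eventually_mem_nhds_iff.2 hW] with x hx
      exact h.contMDiffAt hx)
  exact ⟨s, by simpa using hs.self_of_nhds⟩

/-- Near every point there is a smooth frame consisting of global sections. -/
lemma exists_frame [FiniteDimensional ℝ F] (p : M) :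
    ∃ φ : Fin (Module.finrank ℝ F) → Cₛ^∞⟮𝓡 m; F, V⟯,
      (∀ᶠ x in 𝓝 p, LinearIndependent ℝ (fun a ↦ φ a x)) ∧
      (∀ᶠ x in 𝓝 p, ∀ v : V x, ∃ c : Fin (Module.finrank ℝ F) → ℝ, v = ∑ a, c a • φ a x) ∧
      ∀ s : Cₛ^∞⟮𝓡 m; F, V⟯, ∃ c : Fin (Module.finrank ℝ F) → C^∞⟮𝓡 m, M; 𝓘(ℝ, ℝ), ℝ⟯,
        ∀ᶠ x in 𝓝 p, s x = ∑ a, c a x • φ a x := by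
  have : ContMDiffVectorBundle 1 F V (𝓡 m) := .of_le (n := ∞) ENat.LEInfty.out
  set e := trivializationAt F V p with he
  set b := Module.finBasis ℝ F with hb
  have hp : p ∈ e.baseSet := FiberBundle.mem_baseSet_trivializationAt' p
  have hev : ∀ᶠ x in 𝓝 p, x ∈ e.baseSet := e.open_baseSet.mem_nhds hp
  have hfr := e.isLocalFrameOn_localFrame_baseSet (𝓡 m) ∞ b
  choose φ hφ using fun a ↦ exists_contMDiffSection_eventuallyEq (V := V) (F := F) (p := p)
    (s := e.localFrame b a) (hev.mono fun x hx ↦ hfr.contMDiffAt e.open_baseSet hx a)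
  have hφ' : ∀ᶠ x in 𝓝 p, ∀ a, φ a x = e.localFrame b a x := eventually_all.2 hφ
  refine ⟨φ, ?_, ?_, fun s ↦ ?_⟩
  · filter_upwards [hφ', hev] with x h1 hx
    simpa only [h1] using hfr.linearIndependent hx
  · filter_upwards [hφ', hev] with x h1 hx v
    refine ⟨(hfr.toBasisAt hx).repr v, ?_⟩
    conv_lhs => rw [← (hfr.toBasisAt hx).sum_repr v]
    simp [h1, IsLocalFrameOn.toBasisAt_coe]
  · choose c hc using fun a ↦ exists_contMDiff_eventuallyEq (p := p)
      (f := fun x ↦ e.localFrameCoeff (𝓡 m) b a x (s x))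
      (hev.mono fun x hx ↦ contMDiffAt_localFrameCoeff b hx (s.contMDiff x) a)
    refine ⟨fun a ↦ ⟨c a, (hc a).1⟩, ?_⟩
    filter_upwards [hφ', hev, eventually_all.2 fun a ↦ (hc a).2] with x h1 hx h2
    rw [e.eq_sum_localFrameCoeff_smul (I := 𝓡 m) (b := b) (s := s) hx]
    exact Finset.sum_congr rfl fun a _ ↦ by rw [h1 a]; exact congrArg (· • _) (h2 a).symm

end Frames

end SmoothSections

namespace CourantAlgebroid

variable {m : ℕ} {M : Type*} [TopologicalSpace M]
  [ChartedSpace (EuclideanSpace ℝ (Fin m)) M] [IsManifold (𝓡 m) ∞ M]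
  {F : Type*} [NormedAddCommGroup F] [NormedSpace ℝ F]
  {V : M → Type*} [TopologicalSpace (TotalSpace F V)]
  [∀ x, TopologicalSpace (V x)] [∀ x, AddCommGroup (V x)] [∀ x, Module ℝ (V x)]
  [FiberBundle F V] [VectorBundle ℝ F V]
  (C : CourantAlgebroid m F V)

/-- The derivation of the algebra of smooth functions given by the anchor of a section. -/
def anchorDerivation (u : Cₛ^∞⟮𝓡 m; F, V⟯) :
    Derivation ℝ C^∞⟮𝓡 m, M; 𝓘(ℝ, ℝ), ℝ⟯ C^∞⟮𝓡 m, M; 𝓘(ℝ, ℝ), ℝ⟯ :=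
  Derivation.mk'
    { toFun := fun f ↦ ⟨fun x ↦ mvfderiv (𝓡 m) f x (C.anchor x (u x)), fun x ↦
        contMDiffAt_mvfderiv_apply (f.contMDiff x) (C.anchor_smooth u x)⟩
      map_add' := fun f g ↦ ContMDiffMap.ext fun x ↦ DFunLike.congr_fun (mvfderiv_add
        ((f.contMDiff x).mdifferentiableAt (by simp))
        ((g.contMDiff x).mdifferentiableAt (by simp))) _
      map_smul' := fun c f ↦ ContMDiffMap.ext fun x ↦ by
        have h := DFunLike.congr_fun (mvfderiv_smul (I := 𝓡 m) (x := x) (a := fun _ ↦ c) (g := f)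
          mdifferentiableAt_const ((f.contMDiff x).mdifferentiableAt (by simp))) (C.anchor x (u x))
        rw [mvfderiv_const] at h
        refine h.trans ?_
        rw [add_apply, smul_apply, ContinuousLinearMap.smulRight_apply, zero_apply, zero_smul,
          add_zero]
        rfl }
    fun f g ↦ ContMDiffMap.ext fun x ↦ DFunLike.congr_fun (mvfderiv_mul
        ((f.contMDiff x).mdifferentiableAt (by simp))
        ((g.contMDiff x).mdifferentiableAt (by simp))) (C.anchor x (u x))

variable [T2Space M] [ContMDiffVectorBundle ∞ F V (𝓡 m)]

/-- The Dorfman algebra of the global sections of a Courant algebroid. -/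
def dorfmanAlgebra : DorfmanAlgebra C^∞⟮𝓡 m, M; 𝓘(ℝ, ℝ), ℝ⟯ Cₛ^∞⟮𝓡 m; F, V⟯ where
  pair := LinearMap.mk₂ _ (fun u v ↦ ⟨fun x ↦ C.pairing x (u x) (v x), C.pairing_smooth u v⟩)
    (fun u u' v ↦ ContMDiffMap.ext fun x ↦ LinearMap.map_add₂ (C.pairing x) (u x) (u' x) (v x))
    (fun f u v ↦ ContMDiffMap.ext fun x ↦ LinearMap.map_smul₂ (C.pairing x) (f x) (u x) (v x))
    (fun u v v' ↦ ContMDiffMap.ext fun x ↦ map_add (C.pairing x (u x)) (v x) (v' x))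
    (fun f u v ↦ ContMDiffMap.ext fun x ↦ map_smul (C.pairing x (u x)) (f x) (v x))
  act :=
    { toFun := C.anchorDerivation
      map_add' := fun u v ↦ Derivation.ext fun f ↦ ContMDiffMap.ext fun x ↦ by
        have h := map_add (mvfderiv (𝓡 m) f x) (C.anchor x (u x)) (C.anchor x (v x))
        rw [← map_add] at h
        exact h
      map_smul' := fun g u ↦ Derivation.ext fun f ↦ ContMDiffMap.ext fun x ↦ by
        have h := map_smul (mvfderiv (𝓡 m) f x) (g x) (C.anchor x (u x))
        rw [← map_smul] at h
        exact h }
  br := C.bracket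
  pair_symm u v := ContMDiffMap.ext fun x ↦ C.pairing_symm x (u x) (v x)
  eq_zero_of_pair u hu := ContMDiffSection.ext fun x ↦ C.pairing_nondegenerate x _ fun b ↦ by
    obtain ⟨v, rfl⟩ := exists_contMDiffSection_eq (m := m) (F := F) b
    exact congrArg (fun f ↦ f x) (hu v)
  jacobi := C.bracket_jacobi
  act_pair u v w := ContMDiffMap.ext fun x ↦ C.bracket_pairing u v w x
  br_symm u v w := ContMDiffMap.ext fun x ↦ C.bracket_symm u v w x

lemma dorfmanAlgebra_pair_apply (u v : Cₛ^∞⟮𝓡 m; F, V⟯) (x : M) :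
    C.dorfmanAlgebra.pair u v x = C.pairing x (u x) (v x) := rfl

lemma dorfmanAlgebra_act_apply (u : Cₛ^∞⟮𝓡 m; F, V⟯) (f : C^∞⟮𝓡 m, M; 𝓘(ℝ, ℝ), ℝ⟯) (x : M) :
    C.dorfmanAlgebra.act u f x = mvfderiv (𝓡 m) f x (C.anchor x (u x)) := rfl

/-- The operations of a Courant algebroid are local. -/
lemma isLocal_germIdeal [FiniteDimensional ℝ F] (p : M) :
    C.dorfmanAlgebra.IsLocal (germIdeal m p) where
  act_mem u f hf := by
    refine mem_germIdeal.2 ?_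
    filter_upwards [eventually_eventually_nhds.2 (mem_germIdeal.1 hf)] with x hx
    rw [dorfmanAlgebra_act_apply, mvfderiv_congr (g := fun _ ↦ (0 : ℝ)) hx, mvfderiv_const]
    rfl
  mem_of_pair u hu := by
    obtain ⟨φ, -, hφ, -⟩ := exists_frame (m := m) (F := F) (V := V) p
    refine mem_germIdeal_smul_top.2 ?_
    filter_upwards [hφ, eventually_all.2 fun a ↦ mem_germIdeal.1 (hu (φ a))] with x hx h1
    refine C.pairing_nondegenerate x _ fun b ↦ ?_
    obtain ⟨c, rfl⟩ := hx b
    rw [map_sum]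
    refine Finset.sum_eq_zero fun a _ ↦ ?_
    rw [map_smul]
    exact (congrArg (c a • ·) (h1 a)).trans (smul_zero _)

end CourantAlgebroid

/-! ### The straightening hypotheses for germs -/

section Germs

variable {m : ℕ} {M : Type*} [TopologicalSpace M]
  [ChartedSpace (EuclideanSpace ℝ (Fin m)) M]

/-- The value at `p` of a germ of smooth functions. -/
def germEval (m : ℕ) {M : Type*} [TopologicalSpace M] [ChartedSpace (EuclideanSpace ℝ (Fin m)) M]
    (p : M) : C^∞⟮𝓡 m, M; 𝓘(ℝ, ℝ), ℝ⟯ ⧸ germIdeal m p →ₐ[ℝ] ℝ :=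
  Ideal.Quotient.liftₐ (germIdeal m p)
    { ContMDiffMap.evalRingHom (n := ∞) (I := 𝓡 m) (I' := 𝓘(ℝ, ℝ)) (R := ℝ) p with
      commutes' := fun _ ↦ rfl }
    fun _ hf ↦ (mem_germIdeal.1 hf).self_of_nhds

lemma germEval_apply (p : M) (f : C^∞⟮𝓡 m, M; 𝓘(ℝ, ℝ), ℝ⟯) :
    germEval m p (DorfmanAlgebra.toQuotR (germIdeal m p) f) = f p := rfl

/-- The ideal of the functions which vanish on a coordinate hyperplane, near `p`. -/
def sliceIdeal {m : ℕ} {M : Type*} [TopologicalSpace M]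
    [ChartedSpace (EuclideanSpace ℝ (Fin m)) M] (p : M) (j : Fin m) :
    Ideal C^∞⟮𝓡 m, M; 𝓘(ℝ, ℝ), ℝ⟯ where
  carrier := {f | ∀ᶠ x in 𝓝 p, x ∈ coordSlice p j → f x = 0}
  add_mem' {f g} hf hg := by
    filter_upwards [hf, hg] with x h1 h2 hx
    exact (congrArg₂ (· + ·) (h1 hx) (h2 hx)).trans (add_zero 0)
  zero_mem' := Eventually.of_forall fun x _ ↦ rfl
  smul_mem' f g hg := by
    filter_upwards [hg] with x h1 hx
    exact (congrArg (f x * ·) (h1 hx)).trans (mul_zero _)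

lemma toQuotR_mem_map_sliceIdeal {p : M} {j : Fin m} {f : C^∞⟮𝓡 m, M; 𝓘(ℝ, ℝ), ℝ⟯} :
    DorfmanAlgebra.toQuotR (germIdeal m p) f ∈
      (sliceIdeal p j).map (DorfmanAlgebra.toQuotR (germIdeal m p)) ↔
      ∀ᶠ x in 𝓝 p, x ∈ coordSlice p j → f x = 0 :=
  Ideal.mem_quotient_iff_mem (J := sliceIdeal p j) fun f hf ↦
    show ∀ᶠ x in 𝓝 p, x ∈ coordSlice p j → f x = 0 from
      (mem_germIdeal.1 hf).mono fun _ hx _ ↦ hx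

lemma toQuotR_eq_zero_iff {p : M} {f : C^∞⟮𝓡 m, M; 𝓘(ℝ, ℝ), ℝ⟯} :
    DorfmanAlgebra.toQuotR (germIdeal m p) f = 0 ↔ ∀ᶠ x in 𝓝 p, f x = 0 :=
  toQuotR_eq_iff_eventually (g := 0)

lemma isUnit_toQuotR [IsManifold (𝓡 m) ∞ M] [T2Space M] {p : M} {f : C^∞⟮𝓡 m, M; 𝓘(ℝ, ℝ), ℝ⟯}
    (hf : f p ≠ 0) : IsUnit (DorfmanAlgebra.toQuotR (germIdeal m p) f) := by
  have h1 : ∀ᶠ x in 𝓝 p, f x ≠ 0 := (f.contMDiff p).continuousAt.eventually_ne hf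
  obtain ⟨g, hg, hgf⟩ := exists_contMDiff_eventuallyEq (m := m) (p := p) (f := fun x ↦ (f x)⁻¹)
    (h1.mono fun x hx ↦ (f.contMDiff x).inv₀ hx)
  set g' : C^∞⟮𝓡 m, M; 𝓘(ℝ, ℝ), ℝ⟯ := ⟨g, hg⟩
  refine IsUnit.of_mul_eq_one (DorfmanAlgebra.toQuotR (germIdeal m p) g') ?_
  rw [← map_mul, ← map_one (DorfmanAlgebra.toQuotR (germIdeal m p)), toQuotR_eq_iff_eventually]
  filter_upwards [h1, hgf] with x hx hx'
  exact (congrArg (f x * ·) hx').trans (mul_inv_cancel₀ hx)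

/-- Smooth extensions of the coordinate functions. -/
lemma exists_coord_extension [IsManifold (𝓡 m) ∞ M] [T2Space M] (p : M) :
    ∃ X : Fin m → C^∞⟮𝓡 m, M; 𝓘(ℝ, ℝ), ℝ⟯, ∀ j, X j =ᶠ[𝓝 p] chartCoord p j := by
  choose X hX hX' using fun j : Fin m ↦ exists_contMDiff_eventuallyEq (p := p) (f := chartCoord p j)
    ((eventually_mem_chart_source (m := m) p).mono fun x hx ↦ contMDiffAt_chartCoord hx j)
  exact ⟨fun j ↦ ⟨X j, hX j⟩, hX'⟩

lemma toQuotR_one_apply {p : M} {n : Type*} [DecidableEq n] (i j : n) :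
    (1 : Matrix n n (C^∞⟮𝓡 m, M; 𝓘(ℝ, ℝ), ℝ⟯ ⧸ germIdeal m p)) i j =
      DorfmanAlgebra.toQuotR (germIdeal m p)
        ((1 : Matrix n n C^∞⟮𝓡 m, M; 𝓘(ℝ, ℝ), ℝ⟯) i j) := by
  rw [Matrix.one_apply, Matrix.one_apply]
  split_ifs <;> simp

lemma one_smooth_apply {n : Type*} [DecidableEq n] (i j : n) (x : M) :
    (1 : Matrix n n C^∞⟮𝓡 m, M; 𝓘(ℝ, ℝ), ℝ⟯) i j x = (1 : Matrix n n ℝ) i j := by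
  rw [Matrix.one_apply, Matrix.one_apply]
  split_ifs <;> rfl

end Germs

namespace CourantAlgebroid

variable {m : ℕ} {M : Type*} [TopologicalSpace M] [T2Space M]
  [ChartedSpace (EuclideanSpace ℝ (Fin m)) M] [IsManifold (𝓡 m) ∞ M]
  {F : Type*} [NormedAddCommGroup F] [NormedSpace ℝ F] [FiniteDimensional ℝ F]
  {V : M → Type*} [TopologicalSpace (TotalSpace F V)]
  [∀ x, TopologicalSpace (V x)] [∀ x, AddCommGroup (V x)] [∀ x, Module ℝ (V x)]
  [FiberBundle F V] [VectorBundle ℝ F V] [ContMDiffVectorBundle ∞ F V (𝓡 m)]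
  (C : CourantAlgebroid m F V)

/-- The Dorfman algebra of the germs at `p` of sections of a Courant algebroid. -/
abbrev germAlgebra (p : M) := C.dorfmanAlgebra.quotient (C.isLocal_germIdeal p)

variable {C}

/-- The germs of sections are a free module over the germs of functions. -/
lemma exists_basis_germs (p : M) : Nonempty (Module.Basis (Fin (Module.finrank ℝ F))
    (C^∞⟮𝓡 m, M; 𝓘(ℝ, ℝ), ℝ⟯ ⧸ germIdeal m p) (Cₛ^∞⟮𝓡 m; F, V⟯ ⧸
    (germIdeal m p • ⊤ : Submodule C^∞⟮𝓡 m, M; 𝓘(ℝ, ℝ), ℝ⟯ Cₛ^∞⟮𝓡 m; F, V⟯))) := by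
  obtain ⟨φ, hφ, -, hφs⟩ := exists_frame (m := m) (F := F) (V := V) p
  refine ⟨Module.Basis.mk (v := fun a ↦ DorfmanAlgebra.toQuot (germIdeal m p) (φ a)) ?_ ?_⟩
  · refine Fintype.linearIndependent_iff.2 fun g hg ↦ ?_
    choose f hf using fun a ↦ DorfmanAlgebra.toQuotR_surjective (germIdeal m p) (g a)
    simp only [← hf, ← DorfmanAlgebra.toQuot_smul, ← map_sum] at hg ⊢
    rw [← map_zero (DorfmanAlgebra.toQuot (germIdeal m p)), toQuot_eq_iff_eventually] at hg
    have h1 : ∀ᶠ x in 𝓝 p, ∀ a, f a x = 0 := by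
      filter_upwards [hφ, hg] with x h1 h2
      refine Fintype.linearIndependent_iff.1 h1 (fun a ↦ f a x) ?_
      rw [ContMDiffSection.sum_apply] at h2
      exact h2
    exact fun a ↦ toQuotR_eq_zero_iff.2 (h1.mono fun x hx ↦ hx a)
  · rintro s -
    obtain ⟨s, rfl⟩ := DorfmanAlgebra.toQuot_surjective _ s
    obtain ⟨c, hc⟩ := hφs s
    have h1 : DorfmanAlgebra.toQuot (germIdeal m p) s =
        DorfmanAlgebra.toQuot (germIdeal m p) (∑ a, c a • φ a) := by
      rw [toQuot_eq_iff_eventually]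
      filter_upwards [hc] with x hx
      rw [hx, ContMDiffSection.sum_apply]
      rfl
    rw [h1, map_sum]
    refine Submodule.sum_mem _ fun a _ ↦ ?_
    rw [DorfmanAlgebra.toQuot_smul]
    exact Submodule.smul_mem _ _ (Submodule.subset_span (mem_range_self a))

lemma germAlgebra_act {p : M} (u : Cₛ^∞⟮𝓡 m; F, V⟯) (f : C^∞⟮𝓡 m, M; 𝓘(ℝ, ℝ), ℝ⟯) :
    (C.germAlgebra p).act (DorfmanAlgebra.toQuot _ u) (DorfmanAlgebra.toQuotR _ f) =
      DorfmanAlgebra.toQuotR _ (C.dorfmanAlgebra.act u f) :=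
  DorfmanAlgebra.quotient_act _ u f

lemma germAlgebra_act_eq_zero_iff {p : M} (u : Cₛ^∞⟮𝓡 m; F, V⟯) (f : C^∞⟮𝓡 m, M; 𝓘(ℝ, ℝ), ℝ⟯) :
    (C.germAlgebra p).act (DorfmanAlgebra.toQuot _ u) (DorfmanAlgebra.toQuotR _ f) = 0 ↔
      ∀ᶠ x in 𝓝 p, mvfderiv (𝓡 m) f x (C.anchor x (u x)) = 0 := by
  rw [germAlgebra_act, toQuotR_eq_zero_iff]
  rfl

section

variable {p : M} {X : Fin m → C^∞⟮𝓡 m, M; 𝓘(ℝ, ℝ), ℝ⟯} (hX : ∀ j, X j =ᶠ[𝓝 p] chartCoord p j)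
include hX

omit [IsManifold (𝓡 m) ∞ M] [T2Space M] in
lemma eventually_mvfderiv_coord : ∀ᶠ x in 𝓝 p, ∀ (j : Fin m) (v : TangentSpace (𝓡 m) x),
    mvfderiv (𝓡 m) (X j) x v = mvfderiv (𝓡 m) (chartCoord p j) x v := by
  refine eventually_all.2 fun j ↦ ?_
  filter_upwards [(hX j).eventuallyEq_nhds] with x hx v
  exact mvfderiv_congr hx v

/-- If a section acts on the germs of the coordinates like the `j`-th partial derivative, then its
anchor is the `j`-th coordinate vector field near `p`. -/
lemma eventually_anchor_eq {u : Cₛ^∞⟮𝓡 m; F, V⟯} {j : Fin m}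
    (hu : ∀ i, (C.germAlgebra p).act (DorfmanAlgebra.toQuot _ u) (DorfmanAlgebra.toQuotR _ (X i)) =
      (1 : Matrix (Fin m) (Fin m) (C^∞⟮𝓡 m, M; 𝓘(ℝ, ℝ), ℝ⟯ ⧸ germIdeal m p)) j i) :
    ∀ᶠ x in 𝓝 p, mvfderiv (𝓡 m) (extChartAt (𝓡 m) p) x (C.anchor x (u x)) =
      EuclideanSpace.single j 1 := by
  simp only [germAlgebra_act, toQuotR_one_apply, toQuotR_eq_iff_eventually] at hu
  filter_upwards [eventually_all.2 hu, eventually_mem_chart_source (m := m) p,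
    eventually_mvfderiv_coord hX] with x h1 h2 h3
  ext i
  rw [← mvfderiv_chartCoord h2, ← h3 i]
  refine (h1 i).trans ?_
  rw [one_smooth_apply, Matrix.one_apply]
  simp [eq_comm]

end

end CourantAlgebroid

section MatrixODE

variable {m : ℕ} {M : Type*} [TopologicalSpace M]
  [ChartedSpace (EuclideanSpace ℝ (Fin m)) M] [IsManifold (𝓡 m) ∞ M]

omit [IsManifold (𝓡 m) ∞ M] in
lemma mvfderiv_clm_comp {G H : Type*} [NormedAddCommGroup G] [NormedSpace ℝ G]
    [NormedAddCommGroup H] [NormedSpace ℝ H] (L : G →L[ℝ] H) {f : M → G} {x : M}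
    (hf : MDifferentiableAt (𝓡 m) 𝓘(ℝ, G) f x) (v : TangentSpace (𝓡 m) x) :
    mvfderiv (𝓡 m) (fun x ↦ L (f x)) x v = L (mvfderiv (𝓡 m) f x v) := by
  have h := mfderiv_comp (I' := 𝓘(ℝ, G)) (I'' := 𝓘(ℝ, H)) x
    (L.differentiableAt.mdifferentiableAt) hf
  rw [ContinuousLinearMap.mfderiv_eq] at h
  exact DFunLike.congr_fun h v

/-- The solution of a linear differential equation along a coordinate vector field, in terms of
matrices. -/
lemma exists_contMDiff_solution_matrix [T2Space M] {p : M} {n : ℕ}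
    (A : Matrix (Fin n) (Fin n) C^∞⟮𝓡 m, M; 𝓘(ℝ, ℝ), ℝ⟯) (j : Fin m) :
    ∃ g : Matrix (Fin n) (Fin n) C^∞⟮𝓡 m, M; 𝓘(ℝ, ℝ), ℝ⟯,
      (∀ᶠ x in 𝓝 p, ∀ v : TangentSpace (𝓡 m) x,
        mvfderiv (𝓡 m) (extChartAt (𝓡 m) p) x v = EuclideanSpace.single j 1 →
        ∀ a b, mvfderiv (𝓡 m) (g a b) x v = (A * g) a b x) ∧
      ∀ a b, ∀ᶠ x in 𝓝 p, x ∈ coordSlice p j → (g - 1) a b x = 0 := by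
  set Λ : Matrix (Fin n) (Fin n) ℝ ≃ₗ[ℝ] ((Fin n → ℝ) →L[ℝ] (Fin n → ℝ)) :=
    (Matrix.toLin' (R := ℝ) (m := Fin n) (n := Fin n)).trans LinearMap.toContinuousLinearMap with hΛ
  have hΛmul : ∀ B C : Matrix (Fin n) (Fin n) ℝ, Λ (B * C) = Λ B * Λ C := fun B C ↦ by
    ext v i
    simp [hΛ]
  have hΛone : Λ (1 : Matrix (Fin n) (Fin n) ℝ) = 1 := by
    ext v i
    simp [hΛ]
  set ev : M → Matrix (Fin n) (Fin n) ℝ := fun x ↦ Matrix.of fun a b ↦ A a b x with hev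
  have hA : ContMDiff (𝓡 m) 𝓘(ℝ, Fin n → Fin n → ℝ) ∞ (fun x a b ↦ A a b x) :=
    contMDiff_pi_space.2 fun a ↦ contMDiff_pi_space.2 fun b ↦ (A a b).contMDiff
  have hB : ContMDiff (𝓡 m) 𝓘(ℝ, (Fin n → ℝ) →L[ℝ] (Fin n → ℝ)) ∞ (fun x ↦ Λ (ev x)) :=
    (LinearMap.toContinuousLinearMap
      (Λ.toLinearMap ∘ₗ (Matrix.ofLinearEquiv ℝ).toLinearMap)).contMDiff.comp hA
  obtain ⟨g, hg, hgv, hg1⟩ := exists_contMDiffAt_solution (p := p)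
    (Eventually.of_forall fun x ↦ hB x) j
  set ℓ : Fin n → Fin n → ((Fin n → ℝ) →L[ℝ] (Fin n → ℝ)) →L[ℝ] ℝ := fun a b ↦
    LinearMap.toContinuousLinearMap (Matrix.entryLinearMap ℝ ℝ a b ∘ₗ Λ.symm.toLinearMap)
    with hℓ
  have hℓΛ : ∀ a b (B : Matrix (Fin n) (Fin n) ℝ), ℓ a b (Λ B) = B a b := fun a b B ↦ by
    change Λ.symm (Λ B) a b = B a b
    rw [LinearEquiv.symm_apply_apply]
  choose G hG hGg using fun a b ↦ exists_contMDiff_eventuallyEq (m := m) (p := p)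
    (f := fun x ↦ ℓ a b (g x)) (hg.mono fun x hx ↦ (ℓ a b).contMDiff.contMDiffAt.comp x hx)
  set G' : Matrix (Fin n) (Fin n) C^∞⟮𝓡 m, M; 𝓘(ℝ, ℝ), ℝ⟯ :=
    Matrix.of fun a b ↦ ⟨G a b, hG a b⟩ with hG'
  have hev' : ∀ᶠ x in 𝓝 p, ∀ a b, G a b =ᶠ[𝓝 x] fun x ↦ ℓ a b (g x) :=
    eventually_all.2 fun a ↦ eventually_all.2 fun b ↦ (hGg a b).eventuallyEq_nhds
  refine ⟨G', ?_, fun a b ↦ ?_⟩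
  · filter_upwards [hg, hgv, hev'] with x h1 h2 h3 v hv a b
    have h4 : mvfderiv (𝓡 m) (G' a b) x v = ℓ a b (mvfderiv (𝓡 m) g x v) :=
      (mvfderiv_congr (h3 a b) v).trans
        (mvfderiv_clm_comp (ℓ a b) (h1.mdifferentiableAt (by simp)) v)
    have h5 : g x = Λ (Matrix.of fun a b ↦ ℓ a b (g x)) := (Λ.apply_symm_apply (g x)).symm
    rw [h4, h2 v hv, h5, ← hΛmul, hℓΛ, Matrix.mul_apply, Matrix.mul_apply, ContMDiffMap.sum_apply]
    refine Finset.sum_congr rfl fun c _ ↦ ?_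
    have h6 : G c b x = ℓ c b (g x) := (h3 c b).self_of_nhds
    exact congrArg (A a c x * ·) h6.symm
  · filter_upwards [hg1, hev'] with x h1 h3 hx
    have h6 : G a b x = ℓ a b (g x) := (h3 a b).self_of_nhds
    rw [h1 hx, ← hΛone, hℓΛ] at h6
    have h7 : (G' - 1) a b x =
        G a b x - (1 : Matrix (Fin n) (Fin n) C^∞⟮𝓡 m, M; 𝓘(ℝ, ℝ), ℝ⟯) a b x := rfl
    rw [h7, h6, one_smooth_apply, sub_self]

end MatrixODE

namespace CourantAlgebroid

variable {m : ℕ} {M : Type*} [TopologicalSpace M] [T2Space M]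
  [ChartedSpace (EuclideanSpace ℝ (Fin m)) M] [IsManifold (𝓡 m) ∞ M]
  {F : Type*} [NormedAddCommGroup F] [NormedSpace ℝ F] [FiniteDimensional ℝ F]
  {V : M → Type*} [TopologicalSpace (TotalSpace F V)]
  [∀ x, TopologicalSpace (V x)] [∀ x, AddCommGroup (V x)] [∀ x, Module ℝ (V x)]
  [FiberBundle F V] [VectorBundle ℝ F V] [ContMDiffVectorBundle ∞ F V (𝓡 m)]
  {C : CourantAlgebroid m F V}

open DorfmanAlgebra

/-- The germs of sections of a transitive Courant algebroid satisfy the hypotheses of the algebraic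
normal form. -/
theorem isChart_germAlgebra (hC : C.IsTransitive) {p : M} {X : Fin m → C^∞⟮𝓡 m, M; 𝓘(ℝ, ℝ), ℝ⟯}
    (hX : ∀ j, X j =ᶠ[𝓝 p] chartCoord p j) :
    (C.germAlgebra p).IsChart (Fin (Module.finrank ℝ F)) (germEval m p)
      (fun j ↦ toQuotR (germIdeal m p) (X j))
      (fun j ↦ (sliceIdeal p j).map (toQuotR (germIdeal m p))) where
  exists_basis := exists_basis_germs p
  isUnit_of_ev f hf := by
    obtain ⟨f, rfl⟩ := toQuotR_surjective _ f
    exact isUnit_toQuotR hf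
  exists_pair hm := by
    obtain ⟨t, ht⟩ := exists_tangent_coord (mem_chart_source (EuclideanSpace ℝ (Fin m)) p) 1
    obtain ⟨v, rfl⟩ := hC p t
    have hv : v ≠ 0 := by
      rintro rfl
      have := ht ⟨0, hm⟩
      simp at this
    obtain ⟨w, hw⟩ : ∃ w, C.pairing p v w ≠ 0 := by
      by_contra! h
      exact hv (C.pairing_nondegenerate p v h)
    obtain ⟨s, rfl⟩ := exists_contMDiffSection_eq (m := m) (F := F) v
    obtain ⟨s', rfl⟩ := exists_contMDiffSection_eq (m := m) (F := F) w
    refine ⟨toQuot _ s, toQuot _ s', ?_⟩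
    rw [quotient_pair]
    exact hw
  exists_transversal := by
    choose t ht using fun l : Fin m ↦ exists_tangent_coord
      (mem_chart_source (EuclideanSpace ℝ (Fin m)) p) ((1 : Matrix (Fin m) (Fin m) ℝ) l)
    choose v hv using fun l ↦ hC p (t l)
    choose s hs using fun l ↦ exists_contMDiffSection_eq (m := m) (F := F) (v l)
    refine ⟨fun l ↦ toQuot _ (s l), fun l j ↦ ?_⟩
    rw [germAlgebra_act, germEval_apply, ← ht l j,
      ← (eventually_mvfderiv_coord hX).self_of_nhds j, ← hv, ← hs]
    rfl
  act_eq_zero u hu f := by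
    obtain ⟨u, rfl⟩ := toQuot_surjective _ u
    obtain ⟨f, rfl⟩ := toQuotR_surjective _ f
    simp only [germAlgebra_act_eq_zero_iff] at hu ⊢
    filter_upwards [eventually_all.2 hu, eventually_mvfderiv_coord hX,
      eventually_mem_chart_source (m := m) p] with x h1 h2 h3
    have h4 : C.anchor x (u x) = 0 := tangent_ext h3 fun j ↦ by
      rw [← h2, h1, map_zero]
    rw [h4, map_zero]
  eq_const f hf := by
    obtain ⟨f, rfl⟩ := toQuotR_surjective _ f
    obtain ⟨φ, -, hφ, -⟩ := exists_frame (m := m) (F := F) (V := V) p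
    have h1 : ∀ᶠ x in 𝓝 p, ∀ v, mvfderiv (𝓡 m) f x v = 0 := by
      filter_upwards [hφ, eventually_all.2 fun a ↦
        (germAlgebra_act_eq_zero_iff (φ a) f).1 (hf (toQuot _ (φ a)))] with x h1 h2 v
      obtain ⟨w, rfl⟩ := hC x v
      obtain ⟨c, rfl⟩ := h1 w
      simp [h2]
    have h2 := eventually_eq_of_mvfderiv_eq_zero
      (Eventually.of_forall fun x ↦ (f.contMDiff x).mdifferentiableAt (by simp)) h1
    exact toQuotR_eq_iff_eventually (g := algebraMap ℝ _ (f p)) |>.2 h2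
  eq_zero_of_mem u j f hu hf hfZ := by
    obtain ⟨u, rfl⟩ := toQuot_surjective _ u
    obtain ⟨f, rfl⟩ := toQuotR_surjective _ f
    rw [germAlgebra_act_eq_zero_iff] at hf
    rw [toQuotR_mem_map_sliceIdeal] at hfZ
    exact toQuotR_eq_zero_iff.2 (eventually_eq_zero_of_slice (Eventually.of_forall fun x ↦
      (f.contMDiff x).mdifferentiableAt (by simp)) (eventually_anchor_eq hX hu) hf hfZ)
  act_mem u j f hu hfZ := by
    obtain ⟨u, rfl⟩ := toQuot_surjective _ u
    obtain ⟨f, rfl⟩ := toQuotR_surjective _ f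
    rw [germAlgebra_act_eq_zero_iff] at hu
    rw [toQuotR_mem_map_sliceIdeal] at hfZ
    rw [germAlgebra_act, toQuotR_mem_map_sliceIdeal]
    refine eventually_mvfderiv_eq_zero_of_slice (X := fun x ↦ C.anchor x (u x))
      (Eventually.of_forall fun x ↦ (f.contMDiff x).mdifferentiableAt (by simp)) ?_ hfZ
    filter_upwards [hu, eventually_mvfderiv_coord hX] with x h1 h2
    rw [← h2, h1]
  ev_eq_zero j f hf := by
    obtain ⟨f, rfl⟩ := toQuotR_surjective _ f
    exact (toQuotR_mem_map_sliceIdeal.1 hf).self_of_nhds rfl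
  exists_ode u j hu A := by
    obtain ⟨u, rfl⟩ := toQuot_surjective _ u
    choose A' hA' using fun a b ↦ toQuotR_surjective _ (A a b)
    obtain ⟨g, hg, hg1⟩ := exists_contMDiff_solution_matrix (p := p) (Matrix.of A') j
    refine ⟨Matrix.of fun a b ↦ toQuotR _ (g a b), fun a b ↦ ?_, fun a b ↦ ?_⟩
    · have h1 : (A * Matrix.of fun a b ↦ toQuotR (germIdeal m p) (g a b)) a b =
          toQuotR (germIdeal m p) ((Matrix.of A' * g) a b) := by
        simp [Matrix.mul_apply, hA']
      rw [h1, Matrix.of_apply, germAlgebra_act, toQuotR_eq_iff_eventually]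
      filter_upwards [hg, eventually_anchor_eq hX hu] with x h2 h3
      exact h2 _ h3 a b
    · have h1 : ((Matrix.of fun a b ↦ toQuotR (germIdeal m p) (g a b)) - 1) a b =
          toQuotR (germIdeal m p) ((g - 1) a b) := by
        rw [Matrix.sub_apply, Matrix.sub_apply, map_sub, toQuotR_one_apply]
        rfl
      rw [h1, toQuotR_mem_map_sliceIdeal]
      exact hg1 a b

end CourantAlgebroid

/-! ### Brackets in untwisted Dorfman algebras -/

lemma QuadraticLieAlgebra.ext_form {𝔤 : Type*} [AddCommGroup 𝔤] [Module ℝ 𝔤]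
    (Q : QuadraticLieAlgebra 𝔤) {a a' : 𝔤} (h : ∀ b, Q.form a b = Q.form a' b) : a = a' :=
  sub_eq_zero.1 (Q.form_nondegenerate _ fun b ↦ by simp [h b])

/-- The standard basis of `ℝⁿ` has a dual basis with respect to a nondegenerate form. -/
lemma QuadraticLieAlgebra.exists_dual {n : ℕ} (Q : QuadraticLieAlgebra (Fin n → ℝ)) :
    ∃ ρ : Fin n → Fin n → ℝ, ∀ a b, Q.form (ρ a) b = b a := by
  have hinj : Function.Injective Q.form := fun a a' h ↦ Q.ext_form fun b ↦ by rw [h]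
  have hsurj : Function.Surjective Q.form :=
    (LinearMap.injective_iff_surjective_of_finrank_eq_finrank
      (Subspace.dual_finrank_eq (K := ℝ) (V := Fin n → ℝ)).symm).1 hinj
  choose ρ hρ using fun a : Fin n ↦ hsurj (LinearMap.proj a)
  exact ⟨ρ, fun a b ↦ by rw [hρ]; rfl⟩

namespace DorfmanAlgebra

variable {R E : Type*} [CommRing R] [Algebra ℝ R] [AddCommGroup E] [Module R E] [Module ℝ E]
  {D : DorfmanAlgebra R E}

/-- The bracket `[u, v]` is determined by the brackets `[w, u]` with test elements `w`. -/
lemma pair_br (u v w : E) : D.pair (D.br u v) w =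
    D.act u (D.pair v w) - D.act v (D.pair u w) + D.pair v (D.br w u) := by
  have h1 := D.act_pair u v w
  have h2 := D.br_symm u w v
  rw [D.pair_symm _ v, D.pair_symm _ v] at h2
  linear_combination -h1 - h2

namespace IsUntwisted

variable {m n : ℕ} {x : Fin m → R} {Q : QuadraticLieAlgebra (Fin n → ℝ)} {e d : Fin m → E}
  {r : (Fin n → ℝ) →ₗ[ℝ] E} (H : D.IsUntwisted x Q e d r)
  {ρ : Fin n → Fin n → ℝ} (hρ : ∀ a b, Q.form (ρ a) b = b a)
include H

lemma pair_d_e (j i : Fin m) : D.pair (d j) (e i) = (1 : Matrix (Fin m) (Fin m) R) i j := by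
  rw [H.grad, H.act_e]

lemma pair_d_d (i j : Fin m) : D.pair (d i) (d j) = 0 := by
  rw [H.grad, H.act_d]

lemma pair_d_r (j : Fin m) (a : Fin n → ℝ) : D.pair (d j) (r a) = 0 := by
  rw [H.grad, H.act_r]

lemma br_r_e (a : Fin n → ℝ) (i : Fin m) : D.br (r a) (e i) = 0 := by
  rw [br_eq_neg, H.br_e_r, neg_zero]
  simp [H.pair_r_e]

variable [IsScalarTower ℝ R E]
include hρ

/-- Every element is determined by its scalar products with the `d i`, the `e i` and the `r a`. -/
lemma sum_eq (u : E) : u = ∑ i, D.pair u (d i) • e i + ∑ i, D.pair u (e i) • d i +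
    ∑ a, D.pair u (r (Pi.single a 1)) • r (ρ a) := by
  have hed : ∀ i j, D.pair (e i) (d j) = (1 : Matrix (Fin m) (Fin m) R) i j := fun i j ↦ by
    rw [D.pair_symm, H.pair_d_e]
  have her : ∀ i a, D.pair (e i) (r a) = 0 := fun i a ↦ by rw [D.pair_symm, H.pair_r_e]
  refine sub_eq_zero.1 (H.eq_zero _ (fun i ↦ ?_) (fun j ↦ ?_) fun b ↦ ?_)
  · simp [H.pair_e, H.pair_d_e, H.pair_r_e, Matrix.one_apply]
  · simp [hed, H.pair_d_d, D.pair_symm _ (d j), H.pair_d_r, Matrix.one_apply]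
  · have h1 : r b = ∑ a, algebraMap ℝ R (b a) • r (Pi.single a 1) := by
      conv_lhs => rw [pi_eq_sum_univ' b]
      simp [algebraMap_smul]
    have h2 : D.pair u (r b) = ∑ a, algebraMap ℝ R (b a) * D.pair u (r (Pi.single a 1)) := by
      conv_lhs => rw [h1]
      simp only [map_sum, map_smul, smul_eq_mul]
    simp [her, H.pair_d_r, H.pair_r, hρ, h2, mul_comm]

lemma br_r_left (b : Fin n → ℝ) (u : E) :
    D.br (r b) u = ∑ a, D.pair u (r (Pi.single a 1)) • r (Q.bracket b (ρ a)) := by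
  conv_lhs => rw [H.sum_eq hρ u]
  simp [br_smul, H.act_r, H.br_r_e, H.br_r_d, H.br_r]

lemma br_e_left (i : Fin m) (u : E) :
    D.br (e i) u = ∑ j, D.act (e i) (D.pair u (d j)) • e j +
      ∑ j, D.act (e i) (D.pair u (e j)) • d j +
      ∑ a, D.act (e i) (D.pair u (r (Pi.single a 1))) • r (ρ a) := by
  conv_lhs => rw [H.sum_eq hρ u]
  simp [br_smul, H.br_e, H.br_e_d, H.br_e_r]

/-- The component of a bracket in the bundle of Lie algebras. -/
lemma pair_br_r (u v : E) (b : Fin n → ℝ) :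
    D.pair (D.br u v) (r b) = D.act u (D.pair v (r b)) - D.act v (D.pair u (r b)) +
      ∑ a, D.pair u (r (Pi.single a 1)) * D.pair v (r (Q.bracket b (ρ a))) := by
  rw [pair_br, H.br_r_left hρ]
  simp

/-- The component of a bracket in the cotangent bundle. -/
lemma pair_br_e (u v : E) (i : Fin m) :
    D.pair (D.br u v) (e i) = D.act u (D.pair v (e i)) - D.act v (D.pair u (e i)) +
      (∑ j, D.act (e i) (D.pair u (d j)) * D.pair v (e j) +
      ∑ j, D.act (e i) (D.pair u (e j)) * D.pair v (d j) +
      ∑ a, D.act (e i) (D.pair u (r (Pi.single a 1))) * D.pair v (r (ρ a))) := by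
  rw [pair_br, H.br_e_left hρ]
  simp

end IsUntwisted
end DorfmanAlgebra

/-! ### Adapted sections -/

section Linear

variable {M : Type*} [TopologicalSpace M] {n : ℕ} {p : M}

/-- Near a point, an identity which is linear in `a : ℝⁿ` needs to be verified for each `a`
separately only, since the finitely many basis vectors suffice. -/
lemma eventually_forall_linearMap {W : M → Type*} [∀ y, AddCommGroup (W y)] [∀ y, Module ℝ (W y)]
    (L : ∀ y, (Fin n → ℝ) →ₗ[ℝ] W y) (h : ∀ a, ∀ᶠ y in 𝓝 p, L y a = 0) :
    ∀ᶠ y in 𝓝 p, ∀ a, L y a = 0 := by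
  filter_upwards [eventually_all.2 fun k ↦ h (Pi.single k 1)] with y hy a
  rw [pi_eq_sum_univ' a, map_sum]
  exact Finset.sum_eq_zero fun k _ ↦ by rw [map_smul, hy, smul_zero]

lemma eventually_forall_bilinear {W : M → Type*} [∀ y, AddCommGroup (W y)] [∀ y, Module ℝ (W y)]
    (B : ∀ y, (Fin n → ℝ) →ₗ[ℝ] (Fin n → ℝ) →ₗ[ℝ] W y) (h : ∀ a b, ∀ᶠ y in 𝓝 p, B y a b = 0) :
    ∀ᶠ y in 𝓝 p, ∀ a b, B y a b = 0 := by
  filter_upwards [eventually_forall_linearMap B fun a ↦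
    (eventually_forall_linearMap (fun y ↦ B y a) (h a)).mono fun y hy ↦ LinearMap.ext hy]
    with y hy a b
  rw [hy, LinearMap.zero_apply]

end Linear

namespace CourantAlgebroid

variable {m : ℕ} {M : Type*} [TopologicalSpace M]
  [ChartedSpace (EuclideanSpace ℝ (Fin m)) M] [IsManifold (𝓡 m) ∞ M]
  {F : Type*} [NormedAddCommGroup F] [NormedSpace ℝ F]
  {V : M → Type*} [TopologicalSpace (TotalSpace F V)]
  [∀ x, TopologicalSpace (V x)] [∀ x, AddCommGroup (V x)] [∀ x, Module ℝ (V x)]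
  [FiberBundle F V] [VectorBundle ℝ F V]

open DorfmanAlgebra

/-- The value of a section at a point, as a linear map. -/
def evalSection (y : M) : Cₛ^∞⟮𝓡 m; F, V⟯ →ₗ[ℝ] V y where
  toFun s := s y
  map_add' _ _ := rfl
  map_smul' _ _ := rfl

/-- The identities at the point `y` which say that the sections `e i`, `d j` and `r a` identify a
Courant algebroid with the untwisted one: `e i` corresponds to the coordinate vector field `∂ᵢ`,
`d j` to twice the differential of the coordinate function `X j`, and `r a` to the constant section
`a` of the bundle of quadratic Lie algebras. The vectors `ρ a` are the dual basis of the standard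
basis with respect to the scalar product of the Lie algebra. -/
structure IsAdaptedAt (C : CourantAlgebroid m F V) (X : Fin m → C^∞⟮𝓡 m, M; 𝓘(ℝ, ℝ), ℝ⟯) {n : ℕ}
    (Q : QuadraticLieAlgebra (Fin n → ℝ)) (ρ : Fin n → Fin n → ℝ)
    (e d : Fin m → Cₛ^∞⟮𝓡 m; F, V⟯) (r : (Fin n → ℝ) →ₗ[ℝ] Cₛ^∞⟮𝓡 m; F, V⟯) (y : M) : Prop where
  tangent_ext : ∀ v w : TangentSpace (𝓡 m) y,
    (∀ j, mvfderiv (𝓡 m) (X j) y v = mvfderiv (𝓡 m) (X j) y w) → v = w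
  grad : ∀ j v, C.pairing y (d j y) v = mvfderiv (𝓡 m) (X j) y (C.anchor y v)
  act_e : ∀ i j, mvfderiv (𝓡 m) (X j) y (C.anchor y (e i y)) =
    (1 : Matrix (Fin m) (Fin m) ℝ) i j
  anchor_d : ∀ j, C.anchor y (d j y) = 0
  anchor_r : ∀ a, C.anchor y (r a y) = 0
  pair_e : ∀ i j, C.pairing y (e i y) (e j y) = 0
  pair_r_e : ∀ a i, C.pairing y (r a y) (e i y) = 0
  pair_r : ∀ a b, C.pairing y (r a y) (r b y) = Q.form a b
  br_e : ∀ i j, C.bracket (e i) (e j) y = 0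
  br_e_d : ∀ i j, C.bracket (e i) (d j) y = 0
  br_e_r : ∀ i a, C.bracket (e i) (r a) y = 0
  br_r_d : ∀ a j, C.bracket (r a) (d j) y = 0
  br_r : ∀ a b, C.bracket (r a) (r b) y = r (Q.bracket a b) y
  sum_eq : ∀ v, v = ∑ i, C.pairing y v (d i y) • e i y + ∑ i, C.pairing y v (e i y) • d i y +
    ∑ a, C.pairing y v (r (Pi.single a 1) y) • r (ρ a) y

variable [T2Space M] [FiniteDimensional ℝ F] [ContMDiffVectorBundle ∞ F V (𝓡 m)]
  {C : CourantAlgebroid m F V} {X : Fin m → C^∞⟮𝓡 m, M; 𝓘(ℝ, ℝ), ℝ⟯} {n : ℕ}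
  {Q : QuadraticLieAlgebra (Fin n → ℝ)} {ρ : Fin n → Fin n → ℝ} {e d : Fin m → Cₛ^∞⟮𝓡 m; F, V⟯}
  {r : (Fin n → ℝ) →ₗ[ℝ] Cₛ^∞⟮𝓡 m; F, V⟯}

/-- Sections modulo an ideal of functions, as a real linear map. -/
def toQuotReal (I : Ideal C^∞⟮𝓡 m, M; 𝓘(ℝ, ℝ), ℝ⟯) : Cₛ^∞⟮𝓡 m; F, V⟯ →ₗ[ℝ]
    Cₛ^∞⟮𝓡 m; F, V⟯ ⧸ (I • ⊤ : Submodule C^∞⟮𝓡 m, M; 𝓘(ℝ, ℝ), ℝ⟯ Cₛ^∞⟮𝓡 m; F, V⟯) where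
  toFun := toQuot I
  map_add' := map_add _
  map_smul' := toQuot_smul_real I

/-- Adapted germs of sections at `p` give sections which are adapted near `p`. -/
lemma eventually_isAdaptedAt {p : M} (hX : ∀ j, X j =ᶠ[𝓝 p] chartCoord p j)
    (H : (C.germAlgebra p).IsUntwisted (fun j ↦ toQuotR (germIdeal m p) (X j)) Q
      (fun i ↦ toQuot _ (e i)) (fun j ↦ toQuot _ (d j)) (toQuotReal _ ∘ₗ r))
    (hρ : ∀ a b, Q.form (ρ a) b = b a) : ∀ᶠ y in 𝓝 p, C.IsAdaptedAt X Q ρ e d r y := by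
  obtain ⟨φ, -, hφ, -⟩ := exists_frame (m := m) (F := F) (V := V) p
  have hr : ∀ a, (toQuotReal (germIdeal m p) ∘ₗ r) a = toQuot (germIdeal m p) (r a) := fun _ ↦ rfl
  have hgrad : ∀ j, ∀ᶠ y in 𝓝 p, ∀ v,
      C.pairing y (d j y) v = mvfderiv (𝓡 m) (X j) y (C.anchor y v) := fun j ↦ by
    have h1 : ∀ k, ∀ᶠ y in 𝓝 p, C.pairing y (d j y) (φ k y) =
        mvfderiv (𝓡 m) (X j) y (C.anchor y (φ k y)) := fun k ↦ by
      have := H.grad j (toQuot _ (φ k))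
      rwa [germAlgebra_act, quotient_pair, toQuotR_eq_iff_eventually] at this
    filter_upwards [hφ, eventually_all.2 h1] with y h2 h3 v
    obtain ⟨c, rfl⟩ := h2 v
    simp [h3]
  have hsum : ∀ᶠ y in 𝓝 p, ∀ v, v = ∑ i, C.pairing y v (d i y) • e i y +
      ∑ i, C.pairing y v (e i y) • d i y +
      ∑ a, C.pairing y v (r (Pi.single a 1) y) • r (ρ a) y := by
    have h1 : ∀ k, ∀ᶠ y in 𝓝 p, φ k y = ∑ i, C.pairing y (φ k y) (d i y) • e i y +
      ∑ i, C.pairing y (φ k y) (e i y) • d i y +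
      ∑ a, C.pairing y (φ k y) (r (Pi.single a 1) y) • r (ρ a) y := fun k ↦ by
      have := H.sum_eq hρ (toQuot _ (φ k))
      simp only [hr, quotient_pair, ← toQuot_smul, ← map_sum, ← map_add] at this
      rw [toQuot_eq_iff_eventually] at this
      filter_upwards [this] with y hy
      simpa only [ContMDiffSection.coe_add, Pi.add_apply, ContMDiffSection.sum_apply,
        ContMDiffSection.smooth_smul_apply, dorfmanAlgebra_pair_apply] using hy
    filter_upwards [hφ, eventually_all.2 h1] with y h2 h3 v
    set Φ : V y →ₗ[ℝ] V y := ∑ i, ((C.pairing y).flip (d i y)).smulRight (e i y) +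
      ∑ i, ((C.pairing y).flip (e i y)).smulRight (d i y) +
      ∑ a, ((C.pairing y).flip (r (Pi.single a 1) y)).smulRight (r (ρ a) y) with hΦ
    have h4 : ∀ v, Φ v = ∑ i, C.pairing y v (d i y) • e i y +
      ∑ i, C.pairing y v (e i y) • d i y +
      ∑ a, C.pairing y v (r (Pi.single a 1) y) • r (ρ a) y := fun v ↦ by simp [hΦ]
    rw [← h4]
    obtain ⟨c, rfl⟩ := h2 v
    rw [map_sum]
    refine Finset.sum_congr rfl fun k _ ↦ ?_
    rw [map_smul, h4, ← h3]
  have hact : ∀ {u : Cₛ^∞⟮𝓡 m; F, V⟯},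
      (∀ j, (C.germAlgebra p).act (toQuot _ u) (toQuotR _ (X j)) = 0) →
      ∀ᶠ y in 𝓝 p, C.anchor y (u y) = 0 := fun {u} hu ↦ by
    filter_upwards [eventually_mem_chart_source (m := m) p, eventually_mvfderiv_coord hX,
      eventually_all.2 fun j ↦ (germAlgebra_act_eq_zero_iff u (X j)).1 (hu j)] with y h1 h2 h3
    refine tangent_ext h1 fun j ↦ ?_
    rw [← h2, h3, map_zero]
  have hact_e : ∀ i j, ∀ᶠ y in 𝓝 p, mvfderiv (𝓡 m) (X j) y (C.anchor y (e i y)) =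
      (1 : Matrix (Fin m) (Fin m) ℝ) i j := fun i j ↦ by
    have := H.act_e i j
    rw [germAlgebra_act, toQuotR_one_apply, toQuotR_eq_iff_eventually] at this
    filter_upwards [this] with y hy
    rwa [one_smooth_apply] at hy
  have hpair : ∀ {u v : Cₛ^∞⟮𝓡 m; F, V⟯} {c : ℝ},
      (C.germAlgebra p).pair (toQuot _ u) (toQuot _ v) = algebraMap ℝ _ c →
      ∀ᶠ y in 𝓝 p, C.pairing y (u y) (v y) = c := fun {u v c} h ↦ by
    rw [quotient_pair] at h
    exact toQuotR_eq_iff_eventually (g := algebraMap ℝ _ c) |>.1 h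
  have hbr : ∀ {u v w : Cₛ^∞⟮𝓡 m; F, V⟯},
      (C.germAlgebra p).br (toQuot _ u) (toQuot _ v) = toQuot _ w →
      ∀ᶠ y in 𝓝 p, C.bracket u v y = w y := fun {u v w} h ↦ by
    rw [quotient_br] at h
    exact toQuot_eq_iff_eventually.1 h
  have hbr0 : ∀ {u v : Cₛ^∞⟮𝓡 m; F, V⟯},
      (C.germAlgebra p).br (toQuot _ u) (toQuot _ v) = 0 →
      ∀ᶠ y in 𝓝 p, C.bracket u v y = 0 := fun {u v} h ↦ hbr (w := 0) h
  filter_upwards [eventually_mem_chart_source (m := m) p, eventually_mvfderiv_coord hX,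
    eventually_all.2 hgrad, hsum,
    eventually_all.2 fun i ↦ eventually_all.2 fun j ↦ hact_e i j,
    eventually_all.2 fun i ↦ hact (u := d i) fun j ↦ H.act_d i j,
    eventually_forall_linearMap (fun y ↦ C.anchor y ∘ₗ evalSection y ∘ₗ r) fun a ↦
      hact (u := r a) fun j ↦ H.act_r a _,
    eventually_all.2 fun i ↦ eventually_all.2 fun j ↦ hpair (u := e i) (v := e j) (c := 0)
      ((H.pair_e i j).trans (map_zero _).symm),
    eventually_all.2 fun i ↦ eventually_forall_linearMap
      (fun y ↦ (C.pairing y).flip (e i y) ∘ₗ evalSection y ∘ₗ r) fun a ↦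
      hpair (u := r a) (v := e i) (c := 0) ((H.pair_r_e a i).trans (map_zero _).symm),
    eventually_forall_bilinear
      (fun y ↦ (C.pairing y).compl₁₂ (evalSection y ∘ₗ r) (evalSection y ∘ₗ r) - Q.form)
      fun a b ↦ (hpair (u := r a) (v := r b) (H.pair_r a b)).mono fun y hy ↦ sub_eq_zero.2 hy,
    eventually_all.2 fun i ↦ eventually_all.2 fun j ↦ hbr0 (u := e i) (v := e j) (H.br_e i j),
    eventually_all.2 fun i ↦ eventually_all.2 fun j ↦ hbr0 (u := e i) (v := d j) (H.br_e_d i j),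
    eventually_all.2 fun i ↦ eventually_forall_linearMap
      (fun y ↦ evalSection y ∘ₗ C.bracket (e i) ∘ₗ r) fun a ↦
      hbr0 (u := e i) (v := r a) (H.br_e_r i a),
    eventually_all.2 fun j ↦ eventually_forall_linearMap
      (fun y ↦ evalSection y ∘ₗ C.bracket.flip (d j) ∘ₗ r) fun a ↦
      hbr0 (u := r a) (v := d j) (H.br_r_d a j),
    eventually_forall_bilinear (fun y ↦ (C.bracket.compl₁₂ r r).compr₂ (evalSection y) -
      Q.bracket.compr₂ (evalSection y ∘ₗ r)) fun a b ↦
      (hbr (u := r a) (v := r b) (H.br_r a b)).mono fun y hy ↦ sub_eq_zero.2 hy]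
    with y h1 h2 h3 h4 h5 h6 h7 h8 h9 h10 h11 h12 h13 h14 h15
  exact
    { tangent_ext := fun v w h ↦ tangent_ext h1 fun j ↦ by rw [← h2, ← h2, h]
      grad := h3
      act_e := h5
      anchor_d := h6
      anchor_r := h7
      pair_e := h8
      pair_r_e := fun a i ↦ h9 i a
      pair_r := fun a b ↦ sub_eq_zero.1 (h10 a b)
      br_e := h11
      br_e_d := h12
      br_e_r := h13
      br_r_d := fun a j ↦ h14 j a
      br_r := fun a b ↦ sub_eq_zero.1 (h15 a b)
      sum_eq := h4 }

/-- Every point has a neighbourhood with adapted sections. -/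
lemma exists_eventually_isAdaptedAt (hC : C.IsTransitive) (p : M) :
    ∃ (X : Fin m → C^∞⟮𝓡 m, M; 𝓘(ℝ, ℝ), ℝ⟯) (n : ℕ) (Q : QuadraticLieAlgebra (Fin n → ℝ))
      (ρ : Fin n → Fin n → ℝ) (e d : Fin m → Cₛ^∞⟮𝓡 m; F, V⟯)
      (r : (Fin n → ℝ) →ₗ[ℝ] Cₛ^∞⟮𝓡 m; F, V⟯),
      (∀ a b, Q.form (ρ a) b = b a) ∧ ∀ᶠ y in 𝓝 p, C.IsAdaptedAt X Q ρ e d r y := by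
  obtain ⟨X, hX⟩ := exists_coord_extension (m := m) p
  obtain ⟨n, Q, e, d, r, H⟩ := (isChart_germAlgebra hC hX).exists_isUntwisted
  obtain ⟨ρ, hρ⟩ := Q.exists_dual
  choose e' he using fun i ↦ toQuot_surjective _ (e i)
  choose d' hd using fun i ↦ toQuot_surjective _ (d i)
  choose r' hr using fun a ↦ toQuot_surjective _ (r (Pi.single a 1))
  set r'' := (Pi.basisFun ℝ (Fin n)).constr ℝ r' with hr''
  have h1 : toQuotReal (germIdeal m p) ∘ₗ r'' = r := (Pi.basisFun ℝ (Fin n)).ext fun a ↦ by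
    rw [LinearMap.comp_apply, hr'', Module.Basis.constr_basis, Pi.basisFun_apply, ← hr]
    rfl
  obtain rfl : e = fun i ↦ toQuot _ (e' i) := funext fun i ↦ (he i).symm
  obtain rfl : d = fun i ↦ toQuot _ (d' i) := funext fun i ↦ (hd i).symm
  rw [← h1] at H
  exact ⟨X, n, Q, ρ, e', d', r'', hρ, eventually_isAdaptedAt hX H hρ⟩

/-- Sections which are adapted near `x` have adapted germs at `x`. -/
lemma isUntwisted_germAlgebra {x : M} (H : ∀ᶠ y in 𝓝 x, C.IsAdaptedAt X Q ρ e d r y) :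
    (C.germAlgebra x).IsUntwisted (fun j ↦ toQuotR (germIdeal m x) (X j)) Q
      (fun i ↦ toQuot _ (e i)) (fun j ↦ toQuot _ (d j)) (toQuotReal _ ∘ₗ r) := by
  have hr : ∀ a, (toQuotReal (germIdeal m x) ∘ₗ r) a = toQuot (germIdeal m x) (r a) := fun _ ↦ rfl
  have hpair : ∀ {u v : Cₛ^∞⟮𝓡 m; F, V⟯} {c : ℝ}, (∀ᶠ y in 𝓝 x, C.pairing y (u y) (v y) = c) →
      (C.germAlgebra x).pair (toQuot _ u) (toQuot _ v) = algebraMap ℝ _ c := fun {u v c} h ↦ by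
    rw [quotient_pair]
    exact toQuotR_eq_iff_eventually (g := algebraMap ℝ _ c) |>.2 h
  have hbr : ∀ {u v w : Cₛ^∞⟮𝓡 m; F, V⟯}, (∀ᶠ y in 𝓝 x, C.bracket u v y = w y) →
      (C.germAlgebra x).br (toQuot _ u) (toQuot _ v) = toQuot _ w := fun {u v w} h ↦ by
    rw [quotient_br]
    exact toQuot_eq_iff_eventually.2 h
  refine ⟨fun j v ↦ ?_, fun i j ↦ ?_, fun i j ↦ ?_, fun a f ↦ ?_, fun i j ↦ ?_, fun a i ↦ ?_,
    fun a b ↦ hpair (H.mono fun y hy ↦ hy.pair_r a b),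
    fun i j ↦ hbr (w := 0) (H.mono fun y hy ↦ hy.br_e i j),
    fun i j ↦ hbr (w := 0) (H.mono fun y hy ↦ hy.br_e_d i j),
    fun i a ↦ hbr (w := 0) (H.mono fun y hy ↦ hy.br_e_r i a),
    fun a j ↦ hbr (w := 0) (H.mono fun y hy ↦ hy.br_r_d a j),
    fun a b ↦ hbr (H.mono fun y hy ↦ hy.br_r a b), fun u h1 h2 h3 ↦ ?_⟩
  · obtain ⟨v, rfl⟩ := toQuot_surjective _ v
    rw [germAlgebra_act, quotient_pair, toQuotR_eq_iff_eventually]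
    exact H.mono fun y hy ↦ hy.grad j (v y)
  · rw [germAlgebra_act, toQuotR_one_apply, toQuotR_eq_iff_eventually]
    exact H.mono fun y hy ↦ (hy.act_e i j).trans (one_smooth_apply i j y).symm
  · refine (germAlgebra_act_eq_zero_iff _ _).2 (H.mono fun y hy ↦ ?_)
    rw [hy.anchor_d, map_zero]
  · obtain ⟨f, rfl⟩ := toQuotR_surjective _ f
    refine (germAlgebra_act_eq_zero_iff (r a) f).2 (H.mono fun y hy ↦ ?_)
    rw [hy.anchor_r, map_zero]
  · exact (hpair (H.mono fun y hy ↦ hy.pair_e i j)).trans (map_zero _)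
  · exact (hpair (H.mono fun y hy ↦ hy.pair_r_e a i)).trans (map_zero _)
  · obtain ⟨u, rfl⟩ := toQuot_surjective _ u
    simp only [hr, quotient_pair, toQuotR_eq_zero_iff] at h1 h2 h3
    refine toQuot_eq_iff_eventually (t := 0) |>.2 ?_
    filter_upwards [H, eventually_all.2 h1, eventually_all.2 h2,
      eventually_all.2 fun a ↦ h3 (Pi.single a 1)] with y hy h4 h5 h6
    simp only [dorfmanAlgebra_pair_apply] at h4 h5 h6
    rw [hy.sum_eq (u y)]
    simp [h4, h5, h6]

end CourantAlgebroid

/-! ### The isomorphism with the untwisted Courant algebroid -/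

lemma QuadraticLieAlgebra.bracket_eq_neg {𝔤 : Type*} [AddCommGroup 𝔤] [Module ℝ 𝔤]
    (Q : QuadraticLieAlgebra 𝔤) (a b : 𝔤) : Q.bracket a b = -Q.bracket b a := by
  have h := Q.bracket_self (a + b)
  simp only [map_add, LinearMap.add_apply, Q.bracket_self, zero_add, add_zero] at h
  exact eq_neg_of_add_eq_zero_right h

namespace CourantAlgebroid

variable {m : ℕ} {M : Type*} [TopologicalSpace M]
  [ChartedSpace (EuclideanSpace ℝ (Fin m)) M] [IsManifold (𝓡 m) ∞ M]
  {F : Type*} [NormedAddCommGroup F] [NormedSpace ℝ F]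
  {V : M → Type*} [TopologicalSpace (TotalSpace F V)]
  [∀ x, TopologicalSpace (V x)] [∀ x, AddCommGroup (V x)] [∀ x, Module ℝ (V x)]
  [FiberBundle F V] [VectorBundle ℝ F V]

open DorfmanAlgebra

/-- The map to `TM ⊕ T*M ⊕ (M × ℝⁿ)` given by the anchor and by the scalar products with the
sections `e j` and `r a`. It takes `e j`, `d j` and `r a` to `∂ⱼ`, `2 d(X j)` and `a` where these
sections are adapted. -/
def toUntwisted (C : CourantAlgebroid m F V) (X : Fin m → C^∞⟮𝓡 m, M; 𝓘(ℝ, ℝ), ℝ⟯) {n : ℕ}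
    (ρ : Fin n → Fin n → ℝ) (e : Fin m → Cₛ^∞⟮𝓡 m; F, V⟯)
    (r : (Fin n → ℝ) →ₗ[ℝ] Cₛ^∞⟮𝓡 m; F, V⟯) (x : M) :
    V x →ₗ[ℝ] UntwistedFiber m (Fin n → ℝ) x :=
  (C.anchor x).prod
    ((∑ j, ((2 : ℝ) • (C.pairing x).flip (e j x)).smulRight
      (mvfderiv (𝓡 m) (X j) x : TangentSpace (𝓡 m) x →L[ℝ] ℝ)).prod
    (∑ a, ((C.pairing x).flip (r (Pi.single a 1) x)).smulRight (ρ a)))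

section Fibre

variable {C : CourantAlgebroid m F V} {X : Fin m → C^∞⟮𝓡 m, M; 𝓘(ℝ, ℝ), ℝ⟯} {n : ℕ}
  {Q : QuadraticLieAlgebra (Fin n → ℝ)} {ρ : Fin n → Fin n → ℝ} {e d : Fin m → Cₛ^∞⟮𝓡 m; F, V⟯}
  {r : (Fin n → ℝ) →ₗ[ℝ] Cₛ^∞⟮𝓡 m; F, V⟯} {x : M}

lemma toUntwisted_form (v : V x) : (C.toUntwisted X ρ e r x v).2.1 =
    ∑ j, (2 * C.pairing x v (e j x)) • mvfderiv (𝓡 m) (X j) x := by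
  simp [toUntwisted]

lemma toUntwisted_lie (v : V x) : (C.toUntwisted X ρ e r x v).2.2 =
    ∑ a, C.pairing x v (r (Pi.single a 1) x) • ρ a := by
  simp [toUntwisted]

lemma form_toUntwisted (hρ : ∀ a b, Q.form (ρ a) b = b a) (v : V x) (b : Fin n → ℝ) :
    Q.form (C.toUntwisted X ρ e r x v).2.2 b = C.pairing x v (r b x) := by
  have h1 : r b x = ∑ a, b a • r (Pi.single a 1) x := by
    change evalSection x (r b) = _
    conv_lhs => rw [pi_eq_sum_univ' b]
    simp only [map_sum, map_smul]
    rfl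
  rw [toUntwisted_lie, h1]
  simp [hρ, mul_comm]

namespace IsAdaptedAt

variable (H : C.IsAdaptedAt X Q ρ e d r x)
include H

lemma anchor_eq_sum (w : TangentSpace (𝓡 m) x) :
    w = ∑ j, mvfderiv (𝓡 m) (X j) x w • C.anchor x (e j x) :=
  H.tangent_ext _ _ fun j ↦ by simp [H.act_e, Matrix.one_apply]

lemma clm_ext {ξ ξ' : TangentSpace (𝓡 m) x →L[ℝ] ℝ}
    (h : ∀ i, ξ (C.anchor x (e i x)) = ξ' (C.anchor x (e i x))) : ξ = ξ' := by
  refine ContinuousLinearMap.ext fun w ↦ ?_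
  rw [H.anchor_eq_sum w]
  simp [h]

lemma toUntwisted_form_e (v : V x) (i : Fin m) :
    (C.toUntwisted X ρ e r x v).2.1 (C.anchor x (e i x)) = 2 * C.pairing x v (e i x) := by
  rw [toUntwisted_form]
  simp [sum_apply, H.act_e, Matrix.one_apply]

lemma pairing_toUntwisted (hρ : ∀ a b, Q.form (ρ a) b = b a) (v w : V x) :
    untwistedPairing Q x (C.toUntwisted X ρ e r x v) (C.toUntwisted X ρ e r x w) =
      C.pairing x v w := by
  have h1 : ∀ v w : V x, (C.toUntwisted X ρ e r x v).2.1 (C.toUntwisted X ρ e r x w).1 =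
      ∑ j, 2 * (C.pairing x v (e j x) * C.pairing x w (d j x)) := fun v w ↦ by
    rw [toUntwisted_form, sum_apply]
    refine Finset.sum_congr rfl fun j _ ↦ ?_
    rw [C.pairing_symm x w, H.grad, smul_apply, smul_eq_mul, mul_assoc]
    rfl
  have h2 : C.pairing x v w = ∑ i, C.pairing x v (d i x) * C.pairing x w (e i x) +
      ∑ i, C.pairing x v (e i x) * C.pairing x w (d i x) +
      ∑ a, C.pairing x v (r (Pi.single a 1) x) * C.pairing x w (r (ρ a) x) := by
    conv_lhs => rw [H.sum_eq v]
    simp [C.pairing_symm x w]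
  rw [untwistedPairing, h1, h1, toUntwisted_lie v, h2]
  simp only [map_sum, map_smul, LinearMap.sum_apply, LinearMap.smul_apply, smul_eq_mul,
    Q.form_symm (ρ _), form_toUntwisted hρ, ← Finset.mul_sum]
  simp only [mul_comm (C.pairing x w _)]
  ring

lemma bijective_toUntwisted (hρ : ∀ a b, Q.form (ρ a) b = b a) :
    Function.Bijective (C.toUntwisted X ρ e r x) := by
  refine ⟨(injective_iff_map_eq_zero _).2 fun v hv ↦ ?_, fun ⟨w, ξ, c⟩ ↦ ?_⟩
  · have h1 : C.anchor x v = 0 := congrArg Prod.fst hv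
    have h2 : ∀ j, C.pairing x v (d j x) = 0 := fun j ↦ by
      rw [C.pairing_symm, H.grad, h1, map_zero]
    have h3 : ∀ i, C.pairing x v (e i x) = 0 := fun i ↦ by
      have := H.toUntwisted_form_e v i
      rw [hv] at this
      simpa using this.symm
    have h4 : ∀ b, C.pairing x v (r b x) = 0 := fun b ↦ by
      rw [← form_toUntwisted (X := X) (e := e) hρ, hv]
      simp
    rw [H.sum_eq v]
    simp [h2, h3, h4]
  · set v : V x := ∑ i, mvfderiv (𝓡 m) (X i) x w • e i x +
      ∑ i, ((1 / 2 : ℝ) * ξ (C.anchor x (e i x))) • d i x + r c x with hv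
    have h1 : C.anchor x v = w := by
      conv_rhs => rw [H.anchor_eq_sum w]
      simp [hv, H.anchor_d, H.anchor_r]
    refine ⟨v, Prod.ext h1 (Prod.ext (H.clm_ext fun i ↦ ?_) (Q.ext_form fun b ↦ ?_))⟩
    · rw [H.toUntwisted_form_e, hv]
      simp [H.pair_e, H.pair_r_e, H.grad, H.act_e, Matrix.one_apply]
    · rw [form_toUntwisted hρ, hv]
      have h2 : ∀ i, C.pairing x (e i x) (r b x) = 0 := fun i ↦ by
        rw [C.pairing_symm, H.pair_r_e]
      simp [h2, H.grad, H.anchor_r, H.pair_r]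

/-- The inverse of `toUntwisted`, in terms of the adapted sections. -/
lemma eq_sum_toUntwisted (hρ : ∀ a b, Q.form (ρ a) b = b a) (v : V x) :
    v = ∑ i, mvfderiv (𝓡 m) (X i) x (C.toUntwisted X ρ e r x v).1 • e i x +
      ∑ i, ((1 / 2 : ℝ) * (C.toUntwisted X ρ e r x v).2.1 (C.anchor x (e i x))) • d i x +
      ∑ a, Q.form (C.toUntwisted X ρ e r x v).2.2 (Pi.single a 1) • r (ρ a) x := by
  conv_lhs => rw [H.sum_eq v]
  simp only [H.toUntwisted_form_e, form_toUntwisted hρ]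
  congr 2
  · refine Finset.sum_congr rfl fun i _ ↦ ?_
    rw [C.pairing_symm, H.grad]
    rfl
  · refine Finset.sum_congr rfl fun i _ ↦ ?_
    congr 1
    ring

end IsAdaptedAt

end Fibre

variable [T2Space M] [FiniteDimensional ℝ F] [ContMDiffVectorBundle ∞ F V (𝓡 m)]
  {C : CourantAlgebroid m F V} {X : Fin m → C^∞⟮𝓡 m, M; 𝓘(ℝ, ℝ), ℝ⟯} {n : ℕ}
  {Q : QuadraticLieAlgebra (Fin n → ℝ)} {ρ : Fin n → Fin n → ℝ} {e d : Fin m → Cₛ^∞⟮𝓡 m; F, V⟯}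
  {r : (Fin n → ℝ) →ₗ[ℝ] Cₛ^∞⟮𝓡 m; F, V⟯} {x : M}

/-- The anchor is a homomorphism of brackets. -/
lemma anchor_bracket (hC : C.IsTransitive) (u v : Cₛ^∞⟮𝓡 m; F, V⟯) (x : M) :
    C.anchor x (C.bracket u v x) =
      mlieBracket (𝓡 m) (fun y ↦ C.anchor y (u y)) (fun y ↦ C.anchor y (v y)) x := by
  obtain ⟨X, hX⟩ := exists_coord_extension (m := m) x
  have hX' := (eventually_mvfderiv_coord hX).self_of_nhds
  refine tangent_ext (mem_chart_source _ x) fun j ↦ ?_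
  rw [← hX', ← hX', mvfderiv_mlieBracket ((X j).contMDiff x) (C.anchor_smooth u x)
    (C.anchor_smooth v x)]
  have h := congrArg (germEval m x) ((isChart_germAlgebra hC hX).act_br
    (toQuot _ u) (toQuot _ v) (toQuotR _ (X j)))
  simp only [quotient_br, quotient_act, map_sub, germEval_apply] at h
  exact h

/-- The pointwise form of `DorfmanAlgebra.IsUntwisted.pair_br_r`. -/
lemma pairing_bracket_r (H : ∀ᶠ y in 𝓝 x, C.IsAdaptedAt X Q ρ e d r y)
    (hρ : ∀ a b, Q.form (ρ a) b = b a) (u v : Cₛ^∞⟮𝓡 m; F, V⟯) (b : Fin n → ℝ) :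
    C.pairing x (C.bracket u v x) (r b x) = C.dorfmanAlgebra.act u (C.dorfmanAlgebra.pair v (r b)) x
      - C.dorfmanAlgebra.act v (C.dorfmanAlgebra.pair u (r b)) x +
      ∑ a, C.pairing x (u x) (r (Pi.single a 1) x) *
        C.pairing x (v x) (r (Q.bracket b (ρ a)) x) := by
  have hr : ∀ a, (toQuotReal (germIdeal m x) ∘ₗ r) a = toQuot (germIdeal m x) (r a) := fun _ ↦ rfl
  have h := congrArg (germEval m x)
    ((isUntwisted_germAlgebra H).pair_br_r hρ (toQuot _ u) (toQuot _ v) b)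
  simp only [hr, quotient_br, quotient_pair, quotient_act, map_sub, map_add, map_sum, map_mul,
    germEval_apply] at h
  exact h

/-- The pointwise form of `DorfmanAlgebra.IsUntwisted.pair_br_e`. -/
lemma pairing_bracket_e (H : ∀ᶠ y in 𝓝 x, C.IsAdaptedAt X Q ρ e d r y)
    (hρ : ∀ a b, Q.form (ρ a) b = b a) (u v : Cₛ^∞⟮𝓡 m; F, V⟯) (i : Fin m) :
    C.pairing x (C.bracket u v x) (e i x) = C.dorfmanAlgebra.act u (C.dorfmanAlgebra.pair v (e i)) x
      - C.dorfmanAlgebra.act v (C.dorfmanAlgebra.pair u (e i)) x +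
      (∑ j, C.dorfmanAlgebra.act (e i) (C.dorfmanAlgebra.pair u (d j)) x *
        C.pairing x (v x) (e j x) +
      ∑ j, C.dorfmanAlgebra.act (e i) (C.dorfmanAlgebra.pair u (e j)) x *
        C.pairing x (v x) (d j x) +
      ∑ a, C.dorfmanAlgebra.act (e i) (C.dorfmanAlgebra.pair u (r (Pi.single a 1))) x *
        C.pairing x (v x) (r (ρ a) x)) := by
  have hr : ∀ a, (toQuotReal (germIdeal m x) ∘ₗ r) a = toQuot (germIdeal m x) (r a) := fun _ ↦ rfl
  have h := congrArg (germEval m x)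
    ((isUntwisted_germAlgebra H).pair_br_e hρ (toQuot _ u) (toQuot _ v) i)
  simp only [hr, quotient_br, quotient_pair, quotient_act, map_sub, map_add, map_sum, map_mul,
    germEval_apply] at h
  exact h

end CourantAlgebroid

/-- The expansion of a vector in the dual basis. -/
lemma QuadraticLieAlgebra.sum_form_smul {n : ℕ} (Q : QuadraticLieAlgebra (Fin n → ℝ))
    {ρ : Fin n → Fin n → ℝ} (hρ : ∀ a b, Q.form (ρ a) b = b a) (c : Fin n → ℝ) :
    ∑ a, Q.form c (Pi.single a 1) • ρ a = c := by
  refine Q.ext_form fun b ↦ ?_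
  conv_rhs => rw [pi_eq_sum_univ' b]
  simp [hρ, mul_comm]

namespace CourantAlgebroid

variable {m : ℕ} {M : Type*} [TopologicalSpace M] [T2Space M]
  [ChartedSpace (EuclideanSpace ℝ (Fin m)) M] [IsManifold (𝓡 m) ∞ M]
  {F : Type*} [NormedAddCommGroup F] [NormedSpace ℝ F] [FiniteDimensional ℝ F]
  {V : M → Type*} [TopologicalSpace (TotalSpace F V)]
  [∀ x, TopologicalSpace (V x)] [∀ x, AddCommGroup (V x)] [∀ x, Module ℝ (V x)]
  [FiberBundle F V] [VectorBundle ℝ F V] [ContMDiffVectorBundle ∞ F V (𝓡 m)]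
  {C : CourantAlgebroid m F V} {X : Fin m → C^∞⟮𝓡 m, M; 𝓘(ℝ, ℝ), ℝ⟯} {n : ℕ}
  {Q : QuadraticLieAlgebra (Fin n → ℝ)} {ρ : Fin n → Fin n → ℝ} {e d : Fin m → Cₛ^∞⟮𝓡 m; F, V⟯}
  {r : (Fin n → ℝ) →ₗ[ℝ] Cₛ^∞⟮𝓡 m; F, V⟯} {x : M}

open DorfmanAlgebra

section Bracket

omit [T2Space M] [FiniteDimensional ℝ F] [ContMDiffVectorBundle ∞ F V (𝓡 m)] in
lemma dOneForm_toUntwisted (u : Cₛ^∞⟮𝓡 m; F, V⟯) (v w : TangentSpace (𝓡 m) x) :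
    dOneForm (fun y ↦ (C.toUntwisted X ρ e r y (u y)).2.1) x v w =
      ∑ j, (2 * mvfderiv (𝓡 m) (fun y ↦ C.pairing y (u y) (e j y)) x v *
          mvfderiv (𝓡 m) (X j) x w -
        2 * mvfderiv (𝓡 m) (fun y ↦ C.pairing y (u y) (e j y)) x w *
          mvfderiv (𝓡 m) (X j) x v) := by
  have h2 : ∀ (j : Fin m) (v : TangentSpace (𝓡 m) x),
      mvfderiv (𝓡 m) (fun y ↦ 2 * C.pairing y (u y) (e j y)) x v =
        2 * mvfderiv (𝓡 m) (fun y ↦ C.pairing y (u y) (e j y)) x v := fun j v ↦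
    mvfderiv_clm_comp ((2 : ℝ) • ContinuousLinearMap.id ℝ ℝ)
      ((C.pairing_smooth u (e j) x).mdifferentiableAt (by simp)) v
  rw [dOneForm_sum_smul_mvfderiv (f := fun j y ↦ 2 * C.pairing y (u y) (e j y)) (g := fun j ↦ X j)
    (fun j ↦ contMDiffAt_const.mul (C.pairing_smooth u (e j) x)) (fun j ↦ (X j).contMDiff x)
    (Eventually.of_forall fun y ↦ toUntwisted_form (u y))]
  simp only [h2]

omit [T2Space M] [FiniteDimensional ℝ F] [ContMDiffVectorBundle ∞ F V (𝓡 m)] in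
lemma form_mvfderiv_toUntwisted (hρ : ∀ a b, Q.form (ρ a) b = b a) (u : Cₛ^∞⟮𝓡 m; F, V⟯)
    (b : Fin n → ℝ) (w : TangentSpace (𝓡 m) x) :
    Q.form (mvfderiv (𝓡 m) (fun y ↦ (C.toUntwisted X ρ e r y (u y)).2.2) x w) b =
      mvfderiv (𝓡 m) (fun y ↦ C.pairing y (u y) (r b y)) x w := by
  have hlie : MDifferentiableAt (𝓡 m) 𝓘(ℝ, Fin n → ℝ)
      (fun y ↦ (C.toUntwisted X ρ e r y (u y)).2.2) x := by
    simp only [toUntwisted_lie]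
    refine ContMDiffAt.mdifferentiableAt (n := ∞) ?_ (by simp)
    exact contMDiffAt_finsetSum fun a _ ↦
      (C.pairing_smooth u (r (Pi.single a 1)) x).smul contMDiffAt_const
  have h := mvfderiv_clm_comp (LinearMap.toContinuousLinearMap (Q.form.flip b)) hlie w
  refine h.symm.trans (mvfderiv_congr (Eventually.of_forall fun y ↦ ?_) w)
  exact form_toUntwisted hρ (u y) b

omit [FiniteDimensional ℝ F] in
/-- The derivative of the function `ξ(X)` of two sections `v = Y + ξ + s` and `u = X + η + r`. -/
lemma mvfderiv_toUntwisted_apply (H : ∀ᶠ y in 𝓝 x, C.IsAdaptedAt X Q ρ e d r y)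
    (u v : Cₛ^∞⟮𝓡 m; F, V⟯) (w : Cₛ^∞⟮𝓡 m; F, V⟯) :
    mvfderiv (𝓡 m) (fun y ↦ (C.toUntwisted X ρ e r y (v y)).2.1 (C.anchor y (u y))) x
      (C.anchor x (w x)) =
    ∑ j, 2 * (C.pairing x (v x) (e j x) *
        C.dorfmanAlgebra.act w (C.dorfmanAlgebra.pair u (d j)) x +
      C.pairing x (u x) (d j x) *
        C.dorfmanAlgebra.act w (C.dorfmanAlgebra.pair v (e j)) x) := by
  have h2 : ∀ᶠ y in 𝓝 x, (C.toUntwisted X ρ e r y (v y)).2.1 (C.anchor y (u y)) =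
      (∑ j, (2 : ℝ) • (C.dorfmanAlgebra.pair v (e j) * C.dorfmanAlgebra.pair u (d j))) y := by
    filter_upwards [H] with y hy
    rw [toUntwisted_form, sum_apply, ContMDiffMap.sum_apply]
    refine Finset.sum_congr rfl fun j _ ↦ ?_
    rw [smul_apply, ← hy.grad, C.pairing_symm y (d j y), smul_eq_mul, mul_assoc]
    rfl
  rw [mvfderiv_congr h2, ← dorfmanAlgebra_act_apply, map_sum, ContMDiffMap.sum_apply]
  refine Finset.sum_congr rfl fun j _ ↦ ?_
  rw [Derivation.map_smul, Derivation.leibniz]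
  rfl

/-- The cotangent components of the brackets agree. Both sides are evaluated on the vectors
`∂ᵢ = π(e i)`, where the exterior derivatives are known from `dOneForm_toUntwisted`. -/
lemma toUntwisted_bracket_form (H : ∀ᶠ y in 𝓝 x, C.IsAdaptedAt X Q ρ e d r y)
    (hρ : ∀ a b, Q.form (ρ a) b = b a) (u v : Cₛ^∞⟮𝓡 m; F, V⟯) :
    (C.toUntwisted X ρ e r x (C.bracket u v x)).2.1 = (untwistedBracket Q
      (fun y ↦ C.toUntwisted X ρ e r y (u y)) (fun y ↦ C.toUntwisted X ρ e r y (v y)) x).2.1 := by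
  have Hx := H.self_of_nhds
  refine Hx.clm_ext fun i ↦ ?_
  have h1 : ∀ (u : Cₛ^∞⟮𝓡 m; F, V⟯) (j : Fin m), mvfderiv (𝓡 m) (X j) x (C.anchor x (u x)) =
      C.pairing x (u x) (d j x) := fun u j ↦ by
    rw [C.pairing_symm, Hx.grad]
  have h2 : Q.form (C.toUntwisted X ρ e r x (v x)).2.2
      (mvfderiv (𝓡 m) (fun y ↦ (C.toUntwisted X ρ e r y (u y)).2.2) x (C.anchor x (e i x))) =
      ∑ a, mvfderiv (𝓡 m) (fun y ↦ C.pairing y (u y) (r (Pi.single a 1) y)) x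
        (C.anchor x (e i x)) * C.pairing x (v x) (r (ρ a) x) := by
    rw [← Q.sum_form_smul hρ (mvfderiv (𝓡 m) _ x (C.anchor x (e i x)))]
    simp only [map_sum, map_smul, smul_eq_mul]
    simp only [form_mvfderiv_toUntwisted hρ, form_toUntwisted hρ]
  have h3 : ∀ u v : Cₛ^∞⟮𝓡 m; F, V⟯, dOneForm (fun y ↦ (C.toUntwisted X ρ e r y (v y)).2.1) x
      (C.anchor x (u x)) (C.anchor x (e i x)) =
      2 * C.dorfmanAlgebra.act u (C.dorfmanAlgebra.pair v (e i)) x -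
      2 * ∑ j, C.dorfmanAlgebra.act (e i) (C.dorfmanAlgebra.pair v (e j)) x *
        C.pairing x (u x) (d j x) := fun u v ↦ by
    rw [dOneForm_toUntwisted]
    simp only [Hx.act_e, h1, Finset.sum_sub_distrib, Matrix.one_apply, mul_ite, mul_one, mul_zero,
      Finset.sum_ite_eq, Finset.mem_univ, if_true, Finset.mul_sum, mul_assoc]
    rfl
  rw [Hx.toUntwisted_form_e, pairing_bracket_e H hρ]
  change _ = (mvfderiv (𝓡 m) (fun y ↦ (C.toUntwisted X ρ e r y (v y)).2.1 (C.anchor y (u y))) x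
    (C.anchor x (e i x)) + dOneForm (fun y ↦ (C.toUntwisted X ρ e r y (v y)).2.1) x
      (C.anchor x (u x)) (C.anchor x (e i x))) -
    dOneForm (fun y ↦ (C.toUntwisted X ρ e r y (u y)).2.1) x
      (C.anchor x (v x)) (C.anchor x (e i x)) +
    2 * Q.form (C.toUntwisted X ρ e r x (v x)).2.2
      (mvfderiv (𝓡 m) (fun y ↦ (C.toUntwisted X ρ e r y (u y)).2.2) x (C.anchor x (e i x)))
  rw [h2, h3, h3, mvfderiv_toUntwisted_apply H]
  simp only [← Finset.mul_sum, Finset.sum_add_distrib]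
  simp only [mul_comm (C.pairing x _ _)]
  have h4 : ∀ a, mvfderiv (𝓡 m) (fun y ↦ C.pairing y (u y) (r (Pi.single a 1) y)) x
      (C.anchor x (e i x)) = C.dorfmanAlgebra.act (e i)
        (C.dorfmanAlgebra.pair u (r (Pi.single a 1))) x := fun a ↦ rfl
  simp only [h4]
  ring

/-- The Lie algebra components of the brackets agree. -/
lemma toUntwisted_bracket_lie (H : ∀ᶠ y in 𝓝 x, C.IsAdaptedAt X Q ρ e d r y)
    (hρ : ∀ a b, Q.form (ρ a) b = b a) (u v : Cₛ^∞⟮𝓡 m; F, V⟯) :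
    (C.toUntwisted X ρ e r x (C.bracket u v x)).2.2 = (untwistedBracket Q
      (fun y ↦ C.toUntwisted X ρ e r y (u y)) (fun y ↦ C.toUntwisted X ρ e r y (v y)) x).2.2 := by
  refine Q.ext_form fun b ↦ ?_
  have h1 : Q.form (Q.bracket (C.toUntwisted X ρ e r x (u x)).2.2
      (C.toUntwisted X ρ e r x (v x)).2.2) b = ∑ a, C.pairing x (u x) (r (Pi.single a 1) x) *
        C.pairing x (v x) (r (Q.bracket b (ρ a)) x) := by
    rw [eq_neg_of_add_eq_zero_left (Q.form_invariant _ _ b), Q.bracket_eq_neg _ b, map_neg, neg_neg,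
      toUntwisted_lie (u x)]
    simp only [map_sum, map_smul, smul_eq_mul]
    simp only [form_toUntwisted hρ]
  rw [form_toUntwisted hρ, pairing_bracket_r H hρ]
  simp only [untwistedBracket, map_add, map_sub, LinearMap.add_apply, LinearMap.sub_apply,
    form_mvfderiv_toUntwisted hρ, h1]
  rfl

end Bracket

omit [FiniteDimensional ℝ F] [ContMDiffVectorBundle ∞ F V (𝓡 m)] in
/-- A section is smooth if and only if its image is: its image is computed with smooth scalar
products, and the section is recovered from its image by `IsAdaptedAt.eq_sum_toUntwisted`. -/
lemma contMDiffOn_iff_toUntwisted (hρ : ∀ a b, Q.form (ρ a) b = b a) {W : Set M} (hW : IsOpen W)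
    (H : ∀ y ∈ W, C.IsAdaptedAt X Q ρ e d r y) (u : ∀ x, V x) :
    ContMDiffOn (𝓡 m) ((𝓡 m).prod 𝓘(ℝ, F)) ∞ (fun x ↦ TotalSpace.mk' F x (u x)) W ↔
      IsSmoothSectionOn (fun x ↦ C.toUntwisted X ρ e r x (u x)) W := by
  constructor
  · intro hu
    have hs : ∀ x ∈ W, ∃ s : Cₛ^∞⟮𝓡 m; F, V⟯, ∀ᶠ y in 𝓝 x, s y = u y := fun x hx ↦
      exists_contMDiffSection_eventuallyEq (by
        filter_upwards [hW.mem_nhds hx] with y hy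
        exact hu.contMDiffAt (hW.mem_nhds hy))
    refine ⟨fun x hx ↦ ?_, fun x hx ↦ ?_, fun x hx ↦ ?_⟩
    · obtain ⟨s, hs⟩ := hs x hx
      refine ContMDiffAt.contMDiffWithinAt ((C.anchor_smooth s x).congr_of_eventuallyEq ?_)
      filter_upwards [hs] with y hy
      rw [hy]
      rfl
    · obtain ⟨s, hs⟩ := hs x hx
      refine ContMDiffAt.contMDiffWithinAt (ContMDiffAt.congr_of_eventuallyEq
        (ContMDiffAt.sum_section (s := Finset.univ)
        (t := fun j y ↦ (2 * C.pairing y (s y) (e j y)) • mvfderiv (𝓡 m) (X j) y) fun j _ ↦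
        ContMDiffAt.smul_section (contMDiffAt_const.mul (C.pairing_smooth s (e j) x))
        (contMDiffAt_mvfderiv ((X j).contMDiff x))) ?_)
      filter_upwards [hs] with y hy
      rw [toUntwisted_form, hy]
    · obtain ⟨s, hs⟩ := hs x hx
      refine ContMDiffAt.contMDiffWithinAt (ContMDiffAt.congr_of_eventuallyEq
        (contMDiffAt_finsetSum (t := Finset.univ)
          (f := fun a y ↦ C.pairing y (s y) (r (Pi.single a 1) y) • ρ a) fun a _ ↦
        (C.pairing_smooth s (r (Pi.single a 1)) x).smul contMDiffAt_const) ?_)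
      filter_upwards [hs] with y hy
      rw [toUntwisted_lie, hy]
  · rintro ⟨h1, h2, h3⟩ x hx
    have h1' := h1.contMDiffAt (hW.mem_nhds hx)
    have h2' := h2.contMDiffAt (hW.mem_nhds hx)
    have h3' := h3.contMDiffAt (hW.mem_nhds hx)
    refine ContMDiffAt.contMDiffWithinAt (ContMDiffAt.congr_of_eventuallyEq
      (ContMDiffAt.add_section (ContMDiffAt.add_section
        (ContMDiffAt.sum_section (s := Finset.univ)
          (t := fun i y ↦ mvfderiv (𝓡 m) (X i) y (C.toUntwisted X ρ e r y (u y)).1 • e i y)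
          fun i _ ↦ ContMDiffAt.smul_section
            (contMDiffAt_mvfderiv_apply ((X i).contMDiff x) h1') ((e i).contMDiff x))
        (ContMDiffAt.sum_section (s := Finset.univ)
          (t := fun i y ↦ ((1 / 2 : ℝ) * (C.toUntwisted X ρ e r y (u y)).2.1
            (C.anchor y (e i y))) • d i y)
          fun i _ ↦ ContMDiffAt.smul_section (contMDiffAt_const.mul
            ((contMDiffAt_totalSpace).1 (ContMDiffAt.clm_bundle_apply
            (E₂ := Bundle.Trivial M ℝ) (F₂ := ℝ) h2' (C.anchor_smooth (e i) x))).2)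
            ((d i).contMDiff x)))
        (ContMDiffAt.sum_section (s := Finset.univ)
          (t := fun a y ↦ Q.form (C.toUntwisted X ρ e r y (u y)).2.2 (Pi.single a 1) •
            r (ρ a) y)
          fun a _ ↦ ContMDiffAt.smul_section
            ((LinearMap.toContinuousLinearMap
              (Q.form.flip (Pi.single a 1))).contMDiff.contMDiffAt.comp x h3')
              ((r (ρ a)).contMDiff x))) ?_)
    filter_upwards [hW.mem_nhds hx] with y hy
    exact congrArg _ ((H y hy).eq_sum_toUntwisted hρ (u y))

end CourantAlgebroid

end

/-- Every transitive Courant algebroid is locally isomorphic to an untwisted one. -/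
theorem mainTheorem3 {m : ℕ} {M : Type*} [TopologicalSpace M] [T2Space M]
    [ChartedSpace (EuclideanSpace ℝ (Fin m)) M] [IsManifold (𝓡 m) ∞ M]
    {F : Type*} [NormedAddCommGroup F] [NormedSpace ℝ F] [FiniteDimensional ℝ F]
    {V : M → Type*} [TopologicalSpace (TotalSpace F V)]
    [∀ x, TopologicalSpace (V x)] [∀ x, AddCommGroup (V x)] [∀ x, Module ℝ (V x)]
    [FiberBundle F V] [VectorBundle ℝ F V] [ContMDiffVectorBundle ∞ F V (𝓡 m)]
    (C : CourantAlgebroid m F V) (hC : C.IsTransitive) (p : M) :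
    ∃ (U : TopologicalSpace.Opens M) (n : ℕ) (Q : QuadraticLieAlgebra (Fin n → ℝ)),
      p ∈ U ∧ Nonempty (C.UntwistedIsoOn Q U) := by
  obtain ⟨X, n, Q, ρ, e, d, r, hρ, H⟩ := CourantAlgebroid.exists_eventually_isAdaptedAt hC p
  obtain ⟨U, hU, hUo, hpU⟩ := eventually_nhds_iff.1 H
  exact ⟨⟨U, hUo⟩, n, Q, hpU, ⟨{
    toFun := C.toUntwisted X ρ e r
    bijective := fun x hx ↦ (hU x hx).bijective_toUntwisted hρ
    smooth_iff := fun W hWU u ↦ CourantAlgebroid.contMDiffOn_iff_toUntwisted hρ W.isOpen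
      (fun y hy ↦ hU y (hWU hy)) u
    map_pairing := fun x hx a b ↦ (hU x hx).pairing_toUntwisted hρ a b
    map_anchor := fun x hx a ↦ rfl
    map_bracket := fun u v x hx ↦ by
      have hx' := Filter.eventually_of_mem (hUo.mem_nhds hx) hU
      exact Prod.ext (CourantAlgebroid.anchor_bracket hC u v x) (Prod.ext
        (CourantAlgebroid.toUntwisted_bracket_form hx' hρ u v)
        (CourantAlgebroid.toUntwisted_bracket_lie hx' hρ u v)) }⟩⟩
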